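/- **Setting.** Let $\Bbbk$ be a commutative ring in which $2$ is invertible and let $N\ge 0$ be an integer. A *web* is an oriented trivalent graph whose edges carry thicknesses in $\mathbb N$; closed oriented circles are allowed. At each vertex it looks like a split (one edge of thickness $a+b$ enters, and a left edge of thickness $a$ and a right edge of thickness $b$ leave) or like a merge (the reverse). A closed foam is *in good position* if it is a composition, from the empty web to the empty web, of traces of isotopies of webs and of foams that are a product outside a cylinder and inside it are one of the following basic foams: (co)associativity foams, i.e. the exchange of the two bracketings of a split of a strand of thickness $a+b+c$ into strands $a,b,c$, or of such a merge (neighborhoods of a singular vertex); digon-cup and digon-cap (creation and removal of a digon with sides $a,b$ on a strand of thickness $a+b$); zip and unzip (two parallel strands of thickness $a$ and $b$ become a merge followed by a split, and the reverse); cup and cap (creation and removal of a circle of thickness $a$); and the saddle. It is *spherical* if no saddle is used. Its facets, which have thicknesses, meet along bindings, where a facet of thickness $a+b$ meets a left facet of thickness $a$ and a right facet of thickness $b$. Each facet of thickness $a$ carries a decoration $R\in\Bbbk[x_1,\dots,x_N]^{S_a\times S_{N-a}}$, to be read as a polynomial in $a$ variables of the facet and in the $N-a$ remaining variables. (If $a>N$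 there are no colorings and the evaluation below is zero.) **Evaluation.** A *coloring* $c$ of $F$ assigns to each facet $f$ of thickness $a$ a subset $c(f)\subseteq\{1,\dots,N\}$ with $a$ elements such that at every binding the set on the thick facet is the union of the sets on the two thin facets. Let $F_i(c)$ be the union of the facets with $i\in c(f)$. For $i<j$ let $F_{ij}(c)$ be the union of the facets for which $c(f)$ contains exactly one of $i,j$; it is a closed surface, and the bindings along which both $i$- and $j$-facets meet form circles on it. Let $\theta^+_{ij}(F,c)$ be the number of the circles that are positive, i.e. along which the left facet contains $i$ and the right facet contains $j$. Put $$s(F,c)=\sum_{i=1}^N i\,\frac{\chi(F_i(c))}2+\sum_{i<j}\theta^+_{ij}(F,c),\quad P(F,c)=\prod_f R_f(X_{c(f)},X_{\widehat{c(f)}}),\quad Q(F,c)=\prod_{i<j}(X_i-X_j)^{\chi(F_{ij}(c))/2},$$ where $\widehat{c(f)}$ is the complement of $c(f)$, and $$\langle F\rangle_N=\sum_c(-1)^{s(F,c)}\frac{P(F,c)}{Q(F,c)}\in\Bbbk[X_1,\dots,X_N]\bigl[(X_i-X_j)^{-1}\bigr]_{i<j},$$ extended linearly to linear combinations of foams.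 **Witt action.** For $n\ge-1$ let $\mathbf L_n=-\sum_i X_i^{n+1}\frac{\partial}{\partial X_i}$ on polynomials (with its unique extension to a derivation of the rational functions above). It preserves symmetric polynomials. A *Witt sequence* is a sequence $(\lambda_n)_{n\ge-1}$ in $\Bbbk$ with $\lambda_{-1}=0$ and $n\lambda_n-m\lambda_m=(n-m)\lambda_{m+n}$ for all $m,n\ge0$. Fix $s\in\Bbbk$ and Witt sequences $\lambda,\mu,\nu$. Write $p_k$ for the $k$-th power sum in the variables of a facet and $\hat p_k$ for the one in the remaining $N-a$ variables ($p_0=a$, $\hat p_0=N-a$, and $p_k=\hat p_k=0$ for $k<0$); write $(p_k,p_l)$ for the same basic foam with $p_k$ on the left thin facet and $p_l$ on the right one. Sums run over $k,l\ge0$. Define $L_n$ on linear combinations of decorated closed foams in good position by the Leibniz rule (for compositions, and for products of decorations and basic foams) and by: * a decoration $R$ is sent to $\mathbf L_nR$, where $\mathbf L_n$ acts on all $N$ variables of $R$; * traces of isotopies and (co)associativity foams are sent to $0$; * digon-cup $\mapsto \lambda_n(p_n,p_0)+\mu_n(p_0,p_n)+s\sum_{k+l=n}(p_k,p_l)$;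 * digon-cap $\mapsto -\lambda_n(p_n,p_0)-\mu_n(p_0,p_n)+(1-s)\sum_{k+l=n}(p_k,p_l)$; * zip $\mapsto \lambda_n(p_n,p_0)+\mu_n(p_0,p_n)-(1-s)\sum_{k+l=n}(p_k,p_l)$; * unzip $\mapsto -\lambda_n(p_n,p_0)-\mu_n(p_0,p_n)-s\sum_{k+l=n}(p_k,p_l)$; * cup $\mapsto$ the cup decorated with $\nu_n\,p_0\hat p_n-\nu_n\,p_n\hat p_0+\frac12\sum_{k+l=n}p_k\hat p_l$; * cap $\mapsto$ the cap decorated with $-\nu_n\,p_0\hat p_n+\nu_n\,p_n\hat p_0+\frac12\sum_{k+l=n}p_k\hat p_l$. **Proposition.** For every closed spherical foam $F$ in good position (with decorations) and every integer $n\ge-1$, $$\langle L_n\cdot F\rangle_N=\mathbf L_n\cdot\langle F\rangle_N .$$ In particular, when $\langle F\rangle_N$ is a symmetric polynomial, the right side is the usual action of $\mathbf L_n$ on symmetric polynomials. -/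

import Mathlib

/-! Foams in good position, their evaluation, and the action of one half of the Witt algebra.

A foam in `ℝ² × [0,1]` in good position is a composition of basic foams, and it is encoded by its
movie.  The webs of the movie are recorded as finite cellular graphs: oriented, with thicknesses,
with a left and a right thin edge at each trivalent vertex, and with auxiliary bivalent marked
points subdividing the edges (so that circles also have a cell structure).  The foam swept out by
the movie is a finite two-dimensional cell complex.  Colorings, Euler characteristics of monochrome
and bichrome surfaces, separating circles and their signs are read off that complex.  Nothing below
uses planarity of the webs, which is therefore not imposed: every foam in good position in
`ℝ² × [0,1]` is covered. -/

universe u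

namespace WittFoam

noncomputable section

/-! ### Webs and tangles -/

/-- The places where an oriented edge of a web in a disk can start: a point of the boundary of the
disk, a marked point, the left or the right thin slot of a split vertex, the thick slot of a merge
vertex.  Left and right are with respect to the orientation of the edges. -/
inductive Start (In M S G : Type) : Type
  | boundary (p : In)
  | mark (m : M)
  | splitLeft (v : S)
  | splitRight (v : S)
  | merge (v : G)

/-- The places where an oriented edge of a web in a disk can finish. -/
inductive Finish (Out M S G : Type) : Type
  | boundary (p : Out)
  | mark (m : M)
  | split (v : S)
  | mergeLeft (v : G)
  | mergeRight (v : G)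

/-- A (cellular) web with boundary.  `In` and `Out` are the boundary points where strands enter and
exit, with thicknesses `wIn` and `wOut`. -/
structure Tangle {In Out : Type} (wIn : In → ℕ) (wOut : Out → ℕ) : Type 1 where
  Edge : Type
  Mark : Type
  Split : Type
  Merge : Type
  [fintypeEdge : Fintype Edge]
  [fintypeMark : Fintype Mark]
  [fintypeSplit : Fintype Split]
  [fintypeMerge : Fintype Merge]
  start : Edge ≃ Start In Mark Split Merge
  finish : Edge ≃ Finish Out Mark Split Merge
  thickness : Edge → ℕ
  thickness_in : ∀ p, thickness (start.symm (.boundary p)) = wIn p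
  thickness_out : ∀ p, thickness (finish.symm (.boundary p)) = wOut p
  thickness_mark : ∀ m, thickness (start.symm (.mark m)) = thickness (finish.symm (.mark m))
  thickness_split : ∀ v, thickness (finish.symm (.split v)) =
    thickness (start.symm (.splitLeft v)) + thickness (start.symm (.splitRight v))
  thickness_merge : ∀ v, thickness (start.symm (.merge v)) =
    thickness (finish.symm (.mergeLeft v)) + thickness (finish.symm (.mergeRight v))

attribute [instance] Tangle.fintypeEdge Tangle.fintypeMark Tangle.fintypeSplit Tangle.fintypeMerge

/-- The empty family of thicknesses. -/
abbrev noPoints : Empty → ℕ := fun x => x.elim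

/-- A closed web. -/
abbrev Web : Type 1 := Tangle noPoints noPoints

section Tangle

variable {In Out : Type} {wIn : In → ℕ} {wOut : Out → ℕ}

/-- Trivalent vertices. -/
abbrev Tangle.Node (T : Tangle wIn wOut) : Type := T.Split ⊕ T.Merge

/-- All vertices (marked points, split vertices, merge vertices). -/
abbrev Tangle.Vertex (T : Tangle wIn wOut) : Type := T.Mark ⊕ T.Node

/-- The edge `e` is adjacent to the vertex. -/
def Tangle.Touches (T : Tangle wIn wOut) (e : T.Edge) : T.Vertex → Prop
  | .inl m => e = T.start.symm (.mark m) ∨ e = T.finish.symm (.mark m)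
  | .inr (.inl v) => e = T.finish.symm (.split v) ∨ e = T.start.symm (.splitLeft v) ∨
      e = T.start.symm (.splitRight v)
  | .inr (.inr v) => e = T.start.symm (.merge v) ∨ e = T.finish.symm (.mergeLeft v) ∨
      e = T.finish.symm (.mergeRight v)

/-- The thick edge at a trivalent vertex. -/
def Tangle.thickEdge (T : Tangle wIn wOut) : T.Node → T.Edge
  | .inl v => T.finish.symm (.split v)
  | .inr v => T.start.symm (.merge v)

/-- The left thin edge at a trivalent vertex. -/
def Tangle.leftEdge (T : Tangle wIn wOut) : T.Node → T.Edge
  | .inl v => T.start.symm (.splitLeft v)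
  | .inr v => T.finish.symm (.mergeLeft v)

/-- The right thin edge at a trivalent vertex. -/
def Tangle.rightEdge (T : Tangle wIn wOut) : T.Node → T.Edge
  | .inl v => T.start.symm (.splitRight v)
  | .inr v => T.finish.symm (.mergeRight v)

theorem Tangle.thickness_node (T : Tangle wIn wOut) (v : T.Node) :
    T.thickness (T.thickEdge v) = T.thickness (T.leftEdge v) + T.thickness (T.rightEdge v) := by
  rcases v with v | v
  · exact T.thickness_split v
  · exact T.thickness_merge v

/-- Starts in a web glued from an outside part and an inside part: every boundary point of the
disk becomes a marked point. -/
def Start.glue (In Out M M' S S' G G' : Type) :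
    Start Out M S G ⊕ Start In M' S' G' ≃
      Start Empty ((M ⊕ M') ⊕ (In ⊕ Out)) (S ⊕ S') (G ⊕ G') where
  toFun
    | .inl (.boundary q) => .mark (.inr (.inr q))
    | .inl (.mark m) => .mark (.inl (.inl m))
    | .inl (.splitLeft v) => .splitLeft (.inl v)
    | .inl (.splitRight v) => .splitRight (.inl v)
    | .inl (.merge v) => .merge (.inl v)
    | .inr (.boundary p) => .mark (.inr (.inl p))
    | .inr (.mark m) => .mark (.inl (.inr m))
    | .inr (.splitLeft v) => .splitLeft (.inr v)
    | .inr (.splitRight v) => .splitRight (.inr v)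
    | .inr (.merge v) => .merge (.inr v)
  invFun
    | .mark (.inr (.inr q)) => .inl (.boundary q)
    | .mark (.inl (.inl m)) => .inl (.mark m)
    | .splitLeft (.inl v) => .inl (.splitLeft v)
    | .splitRight (.inl v) => .inl (.splitRight v)
    | .merge (.inl v) => .inl (.merge v)
    | .mark (.inr (.inl p)) => .inr (.boundary p)
    | .mark (.inl (.inr m)) => .inr (.mark m)
    | .splitLeft (.inr v) => .inr (.splitLeft v)
    | .splitRight (.inr v) => .inr (.splitRight v)
    | .merge (.inr v) => .inr (.merge v)
  left_inv := by rintro ((_ | _ | _ | _ | _) | (_ | _ | _ | _ | _)) <;> rfl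
  right_inv := by
    rintro (x | ((_ | _) | (_ | _)) | (_ | _) | (_ | _) | (_ | _)) <;> first | rfl | exact x.elim

/-- Finishes in a web glued from an outside part and an inside part. -/
def Finish.glue (In Out M M' S S' G G' : Type) :
    Finish In M S G ⊕ Finish Out M' S' G' ≃
      Finish Empty ((M ⊕ M') ⊕ (In ⊕ Out)) (S ⊕ S') (G ⊕ G') where
  toFun
    | .inl (.boundary p) => .mark (.inr (.inl p))
    | .inl (.mark m) => .mark (.inl (.inl m))
    | .inl (.split v) => .split (.inl v)
    | .inl (.mergeLeft v) => .mergeLeft (.inl v)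
    | .inl (.mergeRight v) => .mergeRight (.inl v)
    | .inr (.boundary q) => .mark (.inr (.inr q))
    | .inr (.mark m) => .mark (.inl (.inr m))
    | .inr (.split v) => .split (.inr v)
    | .inr (.mergeLeft v) => .mergeLeft (.inr v)
    | .inr (.mergeRight v) => .mergeRight (.inr v)
  invFun
    | .mark (.inr (.inl p)) => .inl (.boundary p)
    | .mark (.inl (.inl m)) => .inl (.mark m)
    | .split (.inl v) => .inl (.split v)
    | .mergeLeft (.inl v) => .inl (.mergeLeft v)
    | .mergeRight (.inl v) => .inl (.mergeRight v)
    | .mark (.inr (.inr q)) => .inr (.boundary q)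
    | .mark (.inl (.inr m)) => .inr (.mark m)
    | .split (.inr v) => .inr (.split v)
    | .mergeLeft (.inr v) => .inr (.mergeLeft v)
    | .mergeRight (.inr v) => .inr (.mergeRight v)
  left_inv := by rintro ((_ | _ | _ | _ | _) | (_ | _ | _ | _ | _)) <;> rfl
  right_inv := by
    rintro (x | ((_ | _) | (_ | _)) | (_ | _) | (_ | _) | (_ | _)) <;> first | rfl | exact x.elim

/-- The web which is `T` inside a disk and `K` outside of it.  A strand which enters the disk
exits from `K`, and conversely. -/
def Tangle.glue [Fintype In] [Fintype Out] (K : Tangle wOut wIn) (T : Tangle wIn wOut) : Web where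
  Edge := K.Edge ⊕ T.Edge
  Mark := (K.Mark ⊕ T.Mark) ⊕ (In ⊕ Out)
  Split := K.Split ⊕ T.Split
  Merge := K.Merge ⊕ T.Merge
  start := (K.start.sumCongr T.start).trans (Start.glue _ _ _ _ _ _ _ _)
  finish := (K.finish.sumCongr T.finish).trans (Finish.glue _ _ _ _ _ _ _ _)
  thickness := Sum.elim K.thickness T.thickness
  thickness_in p := p.elim
  thickness_out p := p.elim
  thickness_mark := by
    rintro ((m | m) | (p | q))
    · exact K.thickness_mark m
    · exact T.thickness_mark m
    · exact (T.thickness_in p).trans (K.thickness_out p).symm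
    · exact (K.thickness_in q).trans (T.thickness_out q).symm
  thickness_split := by
    rintro (v | v)
    · exact K.thickness_split v
    · exact T.thickness_split v
  thickness_merge := by
    rintro (v | v)
    · exact K.thickness_merge v
    · exact T.thickness_merge v

end Tangle

/-- Functoriality of `Start` in the sets of vertices. -/
def Start.map {In M M' S S' G G' : Type} (f : M → M') (g : S → S') (h : G → G') :
    Start In M S G → Start In M' S' G'
  | .boundary p => .boundary p
  | .mark m => .mark (f m)
  | .splitLeft v => .splitLeft (g v)
  | .splitRight v => .splitRight (g v)
  | .merge v => .merge (h v)

/-- Functoriality of `Finish` in the sets of vertices. -/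
def Finish.map {Out M M' S S' G G' : Type} (f : M → M') (g : S → S') (h : G → G') :
    Finish Out M S G → Finish Out M' S' G'
  | .boundary p => .boundary p
  | .mark m => .mark (f m)
  | .split v => .split (g v)
  | .mergeLeft v => .mergeLeft (h v)
  | .mergeRight v => .mergeRight (h v)

/-- An isomorphism of webs: what an isotopy carrying one web to another does to their cells. -/
structure WebIso (Γ Γ' : Web) : Type where
  edge : Γ.Edge ≃ Γ'.Edge
  mark : Γ.Mark ≃ Γ'.Mark
  split : Γ.Split ≃ Γ'.Split
  merge : Γ.Merge ≃ Γ'.Merge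
  start_edge : ∀ e, Γ'.start (edge e) = (Γ.start e).map mark split merge
  finish_edge : ∀ e, Γ'.finish (edge e) = (Γ.finish e).map mark split merge
  thickness_edge : ∀ e, Γ'.thickness (edge e) = Γ.thickness e

/-- Starts in a subdivided web. -/
def Start.subdivide (M S G : Type) : Option (Start Empty M S G) ≃ Start Empty (Option M) S G where
  toFun
    | none => .mark none
    | some (.boundary p) => .boundary p
    | some (.mark m) => .mark (some m)
    | some (.splitLeft v) => .splitLeft v
    | some (.splitRight v) => .splitRight v
    | some (.merge v) => .merge v
  invFun
    | .mark none => none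
    | .boundary p => some (.boundary p)
    | .mark (some m) => some (.mark m)
    | .splitLeft v => some (.splitLeft v)
    | .splitRight v => some (.splitRight v)
    | .merge v => some (.merge v)
  left_inv := by rintro (_ | (_ | _ | _ | _ | _)) <;> rfl
  right_inv := by rintro (_ | (_ | _) | _ | _ | _) <;> rfl

/-- Finishes in a subdivided web. -/
def Finish.subdivide (M S G : Type) : Option (Finish Empty M S G) ≃ Finish Empty (Option M) S G where
  toFun
    | none => .mark none
    | some (.boundary p) => .boundary p
    | some (.mark m) => .mark (some m)
    | some (.split v) => .split v
    | some (.mergeLeft v) => .mergeLeft v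
    | some (.mergeRight v) => .mergeRight v
  invFun
    | .mark none => none
    | .boundary p => some (.boundary p)
    | .mark (some m) => some (.mark m)
    | .split v => some (.split v)
    | .mergeLeft v => some (.mergeLeft v)
    | .mergeRight v => some (.mergeRight v)
  left_inv := by rintro (_ | (_ | _ | _ | _ | _)) <;> rfl
  right_inv := by rintro (_ | (_ | _) | _ | _ | _) <;> rfl

open Classical in
theorem swap_getD {E : Type} (e : E) (y : Option E) :
    (Equiv.swap (some e) none y).getD e = y.getD e := by
  rcases eq_or_ne y none with rfl | hy
  · simp
  · rcases eq_or_ne y (some e) with rfl | hy'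
    · simp
    · rw [Equiv.swap_apply_of_ne_of_ne hy' hy]

open Classical in
/-- The same web with one more marked point, `none`, on the edge `e`: the edge `some e` is now the
first half of `e`, and the edge `none` is the second half of `e`. -/
def Tangle.subdivide (Γ : Web) (e : Γ.Edge) : Web where
  Edge := Option Γ.Edge
  Mark := Option Γ.Mark
  Split := Γ.Split
  Merge := Γ.Merge
  start := (Equiv.optionCongr Γ.start).trans (Start.subdivide _ _ _)
  finish := (Equiv.swap (some e) none).trans
    ((Equiv.optionCongr Γ.finish).trans (Finish.subdivide _ _ _))
  thickness x := Γ.thickness (x.getD e)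
  thickness_in p := p.elim
  thickness_out p := p.elim
  thickness_mark := by
    have h := swap_getD e
    rintro (_ | m)
    · exact congrArg Γ.thickness (h none).symm
    · exact (Γ.thickness_mark m).trans (congrArg Γ.thickness (h (some _)).symm)
  thickness_split v := by
    have h := swap_getD e
    exact (congrArg Γ.thickness (h (some _))).trans (Γ.thickness_split v)
  thickness_merge v := by
    have h := swap_getD e
    exact (Γ.thickness_merge v).trans
      (congrArg₂ (· + ·) (congrArg Γ.thickness (h (some _)).symm)
        (congrArg Γ.thickness (h (some _)).symm))

/-! ### The webs in a disk that bound the local models -/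

/-- The empty web in a disk without boundary points. -/
def nothing : Tangle noPoints noPoints where
  Edge := Empty
  Mark := Empty
  Split := Empty
  Merge := Empty
  start := ⟨fun e => e.elim, fun x => by rcases x with x | x | x | x | x <;> exact x.elim,
    fun e => e.elim, fun x => by rcases x with x | x | x | x | x <;> exact x.elim⟩
  finish := ⟨fun e => e.elim, fun x => by rcases x with x | x | x | x | x <;> exact x.elim,
    fun e => e.elim, fun x => by rcases x with x | x | x | x | x <;> exact x.elim⟩
  thickness e := e.elim
  thickness_in p := p.elim
  thickness_out p := p.elim
  thickness_mark p := p.elim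
  thickness_split p := p.elim
  thickness_merge p := p.elim

/-- A circle of thickness `a`, with one marked point. -/
def circle (a : ℕ) : Tangle noPoints noPoints where
  Edge := Unit
  Mark := Unit
  Split := Empty
  Merge := Empty
  start := ⟨fun _ => .mark (), fun _ => (), fun _ => rfl, fun x => by
    rcases x with x | x | x | x | x <;> first | rfl | exact x.elim⟩
  finish := ⟨fun _ => .mark (), fun _ => (), fun _ => rfl, fun x => by
    rcases x with x | x | x | x | x <;> first | rfl | exact x.elim⟩
  thickness _ := a
  thickness_in p := p.elim
  thickness_out p := p.elim
  thickness_mark _ := rfl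
  thickness_split p := p.elim
  thickness_merge p := p.elim

/-- One strand of thickness `a`. -/
def strand (a : ℕ) : Tangle (fun _ : Unit => a) (fun _ : Unit => a) where
  Edge := Unit
  Mark := Empty
  Split := Empty
  Merge := Empty
  start := ⟨fun _ => .boundary (), fun _ => (), fun _ => rfl, fun x => by
    rcases x with x | x | x | x | x <;> first | rfl | exact x.elim⟩
  finish := ⟨fun _ => .boundary (), fun _ => (), fun _ => rfl, fun x => by
    rcases x with x | x | x | x | x <;> first | rfl | exact x.elim⟩
  thickness _ := a
  thickness_in _ := rfl
  thickness_out _ := rfl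
  thickness_mark p := p.elim
  thickness_split p := p.elim
  thickness_merge p := p.elim

/-- The edges of a digon. -/
inductive DigonEdge | before | left | right | after
  deriving DecidableEq

instance : Fintype DigonEdge := ⟨{.before, .left, .right, .after}, fun x => by cases x <;> decide⟩

/-- A thick strand of thickness `a + b` with a digon whose sides have thickness `a` (left) and `b`
(right). -/
def digon (a b : ℕ) : Tangle (fun _ : Unit => a + b) (fun _ : Unit => a + b) where
  Edge := DigonEdge
  Mark := Empty
  Split := Unit
  Merge := Unit
  start :=
    ⟨fun | .before => .boundary () | .left => .splitLeft () | .right => .splitRight ()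
         | .after => .merge (),
     fun | .boundary _ => .before | .mark m => m.elim | .splitLeft _ => .left
         | .splitRight _ => .right | .merge _ => .after,
     fun e => by cases e <;> rfl,
     fun x => by rcases x with x | x | x | x | x <;> first | rfl | exact x.elim⟩
  finish :=
    ⟨fun | .before => .split () | .left => .mergeLeft () | .right => .mergeRight ()
         | .after => .boundary (),
     fun | .boundary _ => .after | .mark m => m.elim | .split _ => .before
         | .mergeLeft _ => .left | .mergeRight _ => .right,
     fun e => by cases e <;> rfl,
     fun x => by rcases x with x | x | x | x | x <;> first | rfl | exact x.elim⟩
  thickness | .before => a + b | .left => a | .right => b | .after => a + b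
  thickness_in _ := rfl
  thickness_out _ := rfl
  thickness_mark p := p.elim
  thickness_split _ := rfl
  thickness_merge _ := rfl

/-- Left and right. -/
inductive Side | left | right
  deriving DecidableEq

instance : Fintype Side := ⟨{.left, .right}, fun x => by cases x <;> decide⟩

/-- The thicknesses of two parallel strands. -/
def Side.width (a b : ℕ) : Side → ℕ
  | .left => a
  | .right => b

/-- Two parallel strands with the same direction, of thickness `a` (left) and `b` (right). -/
def parallel (a b : ℕ) : Tangle (Side.width a b) (Side.width a b) where
  Edge := Side
  Mark := Empty
  Split := Empty
  Merge := Empty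
  start :=
    ⟨fun e => .boundary e,
     fun | .boundary e => e | .mark v => v.elim | .splitLeft v => v.elim
         | .splitRight v => v.elim | .merge v => v.elim,
     fun _ => rfl,
     fun x => by rcases x with x | x | x | x | x <;> first | rfl | exact x.elim⟩
  finish :=
    ⟨fun e => .boundary e,
     fun | .boundary e => e | .mark v => v.elim | .split v => v.elim
         | .mergeLeft v => v.elim | .mergeRight v => v.elim,
     fun _ => rfl,
     fun x => by rcases x with x | x | x | x | x <;> first | rfl | exact x.elim⟩
  thickness := Side.width a b
  thickness_in _ := rfl
  thickness_out _ := rfl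
  thickness_mark p := p.elim
  thickness_split p := p.elim
  thickness_merge p := p.elim

/-- The edges of a dumbbell. -/
inductive DumbbellEdge | leftIn | rightIn | thick | leftOut | rightOut
  deriving DecidableEq

instance : Fintype DumbbellEdge := ⟨{.leftIn, .rightIn, .thick, .leftOut, .rightOut}, fun x => by cases x <;> decide⟩

/-- Strands of thickness `a` (left) and `b` (right) merge into a thick edge which then splits
again. -/
def dumbbell (a b : ℕ) : Tangle (Side.width a b) (Side.width a b) where
  Edge := DumbbellEdge
  Mark := Empty
  Split := Unit
  Merge := Unit
  start :=
    ⟨fun | .leftIn => .boundary .left | .rightIn => .boundary .right | .thick => .merge ()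
         | .leftOut => .splitLeft () | .rightOut => .splitRight (),
     fun | .boundary .left => .leftIn | .boundary .right => .rightIn | .mark m => m.elim
         | .splitLeft _ => .leftOut | .splitRight _ => .rightOut | .merge _ => .thick,
     fun e => by cases e <;> rfl,
     fun x => by rcases x with (_ | _) | x | x | x | x <;> first | rfl | exact x.elim⟩
  finish :=
    ⟨fun | .leftIn => .mergeLeft () | .rightIn => .mergeRight () | .thick => .split ()
         | .leftOut => .boundary .left | .rightOut => .boundary .right,
     fun | .boundary .left => .leftOut | .boundary .right => .rightOut | .mark m => m.elim
         | .split _ => .thick | .mergeLeft _ => .leftIn | .mergeRight _ => .rightIn,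
     fun e => by cases e <;> rfl,
     fun x => by rcases x with (_ | _) | x | x | x | x <;> first | rfl | exact x.elim⟩
  thickness | .leftIn => a | .rightIn => b | .thick => a + b | .leftOut => a | .rightOut => b
  thickness_in p := by cases p <;> rfl
  thickness_out p := by cases p <;> rfl
  thickness_mark p := p.elim
  thickness_split _ := rfl
  thickness_merge _ := rfl

/-- Two strands of thickness `a`.  The strand entering at the boundary point `p` exits at the
boundary point `σ p`. -/
def twoStrands (a : ℕ) (σ : Equiv.Perm Side) : Tangle (fun _ : Side => a) (fun _ : Side => a) where
  Edge := Side
  Mark := Empty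
  Split := Empty
  Merge := Empty
  start :=
    ⟨fun e => .boundary e,
     fun | .boundary e => e | .mark v => v.elim | .splitLeft v => v.elim
         | .splitRight v => v.elim | .merge v => v.elim,
     fun _ => rfl,
     fun x => by rcases x with x | x | x | x | x <;> first | rfl | exact x.elim⟩
  finish :=
    ⟨fun e => .boundary (σ e),
     fun | .boundary e => σ.symm e | .mark v => v.elim | .split v => v.elim
         | .mergeLeft v => v.elim | .mergeRight v => v.elim,
     fun e => σ.symm_apply_apply e,
     fun x => by
      rcases x with x | x | x | x | x <;>
        first | exact congrArg Finish.boundary (σ.apply_symm_apply x) | exact x.elim⟩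
  thickness _ := a
  thickness_in _ := rfl
  thickness_out _ := rfl
  thickness_mark p := p.elim
  thickness_split p := p.elim
  thickness_merge p := p.elim

/-- The three legs of a tree, from left to right. -/
inductive Leg | a | b | c
  deriving DecidableEq

instance : Fintype Leg := ⟨{.a, .b, .c}, fun x => by cases x <;> decide⟩

/-- The thicknesses of the legs. -/
def Leg.width (a b c : ℕ) : Leg → ℕ
  | .a => a
  | .b => b
  | .c => c

/-- The edges of a tree with three legs. -/
inductive TreeEdge | trunk | middle | leg (l : Leg)
  deriving DecidableEq

instance : Fintype TreeEdge := ⟨{.trunk, .middle, .leg .a, .leg .b, .leg .c}, fun x => by rcases x with _ | _ | (_ | _ | _) <;> decide⟩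

/-- The vertices of a tree with three legs: the one at the trunk and the other one. -/
inductive TreeNode | outer | inner
  deriving DecidableEq

instance : Fintype TreeNode := ⟨{.outer, .inner}, fun x => by cases x <;> decide⟩

/-- The trunk splits into `(a + b, c)`, and then `a + b` splits into `(a, b)`. -/
def splitTreeLeft (a b c : ℕ) : Tangle (fun _ : Unit => a + b + c) (Leg.width a b c) where
  Edge := TreeEdge
  Mark := Empty
  Split := TreeNode
  Merge := Empty
  start :=
    ⟨fun | .trunk => .boundary () | .middle => .splitLeft .outer
         | .leg .c => .splitRight .outer | .leg .a => .splitLeft .inner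
         | .leg .b => .splitRight .inner,
     fun | .boundary _ => .trunk | .mark m => m.elim | .splitLeft .outer => .middle
         | .splitRight .outer => .leg .c | .splitLeft .inner => .leg .a
         | .splitRight .inner => .leg .b | .merge v => v.elim,
     fun e => by rcases e with _ | _ | (_ | _ | _) <;> rfl,
     fun x => by rcases x with x | x | (_ | _) | (_ | _) | x <;> first | rfl | exact x.elim⟩
  finish :=
    ⟨fun | .trunk => .split .outer | .middle => .split .inner | .leg l => .boundary l,
     fun | .boundary l => .leg l | .mark m => m.elim | .split .outer => .trunk
         | .split .inner => .middle | .mergeLeft v => v.elim | .mergeRight v => v.elim,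
     fun e => by cases e <;> rfl,
     fun x => by rcases x with x | x | (_ | _) | x | x <;> first | rfl | exact x.elim⟩
  thickness | .trunk => a + b + c | .middle => a + b | .leg l => l.width a b c
  thickness_in _ := rfl
  thickness_out _ := rfl
  thickness_mark p := p.elim
  thickness_split v := by cases v <;> rfl
  thickness_merge p := p.elim

/-- The trunk splits into `(a, b + c)`, and then `b + c` splits into `(b, c)`. -/
def splitTreeRight (a b c : ℕ) : Tangle (fun _ : Unit => a + b + c) (Leg.width a b c) where
  Edge := TreeEdge
  Mark := Empty
  Split := TreeNode
  Merge := Empty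
  start :=
    ⟨fun | .trunk => .boundary () | .middle => .splitRight .outer
         | .leg .a => .splitLeft .outer | .leg .b => .splitLeft .inner
         | .leg .c => .splitRight .inner,
     fun | .boundary _ => .trunk | .mark m => m.elim | .splitRight .outer => .middle
         | .splitLeft .outer => .leg .a | .splitLeft .inner => .leg .b
         | .splitRight .inner => .leg .c | .merge v => v.elim,
     fun e => by rcases e with _ | _ | (_ | _ | _) <;> rfl,
     fun x => by rcases x with x | x | (_ | _) | (_ | _) | x <;> first | rfl | exact x.elim⟩
  finish :=
    ⟨fun | .trunk => .split .outer | .middle => .split .inner | .leg l => .boundary l,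
     fun | .boundary l => .leg l | .mark m => m.elim | .split .outer => .trunk
         | .split .inner => .middle | .mergeLeft v => v.elim | .mergeRight v => v.elim,
     fun e => by cases e <;> rfl,
     fun x => by rcases x with x | x | (_ | _) | x | x <;> first | rfl | exact x.elim⟩
  thickness | .trunk => a + b + c | .middle => b + c | .leg l => l.width a b c
  thickness_in _ := rfl
  thickness_out _ := rfl
  thickness_mark p := p.elim
  thickness_split v := by
    cases v
    · exact Nat.add_assoc a b c
    · rfl
  thickness_merge p := p.elim

/-- `(a, b)` merge into `a + b`, and then `(a + b, c)` merge into the trunk. -/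
def mergeTreeLeft (a b c : ℕ) : Tangle (Leg.width a b c) (fun _ : Unit => a + b + c) where
  Edge := TreeEdge
  Mark := Empty
  Split := Empty
  Merge := TreeNode
  start :=
    ⟨fun | .trunk => .merge .outer | .middle => .merge .inner | .leg l => .boundary l,
     fun | .boundary l => .leg l | .mark m => m.elim | .merge .outer => .trunk
         | .merge .inner => .middle | .splitLeft v => v.elim | .splitRight v => v.elim,
     fun e => by cases e <;> rfl,
     fun x => by rcases x with x | x | x | x | (_ | _) <;> first | rfl | exact x.elim⟩
  finish :=
    ⟨fun | .trunk => .boundary () | .middle => .mergeLeft .outer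
         | .leg .c => .mergeRight .outer | .leg .a => .mergeLeft .inner
         | .leg .b => .mergeRight .inner,
     fun | .boundary _ => .trunk | .mark m => m.elim | .mergeLeft .outer => .middle
         | .mergeRight .outer => .leg .c | .mergeLeft .inner => .leg .a
         | .mergeRight .inner => .leg .b | .split v => v.elim,
     fun e => by rcases e with _ | _ | (_ | _ | _) <;> rfl,
     fun x => by rcases x with x | x | x | (_ | _) | (_ | _) <;> first | rfl | exact x.elim⟩
  thickness | .trunk => a + b + c | .middle => a + b | .leg l => l.width a b c
  thickness_in _ := rfl
  thickness_out _ := rfl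
  thickness_mark p := p.elim
  thickness_split p := p.elim
  thickness_merge v := by cases v <;> rfl

/-- `(b, c)` merge into `b + c`, and then `(a, b + c)` merge into the trunk. -/
def mergeTreeRight (a b c : ℕ) : Tangle (Leg.width a b c) (fun _ : Unit => a + b + c) where
  Edge := TreeEdge
  Mark := Empty
  Split := Empty
  Merge := TreeNode
  start :=
    ⟨fun | .trunk => .merge .outer | .middle => .merge .inner | .leg l => .boundary l,
     fun | .boundary l => .leg l | .mark m => m.elim | .merge .outer => .trunk
         | .merge .inner => .middle | .splitLeft v => v.elim | .splitRight v => v.elim,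
     fun e => by cases e <;> rfl,
     fun x => by rcases x with x | x | x | x | (_ | _) <;> first | rfl | exact x.elim⟩
  finish :=
    ⟨fun | .trunk => .boundary () | .middle => .mergeRight .outer
         | .leg .a => .mergeLeft .outer | .leg .b => .mergeLeft .inner
         | .leg .c => .mergeRight .inner,
     fun | .boundary _ => .trunk | .mark m => m.elim | .mergeRight .outer => .middle
         | .mergeLeft .outer => .leg .a | .mergeLeft .inner => .leg .b
         | .mergeRight .inner => .leg .c | .split v => v.elim,
     fun e => by rcases e with _ | _ | (_ | _ | _) <;> rfl,
     fun x => by rcases x with x | x | x | (_ | _) | (_ | _) <;> first | rfl | exact x.elim⟩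
  thickness | .trunk => a + b + c | .middle => b + c | .leg l => l.width a b c
  thickness_in _ := rfl
  thickness_out _ := rfl
  thickness_mark p := p.elim
  thickness_split p := p.elim
  thickness_merge v := by
    cases v
    · exact Nat.add_assoc a b c
    · rfl

/-! ### Local models of basic foams -/

/-- An end of an open arc of binding in a slab: an interior point of the slab (a singular vertex,
or a trivalent vertex of an intermediate web), a vertex of the bottom web, or a vertex of the top
web. -/
inductive BindingEnd (P B T : Type) : Type
  | point (p : P)
  | bottom (v : B)
  | top (v : T)

/-- A foam in `disk × [0,1]`, product near `∂ disk × [0,1]`, with bottom `bot` and top `top`.  Its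
open cells strictly between bottom and top and off `∂ disk × [0,1]` are: the faces, open arcs of
bindings and singular vertices.  An edge `e` of the bottom web lies on the boundary of the face
`lower e`, an edge of the top web on that of `upper e`.  At an arc of binding there are a thick face
and two thin ones, the left and the right one. -/
structure LocalModel : Type 1 where
  {In : Type}
  {Out : Type}
  [fintypeIn : Fintype In]
  [fintypeOut : Fintype Out]
  wIn : In → ℕ
  wOut : Out → ℕ
  bot : Tangle wIn wOut
  top : Tangle wIn wOut
  Face : Type
  Binding : Type
  Point : Type
  [fintypeFace : Fintype Face]
  [fintypeBinding : Fintype Binding]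
  [fintypePoint : Fintype Point]
  thickness : Face → ℕ
  lower : bot.Edge → Face
  upper : top.Edge → Face
  thickness_lower : ∀ e, thickness (lower e) = bot.thickness e
  thickness_upper : ∀ e, thickness (upper e) = top.thickness e
  wall_in : ∀ p, lower (bot.start.symm (.boundary p)) = upper (top.start.symm (.boundary p))
  wall_out : ∀ p, lower (bot.finish.symm (.boundary p)) = upper (top.finish.symm (.boundary p))
  thick : Binding → Face
  left : Binding → Face
  right : Binding → Face
  thickness_binding : ∀ x, thickness (thick x) = thickness (left x) + thickness (right x)
  end₁ : Binding → BindingEnd Point bot.Node top.Node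
  end₂ : Binding → BindingEnd Point bot.Node top.Node
  around : Point → Set Face

attribute [instance] LocalModel.fintypeIn LocalModel.fintypeOut LocalModel.fintypeFace
  LocalModel.fintypeBinding LocalModel.fintypePoint

/-- Exchange bottom and top. -/
def BindingEnd.flip {P B T : Type} : BindingEnd P B T → BindingEnd P T B
  | .point p => .point p
  | .bottom v => .top v
  | .top v => .bottom v

/-- The mirror image of a local model with respect to the horizontal plane. -/
def LocalModel.flip (L : LocalModel) : LocalModel where
  wIn := L.wIn
  wOut := L.wOut
  bot := L.top
  top := L.bot
  Face := L.Face
  Binding := L.Binding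
  Point := L.Point
  thickness := L.thickness
  lower := L.upper
  upper := L.lower
  thickness_lower := L.thickness_upper
  thickness_upper := L.thickness_lower
  wall_in p := (L.wall_in p).symm
  wall_out p := (L.wall_out p).symm
  thick := L.thick
  left := L.left
  right := L.right
  thickness_binding := L.thickness_binding
  end₁ x := (L.end₁ x).flip
  end₂ x := (L.end₂ x).flip
  around := L.around

/-- The cup: a disk bounded by a circle. -/
def LocalModel.cup (a : ℕ) : LocalModel where
  wIn := noPoints
  wOut := noPoints
  bot := nothing
  top := circle a
  Face := Unit
  Binding := Empty
  Point := Empty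
  thickness _ := a
  lower _ := ()
  upper _ := ()
  thickness_lower x := x.elim
  thickness_upper _ := rfl
  wall_in x := x.elim
  wall_out x := x.elim
  thick x := x.elim
  left x := x.elim
  right x := x.elim
  thickness_binding x := x.elim
  end₁ x := x.elim
  end₂ x := x.elim
  around x := x.elim

/-- The saddle: a disk whose bottom consists of two strands and whose top consists of the two
strands obtained by exchanging the exits. -/
def LocalModel.saddle (a : ℕ) : LocalModel where
  wIn _ := a
  wOut _ := a
  bot := twoStrands a 1
  top := twoStrands a (Equiv.swap .left .right)
  Face := Unit
  Binding := Empty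
  Point := Empty
  thickness _ := a
  lower _ := ()
  upper _ := ()
  thickness_lower _ := rfl
  thickness_upper _ := rfl
  wall_in _ := rfl
  wall_out _ := rfl
  thick x := x.elim
  left x := x.elim
  right x := x.elim
  thickness_binding x := x.elim
  end₁ x := x.elim
  end₂ x := x.elim
  around x := x.elim

/-- The three faces of a neighborhood of an arc of binding. -/
inductive YFace | thick | left | right
  deriving DecidableEq

instance : Fintype YFace := ⟨{.thick, .left, .right}, fun x => by cases x <;> decide⟩

/-- Their thicknesses. -/
def YFace.width (a b : ℕ) : YFace → ℕ
  | .thick => a + b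
  | .left => a
  | .right => b

/-- The digon-cup: a digon is created on a strand of thickness `a + b`.  There is a single
arc of binding, whose two ends are the vertices of the digon. -/
def LocalModel.digonCup (a b : ℕ) : LocalModel where
  wIn _ := a + b
  wOut _ := a + b
  bot := strand (a + b)
  top := digon a b
  Face := YFace
  Binding := Unit
  Point := Empty
  thickness := YFace.width a b
  lower _ := .thick
  upper | .before => .thick | .left => .left | .right => .right | .after => .thick
  thickness_lower _ := rfl
  thickness_upper e := by cases e <;> rfl
  wall_in _ := rfl
  wall_out _ := rfl
  thick _ := .thick
  left _ := .left
  right _ := .right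
  thickness_binding _ := rfl
  end₁ _ := .top (.inl ())
  end₂ _ := .top (.inr ())
  around x := x.elim

/-- The zip: two parallel strands of thickness `a` and `b` become a dumbbell.  There is a single
arc of binding, whose two ends are the vertices of the dumbbell. -/
def LocalModel.zip (a b : ℕ) : LocalModel where
  wIn := Side.width a b
  wOut := Side.width a b
  bot := parallel a b
  top := dumbbell a b
  Face := YFace
  Binding := Unit
  Point := Empty
  thickness := YFace.width a b
  lower | .left => .left | .right => .right
  upper
    | .leftIn => .left | .rightIn => .right | .thick => .thick | .leftOut => .left
    | .rightOut => .right
  thickness_lower e := by cases e <;> rfl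
  thickness_upper e := by cases e <;> rfl
  wall_in p := by cases p <;> rfl
  wall_out p := by cases p <;> rfl
  thick _ := .thick
  left _ := .left
  right _ := .right
  thickness_binding _ := rfl
  end₁ _ := .top (.inl ())
  end₂ _ := .top (.inr ())
  around x := x.elim

/-- The six faces at a singular vertex. -/
inductive TFace | abc | ab | bc | a | b | c
  deriving DecidableEq

instance : Fintype TFace := ⟨{.abc, .ab, .bc, .a, .b, .c}, fun x => by cases x <;> decide⟩

/-- Their thicknesses. -/
def TFace.width (a b c : ℕ) : TFace → ℕ
  | .abc => a + b + c
  | .ab => a + b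
  | .bc => b + c
  | .a => a
  | .b => b
  | .c => c

/-- The four arcs of binding at a singular vertex, named after their thin faces. -/
inductive TBinding | ab_c | a_b | a_bc | b_c
  deriving DecidableEq

instance : Fintype TBinding := ⟨{.ab_c, .a_b, .a_bc, .b_c}, fun x => by cases x <;> decide⟩

/-- The thick face at an arc. -/
def TBinding.thick : TBinding → TFace
  | .ab_c => .abc
  | .a_b => .ab
  | .a_bc => .abc
  | .b_c => .bc

/-- The left thin face at an arc. -/
def TBinding.left : TBinding → TFace
  | .ab_c => .ab
  | .a_b => .a
  | .a_bc => .a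
  | .b_c => .b

/-- The right thin face at an arc. -/
def TBinding.right : TBinding → TFace
  | .ab_c => .c
  | .a_b => .b
  | .a_bc => .bc
  | .b_c => .c

theorem TBinding.width_thick (a b c : ℕ) (x : TBinding) :
    x.thick.width a b c = x.left.width a b c + x.right.width a b c := by
  cases x
  · rfl
  · rfl
  · exact Nat.add_assoc a b c
  · rfl

/-- The face of a leg. -/
def Leg.face : Leg → TFace
  | .a => .a
  | .b => .b
  | .c => .c

/-- Associativity for splits. -/
def LocalModel.assocSplit (a b c : ℕ) : LocalModel where
  wIn _ := a + b + c
  wOut := Leg.width a b c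
  bot := splitTreeLeft a b c
  top := splitTreeRight a b c
  Face := TFace
  Binding := TBinding
  Point := Unit
  thickness := TFace.width a b c
  lower | .trunk => .abc | .middle => .ab | .leg l => l.face
  upper | .trunk => .abc | .middle => .bc | .leg l => l.face
  thickness_lower e := by rcases e with _ | _ | (_ | _ | _) <;> rfl
  thickness_upper e := by rcases e with _ | _ | (_ | _ | _) <;> rfl
  wall_in _ := rfl
  wall_out _ := rfl
  thick := TBinding.thick
  left := TBinding.left
  right := TBinding.right
  thickness_binding := TBinding.width_thick a b c
  end₁ _ := .point ()
  end₂
    | .ab_c => .bottom (.inl .outer)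
    | .a_b => .bottom (.inl .inner)
    | .a_bc => .top (.inl .outer)
    | .b_c => .top (.inl .inner)
  around _ := Set.univ

/-- Associativity for merges. -/
def LocalModel.assocMerge (a b c : ℕ) : LocalModel where
  wIn := Leg.width a b c
  wOut _ := a + b + c
  bot := mergeTreeLeft a b c
  top := mergeTreeRight a b c
  Face := TFace
  Binding := TBinding
  Point := Unit
  thickness := TFace.width a b c
  lower | .trunk => .abc | .middle => .ab | .leg l => l.face
  upper | .trunk => .abc | .middle => .bc | .leg l => l.face
  thickness_lower e := by rcases e with _ | _ | (_ | _ | _) <;> rfl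
  thickness_upper e := by rcases e with _ | _ | (_ | _ | _) <;> rfl
  wall_in _ := rfl
  wall_out _ := rfl
  thick := TBinding.thick
  left := TBinding.left
  right := TBinding.right
  thickness_binding := TBinding.width_thick a b c
  end₁ _ := .point ()
  end₂
    | .ab_c => .bottom (.inr .outer)
    | .a_b => .bottom (.inr .inner)
    | .a_bc => .top (.inr .outer)
    | .b_c => .top (.inr .inner)
  around _ := Set.univ

/-- The list of local models of basic foams.  (Decorations by polynomials are placed on the faces
separately, see `DecoratedFoam`.) -/
inductive Model : Type
  | assocSplit (a b c : ℕ)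
  | coassocSplit (a b c : ℕ)
  | assocMerge (a b c : ℕ)
  | coassocMerge (a b c : ℕ)
  | digonCup (a b : ℕ)
  | digonCap (a b : ℕ)
  | zip (a b : ℕ)
  | unzip (a b : ℕ)
  | cup (a : ℕ)
  | cap (a : ℕ)
  | saddle (a : ℕ)

/-- The local model with a given name. -/
def Model.piece : Model → LocalModel
  | .assocSplit a b c => LocalModel.assocSplit a b c
  | .coassocSplit a b c => (LocalModel.assocSplit a b c).flip
  | .assocMerge a b c => LocalModel.assocMerge a b c
  | .coassocMerge a b c => (LocalModel.assocMerge a b c).flip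
  | .digonCup a b => LocalModel.digonCup a b
  | .digonCap a b => (LocalModel.digonCup a b).flip
  | .zip a b => LocalModel.zip a b
  | .unzip a b => (LocalModel.zip a b).flip
  | .cup a => LocalModel.cup a
  | .cap a => (LocalModel.cup a).flip
  | .saddle a => LocalModel.saddle a

/-! ### Foams as cell complexes -/

/-- A foam between two webs as a finite cell complex.  The open cells strictly between bottom and top
are: faces (2-cells), seams (1-cells in the interior of a facet, with a face on each side), arcs of
bindings (1-cells with a thick, a left and a right face), and points (0-cells, `around p` being the
set of faces whose closure contains `p`).  The facets of the foam are the classes of faces that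
are connected through seams.  Going around an arc of binding, whose orientation is the one induced by
the thin facets, the thick, the left and the right face follow each other in this cyclic order. -/
structure FoamComplex (Γ Γ' : Web) : Type 1 where
  Face : Type
  Seam : Type
  Binding : Type
  Point : Type
  [fintypeFace : Fintype Face]
  [fintypeSeam : Fintype Seam]
  [fintypeBinding : Fintype Binding]
  [fintypePoint : Fintype Point]
  thickness : Face → ℕ
  lower : Γ.Edge → Face
  upper : Γ'.Edge → Face
  thickness_lower : ∀ e, thickness (lower e) = Γ.thickness e
  thickness_upper : ∀ e, thickness (upper e) = Γ'.thickness e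
  side₁ : Seam → Face
  side₂ : Seam → Face
  thickness_seam : ∀ x, thickness (side₁ x) = thickness (side₂ x)
  thick : Binding → Face
  left : Binding → Face
  right : Binding → Face
  thickness_binding : ∀ x, thickness (thick x) = thickness (left x) + thickness (right x)
  end₁ : Binding → BindingEnd Point Γ.Node Γ'.Node
  end₂ : Binding → BindingEnd Point Γ.Node Γ'.Node
  around : Point → Set Face

attribute [instance] FoamComplex.fintypeFace FoamComplex.fintypeSeam FoamComplex.fintypeBinding
  FoamComplex.fintypePoint

/-- The trace of an isotopy. -/
def FoamComplex.cylinder {Γ Γ' : Web} (φ : WebIso Γ Γ') : FoamComplex Γ Γ' where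
  Face := Γ.Edge
  Seam := Γ.Mark
  Binding := Γ.Node
  Point := Empty
  thickness := Γ.thickness
  lower e := e
  upper e := φ.edge.symm e
  thickness_lower _ := rfl
  thickness_upper e := by rw [← φ.thickness_edge, Equiv.apply_symm_apply]
  side₁ m := Γ.start.symm (.mark m)
  side₂ m := Γ.finish.symm (.mark m)
  thickness_seam := Γ.thickness_mark
  thick := Γ.thickEdge
  left := Γ.leftEdge
  right := Γ.rightEdge
  thickness_binding := Γ.thickness_node
  end₁ v := .bottom v
  end₂ v := .top (Sum.map φ.split φ.merge v)
  around x := x.elim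

/-- The product `Γ × [0,1]` (the trace of a constant isotopy), with a marked point added at the top on
the edge `e`. -/
def FoamComplex.subdivide (Γ : Web) (e : Γ.Edge) : FoamComplex Γ (Γ.subdivide e) where
  Face := Γ.Edge
  Seam := Γ.Mark
  Binding := Γ.Node
  Point := Empty
  thickness := Γ.thickness
  lower x := x
  upper x := Option.getD x e
  thickness_lower _ := rfl
  thickness_upper _ := rfl
  side₁ m := Γ.start.symm (.mark m)
  side₂ m := Γ.finish.symm (.mark m)
  thickness_seam := Γ.thickness_mark
  thick := Γ.thickEdge
  left := Γ.leftEdge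
  right := Γ.rightEdge
  thickness_binding := Γ.thickness_node
  end₁ v := .bottom v
  end₂ v := .top v
  around x := x.elim

/-- The mirror image of a foam with respect to the horizontal plane. -/
def FoamComplex.flip {Γ Γ' : Web} (F : FoamComplex Γ Γ') : FoamComplex Γ' Γ where
  Face := F.Face
  Seam := F.Seam
  Binding := F.Binding
  Point := F.Point
  thickness := F.thickness
  lower := F.upper
  upper := F.lower
  thickness_lower := F.thickness_upper
  thickness_upper := F.thickness_lower
  side₁ := F.side₁
  side₂ := F.side₂
  thickness_seam := F.thickness_seam
  thick := F.thick
  left := F.left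
  right := F.right
  thickness_binding := F.thickness_binding
  end₁ x := (F.end₁ x).flip
  end₂ x := (F.end₂ x).flip
  around := F.around

/-- The foam which is `K × [0,1]` outside a cylinder and is given by the local model `L` inside. -/
def FoamComplex.basic (L : LocalModel) (K : Tangle L.wOut L.wIn) :
    FoamComplex (K.glue L.bot) (K.glue L.top) where
  Face := K.Edge ⊕ L.Face
  Seam := K.Mark ⊕ (L.In ⊕ L.Out)
  Binding := K.Node ⊕ L.Binding
  Point := L.Point
  thickness := Sum.elim K.thickness L.thickness
  lower := Sum.map id L.lower
  upper := Sum.map id L.upper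
  thickness_lower := by
    rintro (e | e)
    · rfl
    · exact L.thickness_lower e
  thickness_upper := by
    rintro (e | e)
    · rfl
    · exact L.thickness_upper e
  side₁
    | .inl m => .inl (K.start.symm (.mark m))
    | .inr (.inl p) => .inr (L.lower (L.bot.start.symm (.boundary p)))
    | .inr (.inr q) => .inl (K.start.symm (.boundary q))
  side₂
    | .inl m => .inl (K.finish.symm (.mark m))
    | .inr (.inl p) => .inl (K.finish.symm (.boundary p))
    | .inr (.inr q) => .inr (L.lower (L.bot.finish.symm (.boundary q)))
  thickness_seam := by
    rintro (m | (p | q))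
    · exact K.thickness_mark m
    · exact (L.thickness_lower _).trans ((L.bot.thickness_in p).trans (K.thickness_out p).symm)
    · exact (K.thickness_in q).trans ((L.bot.thickness_out q).symm.trans (L.thickness_lower _).symm)
  thick := Sum.map K.thickEdge L.thick
  left := Sum.map K.leftEdge L.left
  right := Sum.map K.rightEdge L.right
  thickness_binding := by
    rintro (v | x)
    · exact K.thickness_node v
    · exact L.thickness_binding x
  end₁
    | .inl v => .bottom (Sum.map .inl .inl v)
    | .inr x => match L.end₁ x with
      | .point p => .point p
      | .bottom v => .bottom (Sum.map .inr .inr v)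
      | .top v => .top (Sum.map .inr .inr v)
  end₂
    | .inl v => .top (Sum.map .inl .inl v)
    | .inr x => match L.end₂ x with
      | .point p => .point p
      | .bottom v => .bottom (Sum.map .inr .inr v)
      | .top v => .top (Sum.map .inr .inr v)
  around p := Sum.inr '' L.around p

/-- Stack `G` on top of `F`: the edges of the intermediate web become seams and its vertices become
points. -/
def FoamComplex.comp {Γ Γ' Γ'' : Web} (F : FoamComplex Γ Γ') (G : FoamComplex Γ' Γ'') :
    FoamComplex Γ Γ'' where
  Face := F.Face ⊕ G.Face
  Seam := F.Seam ⊕ (Γ'.Edge ⊕ G.Seam)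
  Binding := F.Binding ⊕ G.Binding
  Point := F.Point ⊕ (Γ'.Vertex ⊕ G.Point)
  thickness := Sum.elim F.thickness G.thickness
  lower e := .inl (F.lower e)
  upper e := .inr (G.upper e)
  thickness_lower := F.thickness_lower
  thickness_upper := G.thickness_upper
  side₁
    | .inl x => .inl (F.side₁ x)
    | .inr (.inl e) => .inl (F.upper e)
    | .inr (.inr x) => .inr (G.side₁ x)
  side₂
    | .inl x => .inl (F.side₂ x)
    | .inr (.inl e) => .inr (G.lower e)
    | .inr (.inr x) => .inr (G.side₂ x)
  thickness_seam := by
    rintro (x | (e | x))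
    · exact F.thickness_seam x
    · exact (F.thickness_upper e).trans (G.thickness_lower e).symm
    · exact G.thickness_seam x
  thick := Sum.map F.thick G.thick
  left := Sum.map F.left G.left
  right := Sum.map F.right G.right
  thickness_binding := by
    rintro (x | x)
    · exact F.thickness_binding x
    · exact G.thickness_binding x
  end₁
    | .inl x => match F.end₁ x with
      | .point p => .point (.inl p)
      | .bottom v => .bottom v
      | .top v => .point (.inr (.inl (.inr v)))
    | .inr x => match G.end₁ x with
      | .point p => .point (.inr (.inr p))
      | .bottom v => .point (.inr (.inl (.inr v)))
      | .top v => .top v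
  end₂
    | .inl x => match F.end₂ x with
      | .point p => .point (.inl p)
      | .bottom v => .bottom v
      | .top v => .point (.inr (.inl (.inr v)))
    | .inr x => match G.end₂ x with
      | .point p => .point (.inr (.inr p))
      | .bottom v => .point (.inr (.inl (.inr v)))
      | .top v => .top v
  around
    | .inl p => Sum.inl '' F.around p
    | .inr (.inl v) =>
        {f | ∃ e, Γ'.Touches e v ∧ (f = Sum.inl (F.upper e) ∨ f = Sum.inr (G.lower e))}
    | .inr (.inr p) => Sum.inr '' G.around p

/-! ### Foams in good position -/

/-- Foams in good position: compositions of traces of isotopies and of foams which are a product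
outside a cylinder and one of the local models inside.  Since webs are cellular, traces of constant
isotopies which add a marked point at the top or forget one of the bottom are included. -/
inductive GoodFoam : Web → Web → Type 1
  | isotopy {Γ Γ' : Web} (φ : WebIso Γ Γ') : GoodFoam Γ Γ'
  | subdivide (Γ : Web) (e : Γ.Edge) : GoodFoam Γ (Γ.subdivide e)
  | unsubdivide (Γ : Web) (e : Γ.Edge) : GoodFoam (Γ.subdivide e) Γ
  | basic (m : Model) (K : Tangle m.piece.wOut m.piece.wIn) :
      GoodFoam (K.glue m.piece.bot) (K.glue m.piece.top)
  | comp {Γ Γ' Γ'' : Web} (F : GoodFoam Γ Γ') (G : GoodFoam Γ' Γ'') : GoodFoam Γ Γ''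

/-- The cell complex swept out. -/
def GoodFoam.complex : {Γ Γ' : Web} → GoodFoam Γ Γ' → FoamComplex Γ Γ'
  | _, _, .isotopy φ => .cylinder φ
  | _, _, .subdivide Γ e => .subdivide Γ e
  | _, _, .unsubdivide Γ e => (FoamComplex.subdivide Γ e).flip
  | _, _, .basic m K => .basic m.piece K
  | _, _, .comp F G => F.complex.comp G.complex

/-- A foam in good position is spherical if no saddle is used. -/
def GoodFoam.IsSpherical : {Γ Γ' : Web} → GoodFoam Γ Γ' → Prop
  | _, _, .isotopy _ => True
  | _, _, .subdivide _ _ => True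
  | _, _, .unsubdivide _ _ => True
  | _, _, .basic m _ => ∀ a, m ≠ .saddle a
  | _, _, .comp F G => F.IsSpherical ∧ G.IsSpherical

/-! ### Colorings and surfaces -/

section Coloring

variable {Γ Γ' : Web}

/-- A coloring of a foam with pigments `Fin N`: a map from facets (that is, a map on faces which
is constant through seams) to sets of pigments, of the right cardinality, satisfying the flow
condition at bindings. -/
@[ext] structure Coloring (F : FoamComplex Γ Γ') (N : ℕ) where
  color : F.Face → Finset (Fin N)
  card_color : ∀ f, (color f).card = F.thickness f
  color_seam : ∀ x, color (F.side₁ x) = color (F.side₂ x)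
  color_binding : ∀ x, color (F.thick x) = color (F.left x) ∪ color (F.right x)

instance Coloring.fintype (F : FoamComplex Γ Γ') (N : ℕ) : Fintype (Coloring F N) :=
  haveI : Finite (Coloring F N) :=
    Finite.of_injective (fun c => c.color) (fun _ _ h => Coloring.ext h)
  Fintype.ofFinite _

/-- The Euler characteristic of the union of the closures of the faces satisfying `A`, for a foam
without boundary: the number of 2-cells minus the number of 1-cells plus the number of 0-cells. -/
def FoamComplex.euler (F : FoamComplex Γ Γ') (A : F.Face → Prop) : ℤ :=
  (Nat.card {f : F.Face // A f} : ℤ)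
    - (Nat.card {x : F.Seam // A (F.side₁ x) ∨ A (F.side₂ x)} : ℤ)
    - (Nat.card {x : F.Binding // A (F.thick x) ∨ A (F.left x) ∨ A (F.right x)} : ℤ)
    + (Nat.card {p : F.Point // ∃ f ∈ F.around p, A f} : ℤ)

variable {F : FoamComplex Γ Γ'} {N : ℕ}

/-- The Euler characteristic of the monochrome surface `F_i(c)`. -/
def Coloring.monochromeEuler (c : Coloring F N) (i : Fin N) : ℤ :=
  F.euler fun f => i ∈ c.color f

/-- The Euler characteristic of the bichrome surface `F_ij(c)`. -/
def Coloring.bichromeEuler (c : Coloring F N) (i j : Fin N) : ℤ :=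
  F.euler fun f => Xor (i ∈ c.color f) (j ∈ c.color f)

/-- The arcs of bindings of positive type separating `i`-pigmented and `j`-pigmented regions
of the bichrome surface: the left face contains `i` and the right face contains `j`. -/
def Coloring.PositiveBinding (c : Coloring F N) (i j : Fin N) : Type :=
  {x : F.Binding // i ∈ c.color (F.left x) ∧ j ∈ c.color (F.right x)}

/-- Two arcs of bindings share an end. -/
def FoamComplex.ShareEnd (F : FoamComplex Γ Γ') (x y : F.Binding) : Prop :=
  F.end₁ x = F.end₁ y ∨ F.end₁ x = F.end₂ y ∨ F.end₂ x = F.end₁ y ∨ F.end₂ x = F.end₂ y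

/-- The number of positive circles in the bichrome surface `F_ij(c)`: the number of connected
components of the union of the positive arcs. -/
def Coloring.thetaPlus (c : Coloring F N) (i j : Fin N) : ℕ :=
  Nat.card (Quot fun x y : c.PositiveBinding i j => F.ShareEnd x.1 y.1)

/-- The integer `s(F,c)`; the pigments are numbered from `1` to `N`, and all Euler characteristics
that occur for closed foams are even. -/
def Coloring.signExponent (c : Coloring F N) : ℤ :=
  ∑ i : Fin N, ((i : ℕ) + 1 : ℤ) * (c.monochromeEuler i / 2) +
    ∑ p : {p : Fin N × Fin N // p.1 < p.2}, (c.thetaPlus p.1.1 p.1.2 : ℤ)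

end Coloring

/-! ### Polynomials, decorations and the Witt action -/

section Algebra

variable (k : Type u) [CommRing k]

open MvPolynomial

/-- The operator `L_n = - ∑ z_i ^ (n+1) ∂/∂z_i` for `n ≥ -1`. -/
def witt {σ : Type} [Fintype σ] (n : ℤ) :
    Derivation k (MvPolynomial σ k) (MvPolynomial σ k) :=
  -∑ i : σ, (X i ^ (n + 1).toNat : MvPolynomial σ k) • pderiv (R := k) i

theorem witt_rename {σ τ : Type} [Fintype σ] [Fintype τ] (n : ℤ) (e : σ ≃ τ)
    (p : MvPolynomial σ k) : witt k n (rename e p) = rename e (witt k n p) := by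
  classical
  have hX : ∀ {σ : Type} [Fintype σ] (i : σ),
      witt k n (X i : MvPolynomial σ k) = -X i ^ (n + 1).toNat := by
    intro σ _ i
    classical
    have h : ∀ s : Finset σ, (∑ j ∈ s, (X j ^ (n + 1).toNat : MvPolynomial σ k) •
        pderiv (R := k) j) (X i) = ∑ j ∈ s, X j ^ (n + 1).toNat * pderiv (R := k) j (X i) := by
      intro s
      induction s using Finset.induction_on with
      | empty => simp
      | insert a s ha ih => rw [Finset.sum_insert ha, Finset.sum_insert ha, Derivation.add_apply, ih]; rfl
    simp [witt, h, pderiv_X, Pi.single_apply]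
  induction p using MvPolynomial.induction_on with
  | C a => simp [← algebraMap_eq]
  | add p q hp hq => simp [hp, hq]
  | mul_X p i hp => simp [hp, hX, Derivation.leibniz]

/-- Decorations of facets of thickness `a`: polynomials in `a + (N - a)` variables which are
symmetric in the first `a` variables and in the last `N - a` variables. -/
def Decor (N a : ℕ) : Subalgebra k (MvPolynomial (Fin a ⊕ Fin (N - a)) k) where
  carrier := {p | ∀ (σ : Equiv.Perm (Fin a)) (τ : Equiv.Perm (Fin (N - a))),
    rename (Equiv.sumCongr σ τ) p = p}
  mul_mem' hp hq σ τ := by rw [map_mul, hp σ τ, hq σ τ]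
  add_mem' hp hq σ τ := by rw [map_add, hp σ τ, hq σ τ]
  algebraMap_mem' r σ τ := by simp

variable {k} {N : ℕ}

/-- The Witt action on decorations. -/
def Decor.witt (n : ℤ) {a : ℕ} (R : Decor k N a) : Decor k N a :=
  ⟨WittFoam.witt k n R.1, fun σ τ => by rw [← witt_rename, R.2 σ τ]⟩

variable (k N)

/-- The `n`-th power sum in the variables of the facet (zero for negative `n`, and equal to `a`
for `n = 0`). -/
def Decor.newton (a : ℕ) (n : ℤ) : Decor k N a :=
  ⟨if n < 0 then 0 else ∑ i : Fin a, X (Sum.inl i) ^ n.toNat, fun σ τ => by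
    split_ifs
    · simp
    · simpa using Equiv.sum_comp σ fun i : Fin a =>
        (X (Sum.inl i) ^ n.toNat : MvPolynomial (Fin a ⊕ Fin (N - a)) k)⟩

/-- The `n`-th power sum in the variables which are not in the facet. -/
def Decor.conewton (a : ℕ) (n : ℤ) : Decor k N a :=
  ⟨if n < 0 then 0 else ∑ i : Fin (N - a), X (Sum.inr i) ^ n.toNat, fun σ τ => by
    split_ifs
    · simp
    · simpa using Equiv.sum_comp τ fun i : Fin (N - a) =>
        (X (Sum.inr i) ^ n.toNat : MvPolynomial (Fin a ⊕ Fin (N - a)) k)⟩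

variable {k N}

/-- The evaluation `R(X_I, X_{Î})` of a decoration on the variables with indices in `I` and on those
with indices in the complement. -/
def Decor.evalAt {a : ℕ} (R : Decor k N a) (I : Finset (Fin N)) (h : I.card = a) :
    MvPolynomial (Fin N) k :=
  rename (finSumEquivOfFinset (m := a) (n := N - a) h
    (by rw [Finset.card_compl, Fintype.card_fin, h])) R.1

/-- The pairs of natural numbers with sum `n`. -/
def pairsWithSum (n : ℤ) : Finset (ℕ × ℕ) :=
  if n < 0 then ∅ else Finset.HasAntidiagonal.antidiagonal n.toNat

/-! ### Rational functions -/

variable (k N)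

/-- The multiplicative set generated by the differences `X_i - X_j`. -/
def differences : Submonoid (MvPolynomial (Fin N) k) :=
  Submonoid.closure {p | ∃ i j : Fin N, i < j ∧ p = X i - X j}

/-- The ring of rational functions in `X_1, …, X_N` with denominators products of differences. -/
abbrev RatFun : Type u := Localization (differences k N)

variable {k N}

/-- `X_i - X_j` as an invertible rational function. -/
def diffUnit (p : {p : Fin N × Fin N // p.1 < p.2}) : (RatFun k N)ˣ :=
  (IsLocalization.map_units (RatFun k N)
    (⟨X p.1.1 - X p.1.2, Submonoid.subset_closure ⟨p.1.1, p.1.2, p.2, rfl⟩⟩ :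
      differences k N)).unit

/-- The differences are not zero divisors. -/
theorem differences_le : differences k N ≤ nonZeroDivisors (MvPolynomial (Fin N) k) := by
  rw [differences, Submonoid.closure_le]
  rintro _ ⟨i, j, hij, rfl⟩
  have hij' : j ≠ i := hij.ne'
  let f : MvPolynomial (Fin N) k →ₐ[k] MvPolynomial (Fin N) k :=
    aeval fun l => if l = i then X i + X j else X l
  let g : MvPolynomial (Fin N) k →ₐ[k] MvPolynomial (Fin N) k :=
    aeval fun l => if l = i then X i - X j else X l
  have hgf : ∀ p, g (f p) = p := by
    intro p
    have h : g.comp f = AlgHom.id k _ := by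
      ext1 l
      by_cases hl : l = i
      · subst hl; simp [f, g, hij']
      · simp [f, g, hl]
    exact DFunLike.congr_fun h p
  have hf : f (X i - X j) = X i := by simp [f, hij']
  rw [SetLike.mem_coe, mem_nonZeroDivisors_iff_right]
  intro p hp
  have h : f p * X i = 0 := by rw [← hf, ← map_mul, hp, map_zero]
  have h0 : f p = 0 := isRegular_X.right (by simpa using h : f p * X i = 0 * X i)
  rw [← hgf p, h0, map_zero]

/-- Polynomials are rational functions. -/
theorem algebraMap_ratFun_injective :
    Function.Injective (algebraMap (MvPolynomial (Fin N) k) (RatFun k N)) :=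
  IsLocalization.injective _ differences_le

/-- For a derivation `D` of `P`, the ring homomorphism `p ↦ p + ε D p` to dual numbers over a
`P`-algebra. -/
def dualHom {P : Type u} [CommRing P] [Algebra k P] (D : Derivation k P P)
    (A : Type u) [CommRing A] [Algebra P A] : P →+* TrivSqZeroExt A A where
  toFun p := TrivSqZeroExt.inl (algebraMap P A p) + TrivSqZeroExt.inr (algebraMap P A (D p))
  map_one' := by ext <;> simp
  map_zero' := by ext <;> simp
  map_add' p q := by
    rw [map_add, map_add, map_add]
    ext <;> simp only [TrivSqZeroExt.fst_add, TrivSqZeroExt.snd_add, TrivSqZeroExt.fst_inl,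
      TrivSqZeroExt.fst_inr, TrivSqZeroExt.snd_inl, TrivSqZeroExt.snd_inr, add_zero, zero_add]
  map_mul' p q := by
    ext
    · simp
    · simp only [Derivation.leibniz, map_add, smul_eq_mul, map_mul, TrivSqZeroExt.snd_add,
        TrivSqZeroExt.snd_inl, TrivSqZeroExt.snd_inr, TrivSqZeroExt.snd_mul, zero_add,
        TrivSqZeroExt.fst_add, TrivSqZeroExt.fst_inl, TrivSqZeroExt.fst_inr, add_zero,
        MulOpposite.smul_eq_mul_unop, MulOpposite.unop_op]
      ring

/-- Extension of `dualHom` to a localization. -/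
def dualLift {P : Type u} [CommRing P] [Algebra k P] (D : Derivation k P P)
    (M : Submonoid P) (A : Type u) [CommRing A] [Algebra P A] [IsLocalization M A] :
    A →+* TrivSqZeroExt A A :=
  IsLocalization.lift (M := M) (g := dualHom D A) fun y => by
    rw [TrivSqZeroExt.isUnit_iff_isUnit_fst]
    simpa [dualHom] using IsLocalization.map_units A y

theorem dualLift_algebraMap {P : Type u} [CommRing P] [Algebra k P] (D : Derivation k P P)
    (M : Submonoid P) (A : Type u) [CommRing A] [Algebra P A] [IsLocalization M A] (p : P) :
    dualLift D M A (algebraMap P A p) =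
      TrivSqZeroExt.inl (algebraMap P A p) + TrivSqZeroExt.inr (algebraMap P A (D p)) :=
  IsLocalization.lift_eq _ p

theorem fst_dualLift {P : Type u} [CommRing P] [Algebra k P] (D : Derivation k P P)
    (M : Submonoid P) (A : Type u) [CommRing A] [Algebra P A] [IsLocalization M A] (q : A) :
    (dualLift D M A q).fst = q := by
  have h : ((TrivSqZeroExt.fstHom A A A).toRingHom).comp (dualLift D M A) = RingHom.id _ := by
    refine IsLocalization.ringHom_ext M (RingHom.ext fun p => ?_)
    change (dualLift D M A (algebraMap P A p)).fst = algebraMap P A p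
    rw [dualLift_algebraMap]
    simp
  exact DFunLike.congr_fun h q

/-- The extension of a derivation to a localization. -/
def extendDerivation {P : Type u} [CommRing P] [Algebra k P] (D : Derivation k P P)
    (M : Submonoid P) (A : Type u) [CommRing A] [Algebra P A] [IsLocalization M A]
    [Algebra k A] [IsScalarTower k P A] : Derivation k A A :=
  Derivation.mk'
    { toFun := fun q => (dualLift D M A q).snd
      map_add' := fun p q => by rw [map_add, TrivSqZeroExt.snd_add]
      map_smul' := fun r q => by
        rw [Algebra.smul_def, IsScalarTower.algebraMap_apply k P A, map_mul, dualLift_algebraMap,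
          RingHom.id_apply, Algebra.smul_def, IsScalarTower.algebraMap_apply k P A]
        simp }
    fun p q => by
      change (dualLift D M A (p * q)).snd = p • (dualLift D M A q).snd + q • (dualLift D M A p).snd
      rw [map_mul, TrivSqZeroExt.snd_mul, fst_dualLift, fst_dualLift]
      simp [mul_comm]

theorem extendDerivation_algebraMap {P : Type u} [CommRing P] [Algebra k P] (D : Derivation k P P)
    (M : Submonoid P) (A : Type u) [CommRing A] [Algebra P A] [IsLocalization M A]
    [Algebra k A] [IsScalarTower k P A] (p : P) :
    extendDerivation D M A (algebraMap P A p) = algebraMap P A (D p) := by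
  change (dualLift D M A (algebraMap P A p)).snd = _
  rw [dualLift_algebraMap, TrivSqZeroExt.snd_add, TrivSqZeroExt.snd_inl, TrivSqZeroExt.snd_inr,
    zero_add]

variable (k N)

/-- The Witt action `L_n` on rational functions: the derivation which extends `witt k n` (see
`wittRat_algebraMap`).  The Leibniz rule forces the quotient rule. -/
def wittRat (n : ℤ) : Derivation k (RatFun k N) (RatFun k N) :=
  extendDerivation (witt k n) (differences k N) (RatFun k N)

theorem wittRat_algebraMap (n : ℤ) (p : MvPolynomial (Fin N) k) :
    wittRat k N n (algebraMap _ _ p) = algebraMap _ _ (witt k n p) :=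
  extendDerivation_algebraMap _ _ _ p

end Algebra

/-! ### Evaluation of closed foams -/

section Evaluation

variable (k : Type u) [CommRing k] (N : ℕ)

/-- A closed decorated foam in good position.  Every face carries a decoration (the product of the
dots lying on it); the decoration of a facet is the product of those of its faces. -/
structure DecoratedFoam : Type (max 1 u) where
  foam : GoodFoam nothing nothing
  decor : ∀ f : foam.complex.Face, Decor k N (foam.complex.thickness f)

variable {k N}

/-- The polynomial `P(F,c)`: the product over all facets of the evaluated decorations. -/
def DecoratedFoam.numerator (F : DecoratedFoam k N) (c : Coloring F.foam.complex N) :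
    MvPolynomial (Fin N) k :=
  ∏ f, Decor.evalAt (F.decor f) (c.color f) (c.card_color f)

/-- The product `Q(F,c)` of the `(X_i - X_j) ^ (χ(F_ij(c)) / 2)` for `i < j`. -/
def DecoratedFoam.denominator (F : DecoratedFoam k N) (c : Coloring F.foam.complex N) :
    (RatFun k N)ˣ :=
  ∏ p : {p : Fin N × Fin N // p.1 < p.2}, diffUnit p ^ (c.bichromeEuler p.1.1 p.1.2 / 2)

/-- The colored evaluation `(-1) ^ s(F,c) P(F,c) / Q(F,c)`. -/
def DecoratedFoam.coloredEvaluation (F : DecoratedFoam k N) (c : Coloring F.foam.complex N) :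
    RatFun k N :=
  (((-1) ^ c.signExponent * (F.denominator c)⁻¹ : (RatFun k N)ˣ) : RatFun k N) *
    algebraMap _ _ (F.numerator c)

/-- The evaluation of a closed foam: the sum of the colored evaluations. -/
def DecoratedFoam.evaluation (F : DecoratedFoam k N) : RatFun k N :=
  ∑ c : Coloring F.foam.complex N, F.coloredEvaluation c

variable (k N)

/-- The evaluation of linear combinations of closed foams. -/
def evaluation : (DecoratedFoam k N →₀ k) →ₗ[k] RatFun k N :=
  Finsupp.linearCombination k DecoratedFoam.evaluation

/-! ### The operators `L_n` on foams in good position -/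

/-- Witt sequences; only the values at integers `≥ -1` are relevant. -/
structure IsWittSequence (l : ℤ → k) : Prop where
  neg_one : l (-1) = 0
  relation : ∀ m n : ℤ, 0 ≤ m → 0 ≤ n → (n : k) * l n - (m : k) * l m = ((n : k) - m) * l (m + n)

/-- The parameters of the action: an element `s` and three Witt sequences. -/
structure Parameters where
  s : k
  lam : ℤ → k
  mu : ℤ → k
  nu : ℤ → k
  isWitt_lam : IsWittSequence k lam
  isWitt_mu : IsWittSequence k mu
  isWitt_nu : IsWittSequence k nu

/-- Placements of dots on the faces of a foam or of a local model. -/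
abbrev Dots {Face : Type} (thickness : Face → ℕ) : Type u := ∀ f, Decor k N (thickness f)

variable {k N}

section Terms

variable {Face : Type} [DecidableEq Face] {thickness : Face → ℕ}

/-- A single dot on the face `f`. -/
def dot (f : Face) (R : Decor k N (thickness f)) : Dots k N thickness := Pi.mulSingle f R

/-- The foam with the power sum `p_i` on the face `f` and the power sum `p_j` on the face `g`. -/
def newtonPair (f g : Face) (i j : ℤ) : Dots k N thickness :=
  dot f (Decor.newton k N _ i) * dot g (Decor.newton k N _ j)

/-- The foam with, on the face `f`, the power sum `p_i` in the variables of the facet and the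
power sum `p_j` in the other variables. -/
def coNewtonPair (f : Face) (i j : ℤ) : Dots k N thickness :=
  dot f (Decor.newton k N _ i * Decor.conewton k N _ j)

/-- `x • (p_n, p_0) + y • (p_0, p_n) + z • ∑_{i + j = n} (p_i, p_j)` with the dots on `f` and `g`. -/
def bindingTerms (n : ℤ) (f g : Face) (x y z : k) : Dots k N thickness →₀ k :=
  Finsupp.single (newtonPair f g n 0) x + Finsupp.single (newtonPair f g 0 n) y +
    ∑ p ∈ pairsWithSum n, Finsupp.single (newtonPair f g p.1 p.2) z

/-- `x • (p_0, p̂_n) + y • (p_n, p̂_0) + z • ∑_{i + j = n} (p_i, p̂_j)` with the dots on `f`, where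
`p̂` are power sums in the variables which are not in the facet. -/
def diskTerms (n : ℤ) (f : Face) (x y z : k) : Dots k N thickness →₀ k :=
  Finsupp.single (coNewtonPair f 0 n) x + Finsupp.single (coNewtonPair f n 0) y +
    ∑ p ∈ pairsWithSum n, Finsupp.single (coNewtonPair f p.1 p.2) z

end Terms

variable [Invertible (2 : k)]

/-- The image under `L_n` of an undecorated basic foam, as a linear combination of placements of dots
on the same local model.  (For saddles, which spherical foams do not use, this is the value for the
action on all foams.) -/
def Model.act (θ : Parameters k) (n : ℤ) : (m : Model) → Dots k N m.piece.thickness →₀ k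
  | .assocSplit _ _ _ | .coassocSplit _ _ _ | .assocMerge _ _ _ | .coassocMerge _ _ _ => 0
  | .digonCup _ _ =>
      bindingTerms (Face := YFace) n .left .right (θ.lam n) (θ.mu n) θ.s
  | .digonCap _ _ =>
      bindingTerms (Face := YFace) n .left .right (-θ.lam n) (-θ.mu n) (1 - θ.s)
  | .zip _ _ =>
      bindingTerms (Face := YFace) n .left .right (θ.lam n) (θ.mu n) (-(1 - θ.s))
  | .unzip _ _ =>
      bindingTerms (Face := YFace) n .left .right (-θ.lam n) (-θ.mu n) (-θ.s)
  | .cup _ => diskTerms (Face := Unit) n () (θ.nu n) (-θ.nu n) (⅟2)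
  | .cap _ => diskTerms (Face := Unit) n () (-θ.nu n) (θ.nu n) (⅟2)
  | .saddle _ => diskTerms (Face := Unit) n () 0 0 (-⅟2)

/-- The image under `L_n` of an undecorated foam in good position, as a linear combination of
placements of dots on this foam; it is determined by the values on basic foams, on traces of
isotopies (zero) and by the Leibniz rule `L_n (G ∘ F) = G ∘ L_n F + L_n G ∘ F`. -/
def GoodFoam.act (θ : Parameters k) (n : ℤ) :
    {Γ Γ' : Web} → (F : GoodFoam Γ Γ') → Dots k N F.complex.thickness →₀ k
  | _, _, .isotopy _ => 0
  | _, _, .subdivide _ _ => 0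
  | _, _, .unsubdivide _ _ => 0
  | _, _, .basic m _ => (m.act θ n).mapDomain fun d f => match f with
      | .inl _ => 1
      | .inr f => d f
  | _, _, .comp F G =>
      ((F.act θ n).mapDomain fun d f => match f with
        | .inl f => d f
        | .inr _ => 1) +
      ((G.act θ n).mapDomain fun d f => match f with
        | .inl _ => 1
        | .inr f => d f)

open Classical in
/-- The image under `L_n` of a decorated foam: by the Leibniz rule, `L_n` acts on the decoration of
one face at a time, and on the underlying foam. -/
def DecoratedFoam.act (θ : Parameters k) (n : ℤ) (F : DecoratedFoam k N) :
    DecoratedFoam k N →₀ k :=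
  ∑ f, Finsupp.single ⟨F.foam, Function.update F.decor f (Decor.witt n (F.decor f))⟩ 1 +
    (F.foam.act θ n).mapDomain fun d => ⟨F.foam, d * F.decor⟩

variable (N)

/-- The operator `L_n` on linear combinations of closed foams in good position. -/
def foamL (θ : Parameters k) (n : ℤ) : (DecoratedFoam k N →₀ k) →ₗ[k] (DecoratedFoam k N →₀ k) :=
  Finsupp.linearCombination k (DecoratedFoam.act θ n)

end Evaluation

end

end WittFoam

/-! The identity holds coloring by coloring. A colored evaluation is a unit (a sign divided by `Q`)
times the polynomial `P`, so a derivation acts on it in two ways: through `P`, and through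
multiplication by the logarithmic derivative of the unit. The first is the Leibniz rule over the
decorations (`DecoratedFoam.witt_numerator`). For the second, write `h_n` for the complete symmetric
polynomial `complete`. Since `X_i ^ (n+1) - X_j ^ (n+1) = (X_i - X_j) h_n(X_i, X_j)` and signs are
killed, the logarithmic derivative is `∑_{i<j} (χ(F_ij(c)) / 2) h_n(X_i, X_j)`
(`logDeriv_denominator`). It remains to see that the dots which `L_n` puts on the undecorated foam
evaluate to this same sum (`GoodFoam.termsEval_act_closed`).

Both quantities are sums over the basic foams of the movie. Euler characteristics are additive
(`GoodFoam.euler_eq`): a binding with `i` and `j` on different thin sides contributes `1` for a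
digon-cup or digon-cap and `-1` for a zip or unzip, a cup or cap contributes `1` when it carries
exactly one of `i`, `j`, and singular vertices contribute nothing. The dots evaluate to sums over
pairs of pigments. Comparing coefficients (`two_smul_actWeight`), twice the dots equals the Euler
contribution plus two error terms: `±∑ γ(i, j)` over pairs left and right of a binding, with `+` for
digon-cup and zip and `-` for digon-cap and unzip, and `±∑ δ(i)` over the pigments of a cup or cap.

Both errors telescope along the movie and vanish between empty webs. The first is the variation of
the sum of `γ` over all split vertices of the current web, which reassociation preserves
(`GoodFoam.sum_splitWeight`). The second is the variation of a weighted count of the circles formed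
by the edges carrying a given pigment. Without saddles only cups and caps change the number of such
circles, so each pigment is born as often as it dies (`GoodFoam.sum_birthWeight`). Circles are
counted through unions of components, whose number is `2` to the number of circles; this replaces
connectivity arguments by injections between sets of subwebs.

The same telescoping modulo `2` shows that every `χ(F_ij(c))` is even, and invertibility of `2` then
removes the factor two. -/

namespace WittFoam

noncomputable section

/-! ### Algebra of power sums and logarithmic derivatives. -/

section Algebra

open MvPolynomial

variable {k : Type u} [CommRing k] {N : ℕ}

/-! ### Power sums and evaluation of dots -/

variable (k) in
/-- `X_i ^ n`, read as zero for negative `n`. -/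
def intPow (n : ℤ) (i : Fin N) : MvPolynomial (Fin N) k :=
  if n < 0 then 0 else X i ^ n.toNat

variable (k) in
/-- The complete symmetric polynomial of degree `n` in `X_i` and `X_j`. -/
def complete (n : ℤ) (i j : Fin N) : MvPolynomial (Fin N) k :=
  ∑ p ∈ pairsWithSum n, intPow k p.1 i * intPow k p.2 j

theorem complete_comm (n : ℤ) (i j : Fin N) : complete k n i j = complete k n j i := by
  unfold complete pairsWithSum
  split_ifs
  · simp
  · rw [← Finset.Nat.sum_antidiagonal_swap]
    simp [mul_comm]

theorem witt_X {σ : Type} [Fintype σ] (n : ℤ) (i : σ) :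
    witt k n (X i : MvPolynomial σ k) = -X i ^ (n + 1).toNat := by
  classical
  have h : ∀ s : Finset σ, (∑ j ∈ s, (X j ^ (n + 1).toNat : MvPolynomial σ k) •
      pderiv (R := k) j) (X i) = ∑ j ∈ s, X j ^ (n + 1).toNat * pderiv (R := k) j (X i) := by
    intro s
    induction s using Finset.induction_on with
    | empty => simp
    | insert a s ha ih =>
      rw [Finset.sum_insert ha, Finset.sum_insert ha, Derivation.add_apply, ih]; rfl
  simp [witt, h, pderiv_X, Pi.single_apply]

/-- Factorization of a difference of powers. The quotient is exactly the polynomial produced by the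
symmetric term of the action on basic foams. -/
theorem witt_sub (n : ℤ) (i j : Fin N) :
    witt k n (X i - X j : MvPolynomial (Fin N) k) = -((X i - X j) * complete k n i j) := by
  rw [map_sub, witt_X, witt_X]
  rcases lt_or_ge n 0 with hn | hn
  -- Truncation makes the exponent `0` for every negative `n`: both powers are `1` and cancel, in
  -- agreement with the empty sum `complete`.
  · have : (n + 1).toNat = 0 := by omega
    simp [this, complete, pairsWithSum, hn]
  · obtain ⟨m, rfl⟩ := Int.eq_ofNat_of_zero_le hn
    have : ((m : ℤ) + 1).toNat = m + 1 := by omega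
    rw [this, complete, pairsWithSum, if_neg (by omega), Int.toNat_natCast,
      Finset.Nat.sum_antidiagonal_eq_sum_range_succ
        (fun a b => intPow k (a : ℤ) i * intPow k (b : ℤ) j)]
    have h : ∀ (a : ℕ) (i : Fin N), intPow k (a : ℤ) i = X i ^ a := fun a i => by simp [intPow]
    simp only [h]
    -- The geometric sum has `m + 1` terms with second exponent `m + 1 - 1 - a`, to be read as `m -
    -- a`.
    have := (Commute.all (X i : MvPolynomial (Fin N) k) (X j)).mul_geom_sum₂ (m + 1)
    simp only [Nat.add_sub_cancel] at this
    rw [this]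
    ring

theorem witt_isSymmetric (n : ℤ) {p : MvPolynomial (Fin N) k} (hp : p.IsSymmetric) :
    (witt k n p).IsSymmetric := fun e => by rw [← witt_rename, hp e]

theorem Decor.evalAt_mul {a : ℕ} (R S : Decor k N a) (I : Finset (Fin N)) (h : I.card = a) :
    Decor.evalAt (R * S) I h = Decor.evalAt R I h * Decor.evalAt S I h :=
  map_mul _ _ _

theorem Decor.evalAt_one {a : ℕ} (I : Finset (Fin N)) (h : I.card = a) :
    Decor.evalAt (1 : Decor k N a) I h = 1 :=
  map_one _

theorem Decor.evalAt_witt (n : ℤ) {a : ℕ} (R : Decor k N a) (I : Finset (Fin N))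
    (h : I.card = a) : Decor.evalAt (Decor.witt n R) I h = WittFoam.witt k n (Decor.evalAt R I h) :=
  (witt_rename k n _ _).symm

theorem sum_finSumEquiv_inl {M : Type*} [AddCommMonoid M] {a b : ℕ} (I : Finset (Fin N))
    (h : I.card = a) (h' : Iᶜ.card = b) (f : Fin N → M) :
    ∑ x : Fin a, f (finSumEquivOfFinset h h' (.inl x)) = ∑ i ∈ I, f i := by
  rw [← Finset.sum_coe_sort I f]
  exact Fintype.sum_equiv (I.orderIsoOfFin h).toEquiv _ _ fun x => by simp

theorem sum_finSumEquiv_inr {M : Type*} [AddCommMonoid M] {a b : ℕ} (I : Finset (Fin N))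
    (h : I.card = a) (h' : Iᶜ.card = b) (f : Fin N → M) :
    ∑ x : Fin b, f (finSumEquivOfFinset h h' (.inr x)) = ∑ i ∈ Iᶜ, f i := by
  rw [← Finset.sum_coe_sort Iᶜ f]
  exact Fintype.sum_equiv (Iᶜ.orderIsoOfFin h').toEquiv _ _ fun x => by simp

theorem Decor.evalAt_newton (a : ℕ) (n : ℤ) (I : Finset (Fin N)) (h : I.card = a) :
    Decor.evalAt (Decor.newton k N a n) I h = ∑ i ∈ I, intPow k n i := by
  unfold Decor.evalAt Decor.newton intPow
  split_ifs
  · simp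
  · rw [map_sum, ← sum_finSumEquiv_inl I h (by rw [Finset.card_compl, Fintype.card_fin, h])]
    simp

theorem Decor.evalAt_conewton (a : ℕ) (n : ℤ) (I : Finset (Fin N)) (h : I.card = a) :
    Decor.evalAt (Decor.conewton k N a n) I h = ∑ i ∈ Iᶜ, intPow k n i := by
  unfold Decor.evalAt Decor.conewton intPow
  split_ifs
  · simp
  · rw [map_sum, ← sum_finSumEquiv_inr I h (by rw [Finset.card_compl, Fintype.card_fin, h])]
    simp

/-! ### Evaluation of dots on colored faces. -/

section Dots

variable {Face : Type} [Fintype Face] {thickness : Face → ℕ} (col : Face → Finset (Fin N))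
  (hcol : ∀ f, (col f).card = thickness f)

/-- The evaluation of a placement of dots on colored faces. -/
def dotsEval : Dots k N thickness →* MvPolynomial (Fin N) k where
  toFun d := ∏ f, Decor.evalAt (d f) (col f) (hcol f)
  map_one' := Finset.prod_eq_one fun f _ => Decor.evalAt_one _ _
  map_mul' d d' := by
    rw [← Finset.prod_mul_distrib]
    exact Finset.prod_congr rfl fun f _ => Decor.evalAt_mul _ _ _ _

theorem dotsEval_dot [DecidableEq Face] (f : Face) (R : Decor k N (thickness f)) :
    dotsEval col hcol (dot f R) = Decor.evalAt R (col f) (hcol f) := by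
  change ∏ g, Decor.evalAt _ _ _ = _
  rw [Finset.prod_eq_single f]
  · simp [dot]
  · intro g _ hg
    rw [dot, Pi.mulSingle_eq_of_ne hg, Decor.evalAt_one]
  · simp

/-- The linear extension of `dotsEval`. -/
def termsEval : (Dots k N thickness →₀ k) →ₗ[k] MvPolynomial (Fin N) k :=
  Finsupp.linearCombination k (dotsEval col hcol)

theorem termsEval_single (d : Dots k N thickness) (x : k) :
    termsEval col hcol (Finsupp.single d x) = x • dotsEval col hcol d :=
  Finsupp.linearCombination_single _ _ _

/-- Used to extend dots from a basic foam, or from one factor of a composition, by `1` on the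
remaining faces: the evaluation is unchanged, so the Leibniz rule on foams becomes addition. -/
theorem termsEval_mapDomain {Face' : Type} [Fintype Face'] {thickness' : Face' → ℕ}
    (col' : Face' → Finset (Fin N)) (hcol' : ∀ f, (col' f).card = thickness' f)
    (g : Dots k N thickness' → Dots k N thickness)
    (hg : ∀ d, dotsEval col hcol (g d) = dotsEval col' hcol' d)
    (t : Dots k N thickness' →₀ k) :
    termsEval col hcol (t.mapDomain g) = termsEval col' hcol' t := by
  rw [termsEval, Finsupp.linearCombination_mapDomain, termsEval]
  congr 2
  exact funext hg

end Dots

/-- The sum of the `γ i j` for `i` in the first set and `j` in the second one. -/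
def pairSum {M : Type*} [AddCommMonoid M] (γ : Fin N → Fin N → M) (S T : Finset (Fin N)) : M :=
  ∑ i ∈ S, ∑ j ∈ T, γ i j

theorem pairSum_union_left {M : Type*} [AddCommMonoid M] (γ : Fin N → Fin N → M)
    {S S' : Finset (Fin N)} (T : Finset (Fin N)) (h : Disjoint S S') :
    pairSum γ (S ∪ S') T = pairSum γ S T + pairSum γ S' T :=
  Finset.sum_union h

theorem pairSum_union_right {M : Type*} [AddCommMonoid M] (γ : Fin N → Fin N → M)
    (S : Finset (Fin N)) {T T' : Finset (Fin N)} (h : Disjoint T T') :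
    pairSum γ S (T ∪ T') = pairSum γ S T + pairSum γ S T' := by
  simp only [pairSum, Finset.sum_union h, Finset.sum_add_distrib]

theorem sum_mul_sum_eq_pairSum {M : Type*} [NonUnitalNonAssocSemiring M] (f g : Fin N → M)
    (S T : Finset (Fin N)) :
    (∑ i ∈ S, f i) * ∑ j ∈ T, g j = pairSum (fun i j => f i * g j) S T :=
  Finset.sum_mul_sum _ _ _ _

/-- Interchange of finite sums. The products of power sums with total degree `n` thereby become a
sum over pairs of pigments, the form in which Euler characteristics appear. -/
theorem pairSum_complete (n : ℤ) (S T : Finset (Fin N)) :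
    pairSum (complete k n) S T =
      ∑ p ∈ pairsWithSum n, (∑ i ∈ S, intPow k p.1 i) * ∑ j ∈ T, intPow k p.2 j := by
  simp only [sum_mul_sum_eq_pairSum, pairSum, complete]
  rw [Finset.sum_comm]
  rw [Finset.sum_congr rfl fun i _ => Finset.sum_comm (s := S) (t := pairsWithSum n)]
  rw [Finset.sum_comm]
  exact (Finset.sum_congr rfl fun p _ => Finset.sum_comm)

section Dots

variable {Face : Type} [Fintype Face] [DecidableEq Face] {thickness : Face → ℕ}
  (col : Face → Finset (Fin N)) (hcol : ∀ f, (col f).card = thickness f)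

theorem termsEval_bindingTerms (n : ℤ) (f g : Face) (x y z : k) :
    termsEval col hcol (bindingTerms n f g x y z) =
      x • pairSum (fun i j => intPow k n i * intPow k 0 j) (col f) (col g) +
        y • pairSum (fun i j => intPow k 0 i * intPow k n j) (col f) (col g) +
        z • pairSum (complete k n) (col f) (col g) := by
  simp only [bindingTerms, newtonPair, map_add, map_sum, termsEval_single, map_mul, dotsEval_dot,
    Decor.evalAt_newton, pairSum_complete, Finset.smul_sum, sum_mul_sum_eq_pairSum]

/-- A disk behaves like a binding whose second side is the complement, because the hatted power sums
are evaluated on the complementary variables. -/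
theorem termsEval_diskTerms (n : ℤ) (f : Face) (x y z : k) :
    termsEval col hcol (diskTerms n f x y z) =
      x • pairSum (fun i j => intPow k 0 i * intPow k n j) (col f) (col f)ᶜ +
        y • pairSum (fun i j => intPow k n i * intPow k 0 j) (col f) (col f)ᶜ +
        z • pairSum (complete k n) (col f) (col f)ᶜ := by
  simp only [diskTerms, coNewtonPair, map_add, map_sum, termsEval_single, dotsEval_dot,
    Decor.evalAt_newton, Decor.evalAt_conewton, Decor.evalAt_mul, pairSum_complete,
    Finset.smul_sum, sum_mul_sum_eq_pairSum]

end Dots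

/-! ### Logarithmic derivatives -/

/-- The logarithmic derivative of units. -/
def logDeriv {A : Type*} [CommRing A] [Algebra k A] (D : Derivation k A A) :
    Aˣ →* Multiplicative A where
  toFun u := .ofAdd ((↑u⁻¹ : A) * D u)
  map_one' := by simp
  map_mul' u v := by
    rw [← ofAdd_add]
    congr 1
    simp only [mul_inv, Units.val_mul, Derivation.leibniz, smul_eq_mul]
    -- After the Leibniz rule only the cancellations `u⁻¹ u = 1` and `v⁻¹ v = 1` are needed, one in
    -- each summand.
    linear_combination (↑v⁻¹ * D v : A) * u.inv_mul + (↑u⁻¹ * D u : A) * v.inv_mul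

theorem derivation_unit {A : Type*} [CommRing A] [Algebra k A] (D : Derivation k A A) (u : Aˣ) :
    D u = u * (logDeriv D u).toAdd := by
  simp [logDeriv]

/-- Derivations kill constants. Hence the sign `(-1) ^ s(F,c)` never enters the comparison. -/
theorem logDeriv_neg_one {A : Type*} [CommRing A] [Algebra k A] (D : Derivation k A A) :
    logDeriv D (-1) = 1 := by
  change Multiplicative.ofAdd _ = _
  simp

theorem unit_inv_mul_neg_mul {A : Type*} [CommRing A] (u : Aˣ) (x : A) :
    (↑u⁻¹ : A) * -(↑u * x) = -x := by simp

/-- This is `witt_sub` divided by `X_i - X_j`; the logarithmic derivative of each factor of `Q` is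
therefore a polynomial. -/
theorem logDeriv_diffUnit (n : ℤ) (p : {p : Fin N × Fin N // p.1 < p.2}) :
    (logDeriv (wittRat k N n) (diffUnit p)).toAdd =
      -algebraMap _ _ (complete k n p.1.1 p.1.2) := by
  have h : ((diffUnit p : (RatFun k N)ˣ) : RatFun k N) =
      algebraMap _ _ (X p.1.1 - X p.1.2 : MvPolynomial _ k) :=
    IsUnit.unit_spec _
  change (↑(diffUnit p : (RatFun k N)ˣ)⁻¹ : RatFun k N) *
    wittRat k N n ((diffUnit p : (RatFun k N)ˣ) : RatFun k N) = _
  rw [h, wittRat_algebraMap, witt_sub, map_neg, map_mul, ← h]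
  exact unit_inv_mul_neg_mul _ _

end Algebra

/-! ### Decomposition of a colored foam into colored basic foams. -/

section Pieces

variable {N : ℕ}

/-! ### Colored basic foams in a colored foam -/

/-- The coloring conditions in a local model. -/
structure LocalModel.IsColoring (L : LocalModel) (col : L.Face → Finset (Fin N)) : Prop where
  card_color : ∀ f, (col f).card = L.thickness f
  color_binding : ∀ x, col (L.thick x) = col (L.left x) ∪ col (L.right x)

variable (N) in
/-- A basic foam with sets of pigments on its faces. -/
abbrev Piece : Type := (m : Model) × (m.piece.Face → Finset (Fin N))

/-- The colored basic foams of a colored foam in good position. -/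
def GoodFoam.pieces : {Γ Γ' : Web} → (F : GoodFoam Γ Γ') →
    (F.complex.Face → Finset (Fin N)) → Multiset (Piece N)
  | _, _, .isotopy _, _ => 0
  | _, _, .subdivide _ _, _ => 0
  | _, _, .unsubdivide _ _, _ => 0
  | _, _, .basic m _, col => {⟨m, fun f => col (.inr f)⟩}
  | _, _, .comp F G, col => F.pieces (fun f => col (.inl f)) + G.pieces fun f => col (.inr f)

/-- The lower part of a coloring of a composition. -/
def Coloring.fst {Γ Γ' Γ'' : Web} {F : FoamComplex Γ Γ'} {G : FoamComplex Γ' Γ''}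
    (c : Coloring (F.comp G) N) : Coloring F N where
  color f := c.color (.inl f)
  card_color f := c.card_color (.inl f)
  color_seam x := c.color_seam (.inl x)
  color_binding x := c.color_binding (.inl x)

/-- The upper part of a coloring of a composition. -/
def Coloring.snd {Γ Γ' Γ'' : Web} {F : FoamComplex Γ Γ'} {G : FoamComplex Γ' Γ''}
    (c : Coloring (F.comp G) N) : Coloring G N where
  color f := c.color (.inr f)
  card_color f := c.card_color (.inr f)
  color_seam x := c.color_seam (.inr (.inr x))
  color_binding x := c.color_binding (.inr x)

theorem Coloring.fst_upper {Γ Γ' Γ'' : Web} {F : FoamComplex Γ Γ'} {G : FoamComplex Γ' Γ''}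
    (c : Coloring (F.comp G) N) (e : Γ'.Edge) :
    c.fst.color (F.upper e) = c.snd.color (G.lower e) :=
  c.color_seam (.inr (.inl e))

theorem Coloring.isColoring {L : LocalModel} {K : Tangle L.wOut L.wIn}
    (c : Coloring (FoamComplex.basic L K) N) : L.IsColoring fun f => c.color (.inr f) where
  card_color f := c.card_color (.inr f)
  color_binding x := c.color_binding (.inr x)

/-- Colorings only record unions at bindings; disjointness of the thin colors is recovered from
additivity of thicknesses. -/
theorem disjoint_of_card {S T U : Finset (Fin N)} (h : U = S ∪ T) (h' : U.card = S.card + T.card) :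
    Disjoint S T := by
  rw [← Finset.card_union_eq_card_add_card, ← h, h']

theorem LocalModel.IsColoring.disjoint {L : LocalModel} {col : L.Face → Finset (Fin N)}
    (h : L.IsColoring col) (x : L.Binding) : Disjoint (col (L.left x)) (col (L.right x)) :=
  disjoint_of_card (h.color_binding x) <| by
    rw [h.card_color, h.card_color, h.card_color, L.thickness_binding]

theorem Coloring.disjoint {Γ Γ' : Web} {F : FoamComplex Γ Γ'} (c : Coloring F N) (x : F.Binding) :
    Disjoint (c.color (F.left x)) (c.color (F.right x)) :=
  disjoint_of_card (c.color_binding x) <| by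
    rw [c.card_color, c.card_color, c.card_color, F.thickness_binding]

theorem GoodFoam.isColoring_of_mem_pieces {Γ Γ' : Web} (F : GoodFoam Γ Γ') (hF : F.IsSpherical)
    (c : Coloring F.complex N) :
    ∀ x ∈ F.pieces c.color, x.1.piece.IsColoring x.2 ∧ ∀ a, x.1 ≠ .saddle a := by
  induction F with
  | isotopy => intro x hx; exact absurd hx (Multiset.notMem_zero x)
  | subdivide => intro x hx; exact absurd hx (Multiset.notMem_zero x)
  | unsubdivide => intro x hx; exact absurd hx (Multiset.notMem_zero x)
  | basic m K =>
    intro x hx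
    obtain rfl := Multiset.mem_singleton.1 hx
    exact ⟨Coloring.isColoring c, hF⟩
  | comp F G ihF ihG =>
    intro x hx
    rcases Multiset.mem_add.1 hx with hx | hx
    · exact ihF hF.1 (Coloring.fst c) x hx
    · exact ihG hF.2 (Coloring.snd c) x hx

/-- The coloring conditions on a web. -/
structure Tangle.IsColoring {In Out : Type} {wIn : In → ℕ} {wOut : Out → ℕ} (T : Tangle wIn wOut)
    (col : T.Edge → Finset (Fin N)) : Prop where
  color_mark : ∀ m, col (T.start.symm (.mark m)) = col (T.finish.symm (.mark m))
  color_node : ∀ v, col (T.thickEdge v) = col (T.leftEdge v) ∪ col (T.rightEdge v)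
  disjoint : ∀ v, Disjoint (col (T.leftEdge v)) (col (T.rightEdge v))

end Pieces

/-! ### Sums over cells -/

section Sums

variable {M : Type*} [AddCommMonoid M]

theorem Side.sum_univ (f : Side → M) : ∑ x, f x = f .left + f .right :=
  Finset.sum_pair (by decide)

theorem YFace.sum_univ (f : YFace → M) : ∑ x, f x = f .thick + f .left + f .right := by
  change ∑ x ∈ {YFace.thick, .left, .right}, f x = _
  rw [Finset.sum_insert (by decide), Finset.sum_pair (by decide), add_assoc]

theorem Leg.sum_univ (f : Leg → M) : ∑ x, f x = f .a + f .b + f .c := by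
  change ∑ x ∈ {Leg.a, .b, .c}, f x = _
  rw [Finset.sum_insert (by decide), Finset.sum_pair (by decide), add_assoc]

theorem TreeNode.sum_univ (f : TreeNode → M) : ∑ x, f x = f .outer + f .inner :=
  Finset.sum_pair (by decide)

theorem TFace.sum_univ (f : TFace → M) :
    ∑ x, f x = f .abc + (f .ab + (f .bc + (f .a + (f .b + f .c)))) := by
  change ∑ x ∈ {TFace.abc, .ab, .bc, .a, .b, .c}, f x = _
  rw [Finset.sum_insert (by decide), Finset.sum_insert (by decide), Finset.sum_insert (by decide),
    Finset.sum_insert (by decide), Finset.sum_pair (by decide)]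

theorem TBinding.sum_univ (f : TBinding → M) :
    ∑ x, f x = f .ab_c + (f .a_b + (f .a_bc + f .b_c)) := by
  change ∑ x ∈ {TBinding.ab_c, .a_b, .a_bc, .b_c}, f x = _
  rw [Finset.sum_insert (by decide), Finset.sum_insert (by decide), Finset.sum_pair (by decide)]

/-- The summands are compared through hypotheses, so that for cells of glued or stacked complexes,
whose types are sums only after unfolding, definitional equality closes them. -/
theorem sum_sum_of_eq {α β : Type*} [Fintype α] [Fintype β] {f : α ⊕ β → M} {g : α → M}
    {h : β → M} (hg : ∀ a, f (.inl a) = g a) (hh : ∀ b, f (.inr b) = h b) :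
    ∑ x, f x = ∑ a, g a + ∑ b, h b := by
  rw [Fintype.sum_sum_type]
  exact congrArg₂ _ (Finset.sum_congr rfl fun a _ => hg a) (Finset.sum_congr rfl fun b _ => hh b)

theorem sum_sum_sum_of_eq {α β γ : Type*} [Fintype α] [Fintype β] [Fintype γ]
    {f : α ⊕ (β ⊕ γ) → M} {g : α → M} {h : β → M} {i : γ → M} (hg : ∀ a, f (.inl a) = g a)
    (hh : ∀ b, f (.inr (.inl b)) = h b) (hi : ∀ b, f (.inr (.inr b)) = i b) :
    ∑ x, f x = ∑ a, g a + (∑ b, h b + ∑ c, i c) :=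
  (sum_sum_of_eq hg fun _ => rfl).trans (congrArg _ (sum_sum_of_eq hh hi))

/-- The starts of edges, as a disjoint union. -/
def Start.equivSum (In M S G : Type) : Start In M S G ≃ In ⊕ (M ⊕ (S ⊕ (S ⊕ G))) where
  toFun
    | .boundary p => .inl p
    | .mark m => .inr (.inl m)
    | .splitLeft v => .inr (.inr (.inl v))
    | .splitRight v => .inr (.inr (.inr (.inl v)))
    | .merge v => .inr (.inr (.inr (.inr v)))
  invFun
    | .inl p => .boundary p
    | .inr (.inl m) => .mark m
    | .inr (.inr (.inl v)) => .splitLeft v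
    | .inr (.inr (.inr (.inl v))) => .splitRight v
    | .inr (.inr (.inr (.inr v))) => .merge v
  left_inv := by rintro (_ | _ | _ | _ | _) <;> rfl
  right_inv := by rintro (_ | _ | _ | _ | _) <;> rfl

/-- The ends of edges, as a disjoint union. -/
def Finish.equivSum (Out M S G : Type) : Finish Out M S G ≃ Out ⊕ (M ⊕ (S ⊕ (G ⊕ G))) where
  toFun
    | .boundary p => .inl p
    | .mark m => .inr (.inl m)
    | .split v => .inr (.inr (.inl v))
    | .mergeLeft v => .inr (.inr (.inr (.inl v)))
    | .mergeRight v => .inr (.inr (.inr (.inr v)))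
  invFun
    | .inl p => .boundary p
    | .inr (.inl m) => .mark m
    | .inr (.inr (.inl v)) => .split v
    | .inr (.inr (.inr (.inl v))) => .mergeLeft v
    | .inr (.inr (.inr (.inr v))) => .mergeRight v
  left_inv := by rintro (_ | _ | _ | _ | _) <;> rfl
  right_inv := by rintro (_ | _ | _ | _ | _) <;> rfl

variable {In Out : Type} {wIn : In → ℕ} {wOut : Out → ℕ}

/-- Every edge starts at exactly one place. With the analogous statement for finishes this is the
double count behind all edge-vertex identities below. -/
theorem Tangle.sum_start [Fintype In] (T : Tangle wIn wOut) (f : T.Edge → M) :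
    ∑ e, f e = ∑ p, f (T.start.symm (.boundary p)) + (∑ m, f (T.start.symm (.mark m)) +
      (∑ v, f (T.start.symm (.splitLeft v)) + (∑ v, f (T.start.symm (.splitRight v)) +
        ∑ v, f (T.start.symm (.merge v))))) := by
  rw [← ((T.start.trans (Start.equivSum _ _ _ _)).symm.sum_comp f)]
  simp only [Fintype.sum_sum_type]
  rfl

theorem Tangle.sum_finish [Fintype Out] (T : Tangle wIn wOut) (f : T.Edge → M) :
    ∑ e, f e = ∑ p, f (T.finish.symm (.boundary p)) + (∑ m, f (T.finish.symm (.mark m)) +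
      (∑ v, f (T.finish.symm (.split v)) + (∑ v, f (T.finish.symm (.mergeLeft v)) +
        ∑ v, f (T.finish.symm (.mergeRight v))))) := by
  rw [← ((T.finish.trans (Finish.equivSum _ _ _ _)).symm.sum_comp f)]
  simp only [Fintype.sum_sum_type]
  rfl

open Classical in
/-- The integer which is one if the proposition holds and zero otherwise. -/
def ind (p : Prop) : ℤ := if p then 1 else 0

theorem natCard_subtype {α : Type*} [Fintype α] (p : α → Prop) :
    (Nat.card {x // p x} : ℤ) = ∑ x, ind (p x) := by
  classical
  rw [Nat.card_eq_fintype_card, Fintype.card_subtype]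
  simp [ind]

end Sums

/-! ### Unions of circles in webs -/

section Cycles

variable {In Out : Type} {wIn : In → ℕ} {wOut : Out → ℕ} {N : ℕ}

/-- A set of edges which is a one-dimensional manifold. -/
structure Tangle.IsCycle (T : Tangle wIn wOut) (B : T.Edge → Prop) : Prop where
  mark : ∀ m, B (T.start.symm (.mark m)) ↔ B (T.finish.symm (.mark m))
  node : ∀ v, ind (B (T.thickEdge v)) + ind (B (T.leftEdge v)) + ind (B (T.rightEdge v)) =
    2 * ind (B (T.thickEdge v) ∨ B (T.leftEdge v) ∨ B (T.rightEdge v))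

/-- At a trivalent vertex the edges carrying exactly one of `i`, `j` number zero or two: with one of
the pigments present they are the thick edge and one thin edge, with both on different sides they
are the two thin edges, and otherwise there are none. -/
theorem ind_xor_node {S T U : Finset (Fin N)} (h : U = S ∪ T) (hd : Disjoint S T) (i j : Fin N) :
    ind (Xor (i ∈ U) (j ∈ U)) + ind (Xor (i ∈ S) (j ∈ S)) + ind (Xor (i ∈ T) (j ∈ T)) =
      2 * ind (Xor (i ∈ U) (j ∈ U) ∨ Xor (i ∈ S) (j ∈ S) ∨ Xor (i ∈ T) (j ∈ T)) := by
  have hi : i ∈ S → i ∉ T := fun h h' => Finset.disjoint_left.1 hd h h'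
  have hj : j ∈ S → j ∉ T := fun h h' => Finset.disjoint_left.1 hd h h'
  subst h
  by_cases h1 : i ∈ S <;> by_cases h2 : j ∈ S <;> by_cases h3 : i ∈ T <;> by_cases h4 : j ∈ T <;>
    simp_all [ind, Xor]

theorem Tangle.IsColoring.isCycle {T : Tangle wIn wOut} {col : T.Edge → Finset (Fin N)}
    (h : T.IsColoring col) (i j : Fin N) : T.IsCycle fun e => Xor (i ∈ col e) (j ∈ col e) where
  mark m := by rw [h.color_mark]
  node v := ind_xor_node (h.color_node v) (h.disjoint v) i j

variable [Fintype In] [Fintype Out]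

/-- Handshake count: each edge has two ends, each used interior vertex receives two of them, each
used boundary point one. -/
theorem Tangle.IsCycle.two_mul_sum {T : Tangle wIn wOut} {B : T.Edge → Prop} (h : T.IsCycle B) :
    2 * ∑ e, ind (B e) = ∑ p, ind (B (T.start.symm (.boundary p))) +
      ∑ p, ind (B (T.finish.symm (.boundary p))) + 2 * ∑ m, ind (B (T.start.symm (.mark m))) +
      2 * ∑ v, ind (B (T.thickEdge v) ∨ B (T.leftEdge v) ∨ B (T.rightEdge v)) := by
  have h1 := T.sum_start fun e => ind (B e)
  have h2 := T.sum_finish fun e => ind (B e)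
  have h3 : ∑ m, ind (B (T.start.symm (.mark m))) = ∑ m, ind (B (T.finish.symm (.mark m))) :=
    Finset.sum_congr rfl fun m _ => by rw [h.mark]
  have h4 : ∑ v, (ind (B (T.thickEdge v)) + ind (B (T.leftEdge v)) + ind (B (T.rightEdge v))) =
      2 * ∑ v, ind (B (T.thickEdge v) ∨ B (T.leftEdge v) ∨ B (T.rightEdge v)) := by
    rw [Finset.mul_sum]
    exact Finset.sum_congr rfl fun v _ => h.node v
  simp only [Finset.sum_add_distrib, Fintype.sum_sum_type, Tangle.thickEdge, Tangle.leftEdge,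
    Tangle.rightEdge] at h4 ⊢
  linarith

end Cycles

/-! ### Euler characteristics -/

section Euler

variable {N : ℕ}

theorem FoamComplex.euler_eq {Γ Γ' : Web} (F : FoamComplex Γ Γ') (A : F.Face → Prop) :
    F.euler A = ∑ f, ind (A f) - ∑ x, ind (A (F.side₁ x) ∨ A (F.side₂ x)) -
      ∑ x, ind (A (F.thick x) ∨ A (F.left x) ∨ A (F.right x)) +
      ∑ p, ind (∃ f ∈ F.around p, A f) := by
  simp only [FoamComplex.euler, natCard_subtype]

/-- A closed one-dimensional manifold has Euler characteristic zero. -/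
theorem Tangle.IsCycle.sum_eq {Γ : Web} {B : Γ.Edge → Prop} (h : Γ.IsCycle B) :
    ∑ e, ind (B e) = ∑ m, ind (B (Γ.start.symm (.mark m))) +
      ∑ v, ind (B (Γ.thickEdge v) ∨ B (Γ.leftEdge v) ∨ B (Γ.rightEdge v)) := by
  have := h.two_mul_sum
  simp only [Fintype.sum_empty] at this
  linarith

/-- Only the open cells between bottom and top are counted. In a product these are the edges and
vertices of the web raised by one dimension, and they cancel by `Tangle.IsCycle.sum_eq`. -/
theorem FoamComplex.euler_cylinder {Γ Γ' : Web} (φ : WebIso Γ Γ') {B : Γ.Edge → Prop}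
    (h : Γ.IsCycle B) : (FoamComplex.cylinder φ).euler B = 0 := by
  have h0 := h.sum_eq
  have h1 : ∑ m, ind (B (Γ.start.symm (.mark m))) = ∑ m, ind (B (Γ.start.symm (.mark m)) ∨
      B (Γ.finish.symm (.mark m))) := Finset.sum_congr rfl fun m _ => by rw [← h.mark, or_self]
  refine (FoamComplex.euler_eq (FoamComplex.cylinder φ) B).trans ?_
  change ∑ e : Γ.Edge, ind (B e) - ∑ m : Γ.Mark, ind (B (Γ.start.symm (.mark m)) ∨
      B (Γ.finish.symm (.mark m))) -
    ∑ v : Γ.Node, ind (B (Γ.thickEdge v) ∨ B (Γ.leftEdge v) ∨ B (Γ.rightEdge v)) + 0 = 0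
  linarith

/-- The added marked point lies on the top boundary, which is not counted, so the cells that matter
are those of the cylinder over the identity. -/
theorem FoamComplex.euler_subdivide {Γ : Web} (e : Γ.Edge) {B : Γ.Edge → Prop}
    (h : Γ.IsCycle B) : (FoamComplex.subdivide Γ e).euler B = 0 :=
  FoamComplex.euler_cylinder (Γ' := Γ)
    ⟨.refl _, .refl _, .refl _, .refl _, fun e => by cases h : Γ.start e <;> simp [Start.map, h],
      fun e => by cases h : Γ.finish e <;> simp [Finish.map, h], fun _ => rfl⟩ h

/-- Stacking adds the cells of the surface on the intermediate web. This slice is a union of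
circles, so its edges (new seams) and vertices (new points) cancel. -/
theorem FoamComplex.euler_comp {Γ Γ' Γ'' : Web} (F : FoamComplex Γ Γ') (G : FoamComplex Γ' Γ'')
    (A : (F.comp G).Face → Prop) (hA : ∀ e, A (.inl (F.upper e)) ↔ A (.inr (G.lower e)))
    (h : Γ'.IsCycle fun e => A (.inl (F.upper e))) :
    (F.comp G).euler A = F.euler (fun f => A (.inl f)) + G.euler fun f => A (.inr f) := by
  have h0 := FoamComplex.euler_eq (F.comp G) A
  have h0F := FoamComplex.euler_eq F fun f => A (.inl f)
  have h0G := FoamComplex.euler_eq G fun f => A (.inr f)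
  have h1 : ∑ f, ind (A f) = ∑ f : F.Face, ind (A (.inl f)) + ∑ f : G.Face, ind (A (.inr f)) :=
    Fintype.sum_sum_type _
  have h2 : ∑ x, ind (A ((F.comp G).side₁ x) ∨ A ((F.comp G).side₂ x)) =
      ∑ x, ind (A (.inl (F.side₁ x)) ∨ A (.inl (F.side₂ x))) +
      (∑ e, ind (A (.inl (F.upper e)) ∨ A (.inr (G.lower e))) +
        ∑ x, ind (A (.inr (G.side₁ x)) ∨ A (.inr (G.side₂ x)))) := by
    exact sum_sum_sum_of_eq (fun _ => rfl) (fun _ => rfl) fun _ => rfl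
  have h3 : ∑ x, ind (A ((F.comp G).thick x) ∨ A ((F.comp G).left x) ∨ A ((F.comp G).right x)) =
      ∑ x, ind (A (.inl (F.thick x)) ∨ A (.inl (F.left x)) ∨ A (.inl (F.right x))) +
      ∑ x, ind (A (.inr (G.thick x)) ∨ A (.inr (G.left x)) ∨ A (.inr (G.right x))) := by
    exact sum_sum_of_eq (fun _ => rfl) fun _ => rfl
  have h4 : ∑ p, ind (∃ f ∈ (F.comp G).around p, A f) =
      ∑ p, ind (∃ f ∈ F.around p, A (.inl f)) +
      (∑ v : Γ'.Vertex, ind (∃ e, Γ'.Touches e v ∧ A (.inl (F.upper e))) +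
        ∑ p, ind (∃ f ∈ G.around p, A (.inr f))) := by
    refine sum_sum_sum_of_eq (fun p => ?_) (fun v => ?_) fun p => ?_
    · exact congrArg ind (propext (Set.exists_mem_image))
    · refine congrArg ind (propext ⟨?_, ?_⟩)
      · rintro ⟨f, ⟨e, he, rfl | rfl⟩, hf⟩
        · exact ⟨e, he, hf⟩
        · exact ⟨e, he, (hA e).2 hf⟩
      · rintro ⟨e, he, hf⟩
        exact ⟨_, ⟨e, he, .inl rfl⟩, hf⟩
    · exact congrArg ind (propext (Set.exists_mem_image))
  have h5 : ∑ v : Γ'.Vertex, ind (∃ e, Γ'.Touches e v ∧ A (.inl (F.upper e))) =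
      ∑ e, ind (A (.inl (F.upper e)) ∨ A (.inr (G.lower e))) := by
    have h6 : ∀ e, ind (A (.inl (F.upper e)) ∨ A (.inr (G.lower e))) =
      ind (A (.inl (F.upper e))) := fun e => by rw [← hA, or_self]
    simp only [h6]
    rw [h.sum_eq, Fintype.sum_sum_type]
    congr 1
    · refine Finset.sum_congr rfl fun m _ => congrArg ind (propext ⟨?_, ?_⟩)
      · rintro ⟨e, rfl | rfl, he⟩
        · exact he
        · exact (h.mark m).2 he
      · exact fun he => ⟨_, .inl rfl, he⟩
    · refine Finset.sum_congr rfl fun v _ => congrArg ind (propext ?_)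
      rcases v with v | v
      · simp [Tangle.Touches, Tangle.thickEdge, Tangle.leftEdge, Tangle.rightEdge, or_and_right,
          exists_or]
      · simp [Tangle.Touches, Tangle.thickEdge, Tangle.leftEdge, Tangle.rightEdge, or_and_right,
          exists_or]
  linear_combination h0 - h0F - h0G + h1 - h2 - h3 + h4 + h5

/-- Twice the contribution of a local model to Euler characteristics. -/
def LocalModel.eulerDouble (L : LocalModel) (A : L.Face → Prop) : ℤ :=
  2 * (∑ f, ind (A f) - ∑ x, ind (A (L.thick x) ∨ A (L.left x) ∨ A (L.right x)) +
      ∑ p, ind (∃ f ∈ L.around p, A f)) -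
    ∑ p, ind (A (L.lower (L.bot.start.symm (.boundary p)))) -
    ∑ p, ind (A (L.lower (L.bot.finish.symm (.boundary p))))

/-- By the handshake count, the product over `K` contributes half the number of used boundary
points, while the seams on the wall of the cylinder subtract that whole number. Doubling keeps the
resulting half-integers in `ℤ`. -/
theorem FoamComplex.two_mul_euler_basic {L : LocalModel} {K : Tangle L.wOut L.wIn}
    (A : K.Edge ⊕ L.Face → Prop)
    (hin : ∀ p, A (.inr (L.lower (L.bot.start.symm (.boundary p)))) ↔
      A (.inl (K.finish.symm (.boundary p))))
    (hout : ∀ p, A (.inl (K.start.symm (.boundary p))) ↔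
      A (.inr (L.lower (L.bot.finish.symm (.boundary p)))))
    (h : K.IsCycle fun e => A (.inl e)) :
    2 * (FoamComplex.basic L K).euler A = L.eulerDouble fun f => A (.inr f) := by
  have h0 := FoamComplex.euler_eq (FoamComplex.basic L K) A
  have h1 : ∑ f : (FoamComplex.basic L K).Face, ind (A f) =
      ∑ f : K.Edge, ind (A (.inl f)) + ∑ f : L.Face, ind (A (.inr f)) :=
    Fintype.sum_sum_type _
  have h2 : ∑ x, ind (A ((FoamComplex.basic L K).side₁ x) ∨ A ((FoamComplex.basic L K).side₂ x)) =
      ∑ m, ind (A (.inl (K.start.symm (.mark m)))) +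
      (∑ p, ind (A (.inr (L.lower (L.bot.start.symm (.boundary p))))) +
        ∑ p, ind (A (.inr (L.lower (L.bot.finish.symm (.boundary p)))))) := by
    refine sum_sum_sum_of_eq (fun x => ?_) (fun x => ?_) fun x => ?_
    · exact congrArg ind (propext ((or_congr_right (h.mark x).symm).trans (or_self_iff)))
    · exact congrArg ind (propext ((or_congr_right (hin x).symm).trans (or_self_iff)))
    · exact congrArg ind (propext ((or_congr_left (hout x)).trans (or_self_iff)))
  have h3 : ∑ x, ind (A ((FoamComplex.basic L K).thick x) ∨ A ((FoamComplex.basic L K).left x) ∨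
        A ((FoamComplex.basic L K).right x)) =
      ∑ x, ind (A (.inl (K.thickEdge x)) ∨ A (.inl (K.leftEdge x)) ∨ A (.inl (K.rightEdge x))) +
      ∑ x, ind (A (.inr (L.thick x)) ∨ A (.inr (L.left x)) ∨ A (.inr (L.right x))) := by
    exact sum_sum_of_eq (fun _ => rfl) fun _ => rfl
  have h4 : ∑ p, ind (∃ f ∈ (FoamComplex.basic L K).around p, A f) =
      ∑ p, ind (∃ f ∈ L.around p, A (.inr f)) :=
    Finset.sum_congr rfl fun p _ => congrArg ind (propext (Set.exists_mem_image))
  have h5 := h.two_mul_sum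
  have h6 : ∑ p, ind (A (.inl (K.start.symm (.boundary p)))) =
      ∑ p, ind (A (.inr (L.lower (L.bot.finish.symm (.boundary p))))) :=
    Finset.sum_congr rfl fun p _ => by rw [hout]
  have h7 : ∑ p, ind (A (.inl (K.finish.symm (.boundary p)))) =
      ∑ p, ind (A (.inr (L.lower (L.bot.start.symm (.boundary p))))) :=
    Finset.sum_congr rfl fun p _ => by rw [hin]
  rw [LocalModel.eulerDouble]
  linear_combination 2 * (h0 + h1 - h2 - h3 + h4) + h5 + h6 + h7

end Euler

/-! ### Unions of components of one-colored webs -/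

section Sub

variable {In Out : Type} {wIn : In → ℕ} {wOut : Out → ℕ} {N : ℕ}

/-- `B` is a union of components of `A`, for the set `A` of the edges of a colored web which contain
a given pigment. -/
structure Tangle.IsSub (T : Tangle wIn wOut) (A B : T.Edge → Prop) : Prop where
  le : ∀ e, B e → A e
  mark : ∀ m, B (T.start.symm (.mark m)) ↔ B (T.finish.symm (.mark m))
  node : ∀ v, B (T.thickEdge v) ↔ B (T.leftEdge v) ∨ B (T.rightEdge v)

/-- The number of unions of components of `A`. -/
def Tangle.subCount (T : Tangle wIn wOut) (A : T.Edge → Prop) : ℕ :=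
  Nat.card {B // T.IsSub A B}

theorem Tangle.IsColoring.isSub {T : Tangle wIn wOut} {col : T.Edge → Finset (Fin N)}
    (h : T.IsColoring col) (i : Fin N) : T.IsSub (fun e => i ∈ col e) fun e => i ∈ col e where
  le _ := id
  mark m := by rw [h.color_mark]
  node v := by rw [h.color_node, Finset.mem_union]

/-! ### Unions of components when the inside of a disk is replaced. -/

section Glue

variable [Fintype In] [Fintype Out] {K : Tangle wOut wIn} {T : Tangle wIn wOut}

theorem Tangle.IsSub.glue {A B : K.Edge ⊕ T.Edge → Prop}
    (hK : K.IsSub (fun e => A (.inl e)) fun e => B (.inl e))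
    (hT : T.IsSub (fun e => A (.inr e)) fun e => B (.inr e))
    (hin : ∀ p, B (.inr (T.start.symm (.boundary p))) ↔ B (.inl (K.finish.symm (.boundary p))))
    (hout : ∀ p, B (.inl (K.start.symm (.boundary p))) ↔ B (.inr (T.finish.symm (.boundary p)))) :
    (K.glue T).IsSub A B where
  le := by
    rintro (e | e)
    · exact hK.le e
    · exact hT.le e
  mark := by
    rintro ((m | m) | (p | p))
    · exact hK.mark m
    · exact hT.mark m
    · exact hin p
    · exact hout p
  node := by
    rintro ((v | v) | (v | v))
    · exact hK.node (.inl v)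
    · exact hT.node (.inl v)
    · exact hK.node (.inr v)
    · exact hT.node (.inr v)



theorem Tangle.IsSub.outside {A B : K.Edge ⊕ T.Edge → Prop} (h : (K.glue T).IsSub A B) :
    K.IsSub (fun e => A (.inl e)) fun e => B (.inl e) where
  le e := h.le (.inl e)
  mark m := h.mark (.inl (.inl m))
  node := by
    rintro (v | v)
    · exact h.node (.inl (.inl v))
    · exact h.node (.inr (.inl v))

theorem Tangle.IsSub.inside {A B : K.Edge ⊕ T.Edge → Prop} (h : (K.glue T).IsSub A B) :
    T.IsSub (fun e => A (.inr e)) fun e => B (.inr e) where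
  le e := h.le (.inr e)
  mark m := h.mark (.inl (.inr m))
  node := by
    rintro (v | v)
    · exact h.node (.inl (.inr v))
    · exact h.node (.inr (.inr v))

theorem Tangle.IsSub.wall_in {A B : K.Edge ⊕ T.Edge → Prop} (h : (K.glue T).IsSub A B) (p : In) :
    B (.inr (T.start.symm (.boundary p))) ↔ B (.inl (K.finish.symm (.boundary p))) :=
  h.mark (.inr (.inl p))

theorem Tangle.IsSub.wall_out {A B : K.Edge ⊕ T.Edge → Prop} (h : (K.glue T).IsSub A B) (p : Out) :
    B (.inl (K.start.symm (.boundary p))) ↔ B (.inr (T.finish.symm (.boundary p))) :=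
  h.mark (.inr (.inr p))

/-- The set `A` of edges of a web in a disk is connected or empty. -/
def Tangle.IsPreconnected (T : Tangle wIn wOut) (A : T.Edge → Prop) : Prop :=
  ∀ B, T.IsSub A B → ∃ t : Prop, ∀ e, B e ↔ t ∧ A e

/-- When the inside is connected, a union of components contains all of it or none of it, and this
one bit can be carried over to another inside with the same boundary values. The resulting map of
unions of components is injective as long as a nonempty inside is replaced by a nonempty one. -/
theorem Tangle.subCount_glue_le (K : Tangle wOut wIn) {T T' : Tangle wIn wOut} (A : K.Edge → Prop)
    {a : T.Edge → Prop} {a' : T'.Edge → Prop} (ha' : T'.IsSub a' a') (hT : T.IsPreconnected a)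
    (hin : ∀ p, a (T.start.symm (.boundary p)) ↔ a' (T'.start.symm (.boundary p)))
    (hout : ∀ p, a (T.finish.symm (.boundary p)) ↔ a' (T'.finish.symm (.boundary p)))
    (hne : ∀ e, a e → ∃ e', a' e') :
    (K.glue T).subCount (Sum.elim A a) ≤ (K.glue T').subCount (Sum.elim A a') := by
  -- Keep `B` outside; inside take all of `a'` if `B` meets the old inside, and nothing otherwise.
  let g : (K.Edge ⊕ T.Edge → Prop) → K.Edge ⊕ T'.Edge → Prop := fun B =>
    Sum.elim (fun e => B (.inl e)) fun e => (∃ x, B (.inr x)) ∧ a' e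
  have key : ∀ B : K.Edge ⊕ T.Edge → Prop, (K.glue T).IsSub (Sum.elim A a) B →
      ∀ e, B (.inr e) ↔ (∃ x, B (.inr x)) ∧ a e := by
    intro B hB e
    obtain ⟨t, ht⟩ := hT _ hB.inside
    refine ⟨fun h => ⟨⟨e, h⟩, hB.inside.le e h⟩, ?_⟩
    rintro ⟨⟨x, hx⟩, he⟩
    exact (ht e).2 ⟨((ht x).1 hx).1, he⟩
  have hg : ∀ B, (K.glue T).IsSub (Sum.elim A a) B → (K.glue T').IsSub (Sum.elim A a') (g B) := by
    intro B hB
    refine Tangle.IsSub.glue hB.outside ⟨fun e he => he.2, fun m => ?_, fun v => ?_⟩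
      (fun p => ?_) fun p => ?_
    · exact and_congr_right fun _ => ha'.mark m
    · exact (and_congr_right fun _ => ha'.node v).trans and_or_left
    · exact (and_congr_right fun _ => (hin p).symm).trans ((key B hB _).symm.trans (hB.wall_in p))
    · exact (hB.wall_out p).trans ((key B hB _).trans (and_congr_right fun _ => hout p))
  refine Nat.card_le_card_of_injective
    (fun B : {B // (K.glue T).IsSub (Sum.elim A a) B} => (⟨g B.1, hg B.1 B.2⟩ :
      {B // (K.glue T').IsSub (Sum.elim A a') B})) ?_
  -- The bit "meets the inside" can be read off `g B`, because `hne` provides an edge of `a'` that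
  -- shows it.
  have hle : ∀ B C : K.Edge ⊕ T.Edge → Prop, (K.glue T).IsSub (Sum.elim A a) B →
      g B = g C → (∃ x, B (.inr x)) → ∃ x, C (.inr x) := by
    rintro B C hB h ⟨x, hx⟩
    obtain ⟨e', he'⟩ := hne x (hB.inside.le x hx)
    have h2 := congrFun h (.inr e')
    exact (h2.mp ⟨⟨x, hx⟩, he'⟩ : (∃ x, C (.inr x)) ∧ a' e').1
  rintro ⟨B, hB⟩ ⟨C, hC⟩ h
  have h' : g B = g C := congrArg Subtype.val h
  refine Subtype.ext (funext ?_)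
  rintro (e | e)
  · exact congrFun h' (.inl e)
  · exact propext ((key B hB e).trans ((and_congr_left fun _ =>
      ⟨hle B C hB h', hle C B hC h'.symm⟩).trans (key C hC e).symm))

theorem natCard_imp (P : Prop) [Decidable P] : Nat.card {q : Prop // q → P} = 2 ^ (if P then 1 else 0) := by
  by_cases hP : P
  · rw [Nat.card_congr (Equiv.subtypeUnivEquiv fun _ _ => hP)]
    simp [hP]
  · have : Unique {q : Prop // q → P} :=
      ⟨⟨⟨False, False.elim⟩⟩, fun q => Subtype.ext (propext ⟨fun h => hP (q.2 h), False.elim⟩)⟩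
    rw [Nat.card_unique, if_neg hP, pow_zero]

/-- A circle carrying the pigment is a component by itself, to be included or not independently of
the rest, which doubles the count; a circle without it changes nothing. -/
theorem Tangle.subCount_glue_circle (K : Tangle noPoints noPoints) (A : K.Edge → Prop) (w : ℕ)
    (P : Prop) [Decidable P] : (K.glue (circle w)).subCount (Sum.elim A fun _ => P) =
      (K.glue nothing).subCount (Sum.elim A fun _ => P) * 2 ^ (if P then 1 else 0) := by
  let f : (K.Edge ⊕ Unit → Prop) → K.Edge ⊕ Empty → Prop := fun B =>
    Sum.elim (fun e => B (.inl e)) fun _ => P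
  let g : (K.Edge ⊕ Empty → Prop) → Prop → K.Edge ⊕ Unit → Prop := fun B q =>
    Sum.elim (fun e => B (.inl e)) fun _ => q
  have hf : ∀ B, (K.glue (circle w)).IsSub (Sum.elim A fun _ => P) B →
      (K.glue nothing).IsSub (Sum.elim A fun _ => P) (f B) := fun B hB =>
    Tangle.IsSub.glue (T := nothing) hB.outside
      ⟨fun e => e.elim, fun e => e.elim, fun e => e.elim Empty.elim Empty.elim⟩
      (fun e => e.elim) fun e => e.elim
  have hg : ∀ B (q : Prop), (K.glue nothing).IsSub (Sum.elim A fun _ => P) B → (q → P) →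
      (K.glue (circle w)).IsSub (Sum.elim A fun _ => P) (g B q) := fun B q hB hq =>
    Tangle.IsSub.glue (T := circle w) hB.outside
      ⟨fun _ => hq, fun _ => Iff.rfl, fun e => e.elim Empty.elim Empty.elim⟩
      (fun e => e.elim) fun e => e.elim
  refine Eq.trans (Nat.card_congr (β := {B // (K.glue nothing).IsSub (Sum.elim A fun _ => P) B} ×
      {q : Prop // q → P}) ?_) ((Nat.card_prod _ _).trans (congrArg _ (natCard_imp P)))
  exact
    { toFun := fun B => (⟨f B.1, hf B.1 B.2⟩, ⟨B.1 (.inr ()), B.2.le (.inr ())⟩)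
      invFun := fun x => ⟨g x.1.1 x.2.1, hg _ _ x.1.2 x.2.2⟩
      left_inv := fun B => Subtype.ext (funext fun e => by rcases e with e | e <;> rfl)
      right_inv := fun x => Prod.ext
        (Subtype.ext (funext fun e => by rcases e with e | e; rfl; exact e.elim)) rfl }

end Glue

/-! ### Subwebs under traces of isotopies -/

theorem WebIso.symm_start {Γ Γ' : Web} (φ : WebIso Γ Γ') (x : Start Empty Γ.Mark Γ.Split Γ.Merge) :
    φ.edge.symm (Γ'.start.symm (x.map φ.mark φ.split φ.merge)) = Γ.start.symm x := by
  rw [Equiv.symm_apply_eq, Equiv.symm_apply_eq, φ.start_edge, Equiv.apply_symm_apply]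

theorem WebIso.symm_finish {Γ Γ' : Web} (φ : WebIso Γ Γ')
    (x : Finish Empty Γ.Mark Γ.Split Γ.Merge) :
    φ.edge.symm (Γ'.finish.symm (x.map φ.mark φ.split φ.merge)) = Γ.finish.symm x := by
  rw [Equiv.symm_apply_eq, Equiv.symm_apply_eq, φ.finish_edge, Equiv.apply_symm_apply]

theorem WebIso.symm_thickEdge {Γ Γ' : Web} (φ : WebIso Γ Γ') (v : Γ.Node) :
    φ.edge.symm (Γ'.thickEdge (Sum.map φ.split φ.merge v)) = Γ.thickEdge v := by
  rcases v with v | v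
  · exact φ.symm_finish (.split v)
  · exact φ.symm_start (.merge v)

theorem WebIso.symm_leftEdge {Γ Γ' : Web} (φ : WebIso Γ Γ') (v : Γ.Node) :
    φ.edge.symm (Γ'.leftEdge (Sum.map φ.split φ.merge v)) = Γ.leftEdge v := by
  rcases v with v | v
  · exact φ.symm_start (.splitLeft v)
  · exact φ.symm_finish (.mergeLeft v)

theorem WebIso.symm_rightEdge {Γ Γ' : Web} (φ : WebIso Γ Γ') (v : Γ.Node) :
    φ.edge.symm (Γ'.rightEdge (Sum.map φ.split φ.merge v)) = Γ.rightEdge v := by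
  rcases v with v | v
  · exact φ.symm_start (.splitRight v)
  · exact φ.symm_finish (.mergeRight v)

theorem WebIso.forall_mark {Γ Γ' : Web} (φ : WebIso Γ Γ') {p : Γ'.Edge → Γ'.Edge → Prop} :
    (∀ m, p (Γ'.start.symm (.mark m)) (Γ'.finish.symm (.mark m))) ↔
      ∀ m, p (φ.edge (Γ.start.symm (.mark m))) (φ.edge (Γ.finish.symm (.mark m))) := by
  rw [← φ.mark.forall_congr_right]
  refine forall_congr' fun m => ?_
  rw [← φ.symm_start (.mark m), ← φ.symm_finish (.mark m), Equiv.apply_symm_apply,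
    Equiv.apply_symm_apply]
  rfl

theorem WebIso.forall_node {Γ Γ' : Web} (φ : WebIso Γ Γ')
    {p : Γ'.Edge → Γ'.Edge → Γ'.Edge → Prop} :
    (∀ v, p (Γ'.thickEdge v) (Γ'.leftEdge v) (Γ'.rightEdge v)) ↔
      ∀ v, p (φ.edge (Γ.thickEdge v)) (φ.edge (Γ.leftEdge v)) (φ.edge (Γ.rightEdge v)) := by
  rw [← (Equiv.sumCongr φ.split φ.merge).forall_congr_right]
  refine forall_congr' fun v => ?_
  rw [← φ.symm_thickEdge, ← φ.symm_leftEdge, ← φ.symm_rightEdge, Equiv.apply_symm_apply,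
    Equiv.apply_symm_apply, Equiv.apply_symm_apply]
  rfl

theorem WebIso.isSub_iff {Γ Γ' : Web} (φ : WebIso Γ Γ') (A B : Γ'.Edge → Prop) :
    Γ'.IsSub A B ↔ Γ.IsSub (fun e => A (φ.edge e)) fun e => B (φ.edge e) :=
  ⟨fun h => ⟨fun _ => h.le _, (φ.forall_mark (p := fun x y => B x ↔ B y)).1 h.mark,
      (φ.forall_node (p := fun x y z => B x ↔ B y ∨ B z)).1 h.node⟩,
    fun h => ⟨φ.edge.forall_congr_right.1 h.le, (φ.forall_mark (p := fun x y => B x ↔ B y)).2 h.mark,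
      (φ.forall_node (p := fun x y z => B x ↔ B y ∨ B z)).2 h.node⟩⟩

theorem WebIso.subCount_eq {Γ Γ' : Web} (φ : WebIso Γ Γ') (A : Γ'.Edge → Prop) :
    Γ.subCount (fun e => A (φ.edge e)) = Γ'.subCount A :=
  Eq.symm <| Nat.card_congr <|
    (Equiv.arrowCongr φ.edge.symm (Equiv.refl Prop)).subtypeEquiv fun B => φ.isSub_iff A B

/-! ### Marked points added to an edge. -/

section Subdivide

variable (Γ : Web) (e : Γ.Edge)

theorem Tangle.subdivide_start_mark (m : Γ.Mark) :
    Option.getD ((Γ.subdivide e).start.symm (.mark (some m))) e = Γ.start.symm (.mark m) :=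
  rfl

/-- Unlike starts, finishes pass through the swap of the two halves of `e`; applying `getD e`
forgets which half is meant. -/
theorem Tangle.subdivide_finish_mark (m : Γ.Mark) :
    Option.getD ((Γ.subdivide e).finish.symm (.mark (some m))) e = Γ.finish.symm (.mark m) :=
  swap_getD e (some _)

theorem Tangle.subdivide_thickEdge (v : Γ.Node) :
    Option.getD ((Γ.subdivide e).thickEdge v) e = Γ.thickEdge v := by
  rcases v with v | v
  · exact swap_getD e (some _)
  · rfl

theorem Tangle.subdivide_leftEdge (v : Γ.Node) :
    Option.getD ((Γ.subdivide e).leftEdge v) e = Γ.leftEdge v := by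
  rcases v with v | v
  · rfl
  · exact swap_getD e (some _)

theorem Tangle.subdivide_rightEdge (v : Γ.Node) :
    Option.getD ((Γ.subdivide e).rightEdge v) e = Γ.rightEdge v := by
  rcases v with v | v
  · rfl
  · exact swap_getD e (some _)

theorem Tangle.isSub_subdivide (A B : Γ.Edge → Prop) :
    (Γ.subdivide e).IsSub (fun x => A (Option.getD x e)) (fun x => B (Option.getD x e)) ↔
      Γ.IsSub A B := by
  constructor
  · intro h
    refine ⟨fun x => h.le (some x), fun m => ?_, fun v => ?_⟩
    · have := h.mark (some m)
      rwa [Γ.subdivide_start_mark e, Γ.subdivide_finish_mark e] at this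
    · have := h.node v
      rwa [Γ.subdivide_thickEdge e, Γ.subdivide_leftEdge e, Γ.subdivide_rightEdge e] at this
  · intro h
    have hv (v : Γ.Node) : B (Option.getD ((Γ.subdivide e).thickEdge v) e) ↔
        B (Option.getD ((Γ.subdivide e).leftEdge v) e) ∨
          B (Option.getD ((Γ.subdivide e).rightEdge v) e) := by
      rw [Γ.subdivide_thickEdge e, Γ.subdivide_leftEdge e, Γ.subdivide_rightEdge e]
      exact h.node v
    refine ⟨fun x => h.le _, ?_, hv⟩
    rintro (_ | m)
    -- The new mark compares the two halves of `e`, which both project to `e`.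
    · exact iff_of_eq (congrArg B (swap_getD e none).symm)
    · rw [Γ.subdivide_start_mark e, Γ.subdivide_finish_mark e]
      exact h.mark m

theorem Tangle.subCount_subdivide (A : Γ.Edge → Prop) :
    (Γ.subdivide e).subCount (fun x => A (Option.getD x e)) = Γ.subCount A := by
  refine Eq.symm (Nat.card_eq_of_bijective (fun B : {B // Γ.IsSub A B} =>
    (⟨fun x => B.1 (Option.getD x e), (Γ.isSub_subdivide e A B.1).2 B.2⟩ :
      {B // (Γ.subdivide e).IsSub (fun x => A (Option.getD x e)) B})) ⟨?_, ?_⟩)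
  · intro B C h
    exact Subtype.ext (funext fun x => congrFun (congrArg Subtype.val h) (some x))
  · rintro ⟨B, hB⟩
    -- The condition at the new mark forces `B` to agree on the two halves, so `B` is pulled back
    -- from the original web. This gives surjectivity.
    have h : B = fun x => B (some (Option.getD x e)) := by
      funext x
      rcases x with _ | x
      · refine propext ((hB.mark none).trans (iff_of_eq (congrArg B ?_)))
        classical
        exact Equiv.swap_apply_right (some e) none
      · rfl
    refine ⟨⟨fun x => B (some x), (Γ.isSub_subdivide e _ _).1 ?_⟩, Subtype.ext h.symm⟩
    exact h ▸ hB

end Subdivide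

theorem Tangle.subCount_nothing (A : nothing.Edge → Prop) : nothing.subCount A = 1 := by
  have : Unique {B // nothing.IsSub A B} :=
    ⟨⟨⟨fun e => e.elim, ⟨fun e => e.elim, fun e => e.elim, fun e => e.elim Empty.elim Empty.elim⟩⟩⟩,
      fun B => Subtype.ext (funext fun e => e.elim)⟩
  exact Nat.card_unique

end Sub

/-! ### Colored slices and Euler characteristics of the basic foams. -/

section Models

variable {N : ℕ}

/-! ### Colored webs at the bottom and the top of colored foams -/

/-- The arc ending at the vertex has these three faces. The flow condition on faces thus restricts
to a flow condition on the bottom web. -/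
theorem Model.exists_binding_bot (m : Model) (v : m.piece.bot.Node) :
    ∃ x, m.piece.thick x = m.piece.lower (m.piece.bot.thickEdge v) ∧
      m.piece.left x = m.piece.lower (m.piece.bot.leftEdge v) ∧
      m.piece.right x = m.piece.lower (m.piece.bot.rightEdge v) := by
  cases m with
  | assocSplit a b c =>
    rcases v with (_ | _) | v
    · exact ⟨TBinding.ab_c, rfl, rfl, rfl⟩
    · exact ⟨TBinding.a_b, rfl, rfl, rfl⟩
    · exact v.elim
  | coassocSplit a b c =>
    rcases v with (_ | _) | v
    · exact ⟨TBinding.a_bc, rfl, rfl, rfl⟩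
    · exact ⟨TBinding.b_c, rfl, rfl, rfl⟩
    · exact v.elim
  | assocMerge a b c =>
    rcases v with v | (_ | _)
    · exact v.elim
    · exact ⟨TBinding.ab_c, rfl, rfl, rfl⟩
    · exact ⟨TBinding.a_b, rfl, rfl, rfl⟩
  | coassocMerge a b c =>
    rcases v with v | (_ | _)
    · exact v.elim
    · exact ⟨TBinding.a_bc, rfl, rfl, rfl⟩
    · exact ⟨TBinding.b_c, rfl, rfl, rfl⟩
  | digonCap a b => rcases v with v | v <;> exact ⟨(), rfl, rfl, rfl⟩
  | unzip a b => rcases v with v | v <;> exact ⟨(), rfl, rfl, rfl⟩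
  | _ => rcases v with v | v <;> exact v.elim

/-- Mirror images exchange bottom and top by definition, and the list of models is closed under them
except for the saddle, whose webs have no trivalent vertex. -/
theorem Model.exists_binding_top (m : Model) (v : m.piece.top.Node) :
    ∃ x, m.piece.thick x = m.piece.upper (m.piece.top.thickEdge v) ∧
      m.piece.left x = m.piece.upper (m.piece.top.leftEdge v) ∧
      m.piece.right x = m.piece.upper (m.piece.top.rightEdge v) := by
  cases m with
  | assocSplit a b c => exact Model.exists_binding_bot (.coassocSplit a b c) v
  | coassocSplit a b c => exact Model.exists_binding_bot (.assocSplit a b c) v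
  | assocMerge a b c => exact Model.exists_binding_bot (.coassocMerge a b c) v
  | coassocMerge a b c => exact Model.exists_binding_bot (.assocMerge a b c) v
  | digonCup a b => exact Model.exists_binding_bot (.digonCap a b) v
  | digonCap a b => exact Model.exists_binding_bot (.digonCup a b) v
  | zip a b => exact Model.exists_binding_bot (.unzip a b) v
  | unzip a b => exact Model.exists_binding_bot (.zip a b) v
  | cup a => exact Model.exists_binding_bot (.cap a) v
  | cap a => exact Model.exists_binding_bot (.cup a) v
  | saddle a => rcases v with v | v <;> exact v.elim

theorem Model.lower_mark (m : Model) (x : m.piece.bot.Mark) :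
    m.piece.lower (m.piece.bot.start.symm (.mark x)) =
      m.piece.lower (m.piece.bot.finish.symm (.mark x)) := by
  cases m with
  | cap a => rfl
  | _ => exact x.elim

theorem Model.upper_mark (m : Model) (x : m.piece.top.Mark) :
    m.piece.upper (m.piece.top.start.symm (.mark x)) =
      m.piece.upper (m.piece.top.finish.symm (.mark x)) := by
  cases m with
  | cup a => rfl
  | _ => exact x.elim

theorem Model.isColoring_bot {m : Model} {col : m.piece.Face → Finset (Fin N)}
    (h : m.piece.IsColoring col) : m.piece.bot.IsColoring fun e => col (m.piece.lower e) where
  color_mark x := by rw [m.lower_mark]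
  color_node v := by
    obtain ⟨x, h1, h2, h3⟩ := m.exists_binding_bot v
    rw [← h1, ← h2, ← h3, h.color_binding]
  disjoint v := by
    obtain ⟨x, h1, h2, h3⟩ := m.exists_binding_bot v
    rw [← h2, ← h3]
    exact h.disjoint x

theorem Model.isColoring_top {m : Model} {col : m.piece.Face → Finset (Fin N)}
    (h : m.piece.IsColoring col) : m.piece.top.IsColoring fun e => col (m.piece.upper e) where
  color_mark x := by rw [m.upper_mark]
  color_node v := by
    obtain ⟨x, h1, h2, h3⟩ := m.exists_binding_top v
    rw [← h1, ← h2, ← h3, h.color_binding]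
  disjoint v := by
    obtain ⟨x, h1, h2, h3⟩ := m.exists_binding_top v
    rw [← h2, ← h3]
    exact h.disjoint x

theorem Tangle.IsColoring.glue {In Out : Type} [Fintype In] [Fintype Out] {wIn : In → ℕ}
    {wOut : Out → ℕ} {K : Tangle wOut wIn} {T : Tangle wIn wOut}
    {col : K.Edge ⊕ T.Edge → Finset (Fin N)} (hK : K.IsColoring fun e => col (.inl e))
    (hT : T.IsColoring fun e => col (.inr e))
    (hin : ∀ p, col (.inr (T.start.symm (.boundary p))) = col (.inl (K.finish.symm (.boundary p))))
    (hout : ∀ p,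
      col (.inl (K.start.symm (.boundary p))) = col (.inr (T.finish.symm (.boundary p)))) :
    (K.glue T).IsColoring col where
  color_mark := by
    rintro ((m | m) | (p | p))
    · exact hK.color_mark m
    · exact hT.color_mark m
    · exact hin p
    · exact hout p
  color_node := by
    rintro ((v | v) | (v | v))
    · exact hK.color_node (.inl v)
    · exact hT.color_node (.inl v)
    · exact hK.color_node (.inr v)
    · exact hT.color_node (.inr v)
  disjoint := by
    rintro ((v | v) | (v | v))
    · exact hK.disjoint (.inl v)
    · exact hT.disjoint (.inl v)
    · exact hK.disjoint (.inr v)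
    · exact hT.disjoint (.inr v)

theorem Coloring.isColoring_outside {L : LocalModel} {K : Tangle L.wOut L.wIn}
    (c : Coloring (FoamComplex.basic L K) N) : K.IsColoring fun e => c.color (.inl e) where
  color_mark m := c.color_seam (.inl m)
  color_node v := c.color_binding (.inl v)
  disjoint v := c.disjoint (.inl v)

theorem WebIso.isColoring {Γ Γ' : Web} (φ : WebIso Γ Γ') {col : Γ.Edge → Finset (Fin N)}
    (h : Γ.IsColoring col) : Γ'.IsColoring fun e => col (φ.edge.symm e) where
  color_mark := by
    refine (φ.forall_mark (p := fun x y => col (φ.edge.symm x) = col (φ.edge.symm y))).2 fun m => ?_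
    simpa using h.color_mark m
  color_node := by
    refine (φ.forall_node (p := fun x y z => col (φ.edge.symm x) =
      col (φ.edge.symm y) ∪ col (φ.edge.symm z))).2 fun v => ?_
    simpa using h.color_node v
  disjoint := by
    refine (φ.forall_node (p := fun _ y z => Disjoint
      (col (φ.edge.symm y)) (col (φ.edge.symm z)))).2 fun v => ?_
    simpa using h.disjoint v

theorem Tangle.IsColoring.subdivide {Γ : Web} {col : Γ.Edge → Finset (Fin N)}
    (h : Γ.IsColoring col) (e : Γ.Edge) :
    (Γ.subdivide e).IsColoring fun x => col (Option.getD x e) where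
  color_mark := by
    rintro (_ | m)
    · exact congrArg col (swap_getD e none).symm
    · rw [Γ.subdivide_start_mark e, Γ.subdivide_finish_mark e]
      exact h.color_mark m
  color_node := by
    have hv (v : Γ.Node) : col (Option.getD ((Γ.subdivide e).thickEdge v) e) =
        col (Option.getD ((Γ.subdivide e).leftEdge v) e) ∪
          col (Option.getD ((Γ.subdivide e).rightEdge v) e) := by
      rw [Γ.subdivide_thickEdge e, Γ.subdivide_leftEdge e, Γ.subdivide_rightEdge e]
      exact h.color_node v
    exact hv
  disjoint := by
    have hv (v : Γ.Node) : Disjoint (col (Option.getD ((Γ.subdivide e).leftEdge v) e))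
          (col (Option.getD ((Γ.subdivide e).rightEdge v) e)) := by
      rw [Γ.subdivide_leftEdge e, Γ.subdivide_rightEdge e]
      exact h.disjoint v
    exact hv

theorem Coloring.isColoring_cylinder {Γ Γ' : Web} {φ : WebIso Γ Γ'}
    (c : Coloring (FoamComplex.cylinder φ) N) : Γ.IsColoring c.color where
  color_mark := c.color_seam
  color_node := c.color_binding
  disjoint := c.disjoint

theorem Coloring.isColoring_subdivide {Γ : Web} {e : Γ.Edge}
    (c : Coloring (FoamComplex.subdivide Γ e) N) : Γ.IsColoring c.color where
  color_mark := c.color_seam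
  color_node := c.color_binding
  disjoint := c.disjoint

/-- The mirror image of a coloring. -/
def Coloring.flip {Γ Γ' : Web} {F : FoamComplex Γ Γ'} (c : Coloring F.flip N) : Coloring F N where
  color := c.color
  card_color := c.card_color
  color_seam := c.color_seam
  color_binding := c.color_binding

/-- Provides the condition on intermediate slices under which Euler characteristics are additive. -/
theorem GoodFoam.isColoring_upper {Γ Γ' : Web} (F : GoodFoam Γ Γ') (c : Coloring F.complex N) :
    Γ'.IsColoring fun e => c.color (F.complex.upper e) := by
  induction F with
  | isotopy φ => exact φ.isColoring (Coloring.isColoring_cylinder c)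
  | subdivide Γ e => exact (Coloring.isColoring_subdivide c).subdivide e
  | unsubdivide Γ e => exact Coloring.isColoring_subdivide (Coloring.flip c)
  | basic m K =>
    refine Tangle.IsColoring.glue (col := fun e => Coloring.color c (Sum.map id m.piece.upper e))
      (Coloring.isColoring_outside c) (Model.isColoring_top (Coloring.isColoring c))
      (fun p => ?_) fun p => ?_
    · exact (congrArg (fun f => Coloring.color c (.inr f)) (m.piece.wall_in p).symm).trans
        (c.color_seam (.inr (.inl p)))
    · exact (c.color_seam (.inr (.inr p))).trans
        (congrArg (fun f => Coloring.color c (.inr f)) (m.piece.wall_out p))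
  | comp F G ihF ihG => exact ihG (Coloring.snd c)

/-! ### Contributions of basic foams to Euler characteristics -/

/-- The contribution of a basic foam to the Euler characteristic of a bichrome surface. -/
def eulerWeight (i j : Fin N) : Piece N → ℤ
  | ⟨.digonCup _ _, c⟩ | ⟨.digonCap _ _, c⟩ =>
      ind (i ∈ c YFace.left ∧ j ∈ c YFace.right) + ind (j ∈ c YFace.left ∧ i ∈ c YFace.right)
  | ⟨.zip _ _, c⟩ | ⟨.unzip _ _, c⟩ =>
      -(ind (i ∈ c YFace.left ∧ j ∈ c YFace.right) + ind (j ∈ c YFace.left ∧ i ∈ c YFace.right))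
  | ⟨.cup _, c⟩ | ⟨.cap _, c⟩ => ind (Xor (i ∈ c ()) (j ∈ c ()))
  | _ => 0

/-- The boundary correction concerns the wall, whose faces can be read at the bottom or at the top.
-/
theorem LocalModel.eulerDouble_flip (L : LocalModel) (A : L.Face → Prop) :
    L.flip.eulerDouble A = L.eulerDouble A := by
  have h1 : ∑ p, ind (A (L.lower (L.bot.start.symm (.boundary p)))) =
      ∑ p, ind (A (L.upper (L.top.start.symm (.boundary p)))) :=
    Finset.sum_congr rfl fun p _ => by rw [L.wall_in]
  have h2 : ∑ p, ind (A (L.lower (L.bot.finish.symm (.boundary p)))) =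
      ∑ p, ind (A (L.upper (L.top.finish.symm (.boundary p)))) :=
    Finset.sum_congr rfl fun p _ => by rw [L.wall_out]
  refine Eq.symm ((congrArg₂ _ (congrArg₂ _ rfl h1) h2).trans ?_)
  rfl

theorem LocalModel.eulerDouble_cup (a : ℕ) (A : Unit → Prop) :
    (LocalModel.cup a).eulerDouble A = 2 * ind (A ()) := by
  change 2 * (∑ f : Unit, ind (A f) - ∑ x : Empty, _ + ∑ p : Empty, _) - ∑ p : Empty, _ -
    ∑ p : Empty, _ = _
  simp

theorem LocalModel.eulerDouble_digonCup (a b : ℕ) (A : YFace → Prop) :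
    (LocalModel.digonCup a b).eulerDouble A = 2 * (ind (A .thick) + ind (A .left) + ind (A .right)
      - ind (A .thick ∨ A .left ∨ A .right)) - ind (A .thick) - ind (A .thick) := by
  change 2 * (∑ f : YFace, ind (A f) - ∑ x : Unit, ind (A .thick ∨ A .left ∨ A .right) +
    ∑ p : Empty, _) - ∑ p : Unit, ind (A .thick) - ∑ p : Unit, ind (A .thick) = _
  simp [YFace.sum_univ]

theorem LocalModel.eulerDouble_zip (a b : ℕ) (A : YFace → Prop) :
    (LocalModel.zip a b).eulerDouble A = 2 * (ind (A .thick) + ind (A .left) + ind (A .right)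
      - ind (A .thick ∨ A .left ∨ A .right)) - (ind (A .left) + ind (A .right)) -
        (ind (A .left) + ind (A .right)) := by
  have h (g : Side → ℤ) := Side.sum_univ g
  change 2 * (∑ f : YFace, ind (A f) - ∑ x : Unit, ind (A .thick ∨ A .left ∨ A .right) +
    ∑ p : Empty, _) - ∑ p : Side, _ - ∑ p : Side, _ = _
  rw [h, h]
  simp [YFace.sum_univ]
  rfl

/-- The Euler characteristic of a neighborhood of a singular vertex. -/
theorem LocalModel.eulerDouble_assocSplit (a b c : ℕ) (A : TFace → Prop) :
    (LocalModel.assocSplit a b c).eulerDouble A =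
      2 * ((ind (A .abc) + (ind (A .ab) + (ind (A .bc) + (ind (A .a) + (ind (A .b) + ind (A .c)))))) -
        (ind (A .abc ∨ A .ab ∨ A .c) + (ind (A .ab ∨ A .a ∨ A .b) + (ind (A .abc ∨ A .a ∨ A .bc) +
          ind (A .bc ∨ A .b ∨ A .c)))) + ind (∃ f, A f)) - ind (A .abc) -
        (ind (A .a) + ind (A .b) + ind (A .c)) := by
  change 2 * (∑ f : TFace, ind (A f) - ∑ x : TBinding, ind (A x.thick ∨ A x.left ∨ A x.right) +
    ∑ p : Unit, ind (∃ f ∈ Set.univ, A f)) - ∑ p : Unit, ind (A .abc) - ∑ p : Leg, ind (A p.face) = _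
  rw [TFace.sum_univ, TBinding.sum_univ, Leg.sum_univ]
  simp [TBinding.thick, TBinding.left, TBinding.right, Leg.face]

theorem LocalModel.eulerDouble_assocMerge (a b c : ℕ) (A : TFace → Prop) :
    (LocalModel.assocMerge a b c).eulerDouble A = (LocalModel.assocSplit a b c).eulerDouble A := by
  rw [LocalModel.eulerDouble_assocSplit]
  change 2 * (∑ f : TFace, ind (A f) - ∑ x : TBinding, ind (A x.thick ∨ A x.left ∨ A x.right) +
    ∑ p : Unit, ind (∃ f ∈ Set.univ, A f)) - ∑ p : Leg, ind (A p.face) - ∑ p : Unit, ind (A .abc) = _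
  rw [TFace.sum_univ, TBinding.sum_univ, Leg.sum_univ]
  simp [TBinding.thick, TBinding.left, TBinding.right, Leg.face]
  ring

/-- If the binding separates `i` from `j`, the two thin faces form a disk bounded by the new digon,
contributing `1`. In all other cases the surface is empty or a strip, contributing `0`. -/
theorem LocalModel.eulerDouble_digonCup_xor {a b : ℕ} {col : YFace → Finset (Fin N)}
    (h : (LocalModel.digonCup a b).IsColoring col) {i j : Fin N} :
    (LocalModel.digonCup a b).eulerDouble (fun f => Xor (i ∈ col f) (j ∈ col f)) =
      2 * (ind (i ∈ col YFace.left ∧ j ∈ col YFace.right) +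
        ind (j ∈ col YFace.left ∧ i ∈ col YFace.right)) := by
  have h1 : col .thick = col .left ∪ col .right := h.color_binding ()
  have h2 : Disjoint (col .left) (col .right) := h.disjoint ()
  have hi : i ∈ col .left → i ∉ col .right := fun h h' => Finset.disjoint_left.1 h2 h h'
  have hj : j ∈ col .left → j ∉ col .right := fun h h' => Finset.disjoint_left.1 h2 h h'
  refine (LocalModel.eulerDouble_digonCup a b fun f => Xor (i ∈ col f) (j ∈ col f)).trans ?_
  simp only [h1, Finset.mem_union]
  by_cases i ∈ col .left <;> by_cases j ∈ col .left <;> by_cases i ∈ col .right <;>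
    by_cases j ∈ col .right <;> simp_all [ind, Xor]

/-- If the binding separates `i` from `j`, the bichrome surface passes through a saddle,
contributing `-1`; otherwise it is empty or a strip. -/
theorem LocalModel.eulerDouble_zip_xor {a b : ℕ} {col : YFace → Finset (Fin N)}
    (h : (LocalModel.zip a b).IsColoring col) {i j : Fin N} :
    (LocalModel.zip a b).eulerDouble (fun f => Xor (i ∈ col f) (j ∈ col f)) =
      2 * -(ind (i ∈ col YFace.left ∧ j ∈ col YFace.right) +
        ind (j ∈ col YFace.left ∧ i ∈ col YFace.right)) := by
  have h1 : col .thick = col .left ∪ col .right := h.color_binding ()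
  have h2 : Disjoint (col .left) (col .right) := h.disjoint ()
  have hi : i ∈ col .left → i ∉ col .right := fun h h' => Finset.disjoint_left.1 h2 h h'
  have hj : j ∈ col .left → j ∉ col .right := fun h h' => Finset.disjoint_left.1 h2 h h'
  refine (LocalModel.eulerDouble_zip a b fun f => Xor (i ∈ col f) (j ∈ col f)).trans ?_
  simp only [h1, Finset.mem_union]
  by_cases i ∈ col .left <;> by_cases j ∈ col .left <;> by_cases i ∈ col .right <;>
    by_cases j ∈ col .right <;> simp_all [ind, Xor]

theorem TFace.exists_iff {p : TFace → Prop} :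
    (∃ f, p f) ↔ p .abc ∨ p .ab ∨ p .bc ∨ p .a ∨ p .b ∨ p .c :=
  ⟨fun ⟨f, hf⟩ => by cases f <;> simp [hf], by rintro (h | h | h | h | h | h) <;> exact ⟨_, h⟩⟩

/-- A pigment occurs in at most one of the three legs, and its leg determines all faces that contain
it. -/
theorem mem_of_tree {col : TFace → Finset (Fin N)}
    (h : ∀ x : TBinding, col x.thick = col x.left ∪ col x.right)
    (hd : ∀ x : TBinding, Disjoint (col x.left) (col x.right)) (i : Fin N) :
    (i ∈ col .ab ↔ i ∈ col .a ∨ i ∈ col .b) ∧ (i ∈ col .bc ↔ i ∈ col .b ∨ i ∈ col .c) ∧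
      (i ∈ col .abc ↔ i ∈ col .a ∨ i ∈ col .b ∨ i ∈ col .c) ∧
      ((i ∉ col .a ∧ i ∉ col .b ∧ i ∉ col .c) ∨ (i ∈ col .a ∧ i ∉ col .b ∧ i ∉ col .c) ∨
        (i ∉ col .a ∧ i ∈ col .b ∧ i ∉ col .c) ∨ (i ∉ col .a ∧ i ∉ col .b ∧ i ∈ col .c)) := by
  have h1 : col .abc = col .ab ∪ col .c := h .ab_c
  have h2 : col .ab = col .a ∪ col .b := h .a_b
  have h3 : col .bc = col .b ∪ col .c := h .b_c
  have h4 : i ∈ col .a → i ∉ col .b := fun hx => Finset.disjoint_left.1 (hd .a_b) hx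
  have h5 : i ∈ col .a → i ∉ col .bc := fun hx => Finset.disjoint_left.1 (hd .a_bc) hx
  have h6 : i ∈ col .b → i ∉ col .c := fun hx => Finset.disjoint_left.1 (hd .b_c) hx
  rw [h3] at h5
  rw [h1, h2, h3]
  simp only [Finset.mem_union] at h5 ⊢
  tauto

/-- Each of `i`, `j` has four possible positions by `mem_of_tree`. In each of the sixteen cases the
surface is empty or a strip between bottom and top. -/
theorem LocalModel.eulerDouble_assocSplit_xor (a b c : ℕ) {col : TFace → Finset (Fin N)}
    (h : ∀ x : TBinding, col x.thick = col x.left ∪ col x.right)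
    (hd : ∀ x : TBinding, Disjoint (col x.left) (col x.right)) {i j : Fin N} :
    (LocalModel.assocSplit a b c).eulerDouble (fun f => Xor (i ∈ col f) (j ∈ col f)) = 0 := by
  obtain ⟨h1, h2, h3, h4⟩ := mem_of_tree h hd i
  obtain ⟨h1', h2', h3', h4'⟩ := mem_of_tree h hd j
  refine (LocalModel.eulerDouble_assocSplit a b c fun f => Xor (i ∈ col f) (j ∈ col f)).trans ?_
  simp only [TFace.exists_iff, h1, h2, h3, h1', h2', h3']
  rcases h4 with h4 | h4 | h4 | h4 <;> rcases h4' with h4' | h4' | h4' | h4' <;>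
    simp [h4, h4', ind, Xor]

theorem LocalModel.IsColoring.of_flip {L : LocalModel} {col : L.Face → Finset (Fin N)}
    (h : L.flip.IsColoring col) : L.IsColoring col :=
  ⟨h.card_color, h.color_binding⟩

theorem Model.eulerDouble_eq {m : Model} (hm : ∀ a, m ≠ .saddle a)
    {col : m.piece.Face → Finset (Fin N)} (h : m.piece.IsColoring col) (i j : Fin N) :
    m.piece.eulerDouble (fun f => Xor (i ∈ col f) (j ∈ col f)) = 2 * eulerWeight i j ⟨m, col⟩ := by
  cases m with
  | assocSplit a b c => exact LocalModel.eulerDouble_assocSplit_xor a b c h.color_binding h.disjoint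
  | coassocSplit a b c =>
    exact (LocalModel.eulerDouble_flip _ _).trans
      (LocalModel.eulerDouble_assocSplit_xor a b c h.color_binding h.disjoint)
  | assocMerge a b c =>
    exact (LocalModel.eulerDouble_assocMerge a b c _).trans
      (LocalModel.eulerDouble_assocSplit_xor a b c h.color_binding h.disjoint)
  | coassocMerge a b c =>
    exact (LocalModel.eulerDouble_flip _ _).trans ((LocalModel.eulerDouble_assocMerge a b c _).trans
      (LocalModel.eulerDouble_assocSplit_xor a b c h.color_binding h.disjoint))
  | digonCup a b => exact LocalModel.eulerDouble_digonCup_xor h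
  | digonCap a b =>
    exact (LocalModel.eulerDouble_flip _ _).trans
      (LocalModel.eulerDouble_digonCup_xor (LocalModel.IsColoring.of_flip h))
  | zip a b => exact LocalModel.eulerDouble_zip_xor h
  | unzip a b =>
    exact (LocalModel.eulerDouble_flip _ _).trans
      (LocalModel.eulerDouble_zip_xor (LocalModel.IsColoring.of_flip h))
  | cup a => exact LocalModel.eulerDouble_cup a _
  | cap a => exact (LocalModel.eulerDouble_flip _ _).trans (LocalModel.eulerDouble_cup a _)
  | saddle a => exact absurd rfl (hm a)

/-- A Morse-type count: Euler characteristics of bichrome surfaces add up along the movie, and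
traces of isotopies contribute nothing. -/
theorem GoodFoam.euler_eq {Γ Γ' : Web} (F : GoodFoam Γ Γ') (hF : F.IsSpherical)
    (c : Coloring F.complex N) (i j : Fin N) :
    c.bichromeEuler i j = ((F.pieces c.color).map (eulerWeight i j)).sum := by
  induction F with
  | isotopy φ =>
    exact FoamComplex.euler_cylinder φ ((Coloring.isColoring_cylinder c).isCycle i j)
  | subdivide Γ e =>
    exact FoamComplex.euler_subdivide e ((Coloring.isColoring_subdivide c).isCycle i j)
  | unsubdivide Γ e =>
    exact FoamComplex.euler_subdivide e
      ((Coloring.isColoring_subdivide (Coloring.flip c)).isCycle i j)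
  | basic m K =>
    have h1 := FoamComplex.two_mul_euler_basic
      (fun f => Xor (i ∈ Coloring.color c f) (j ∈ Coloring.color c f))
      (fun p => iff_of_eq (congrArg (fun S => Xor (i ∈ S) (j ∈ S)) (c.color_seam (.inr (.inl p)))))
      (fun p => iff_of_eq (congrArg (fun S => Xor (i ∈ S) (j ∈ S)) (c.color_seam (.inr (.inr p)))))
      ((Coloring.isColoring_outside c).isCycle i j)
    rw [Model.eulerDouble_eq hF (Coloring.isColoring c)] at h1
    exact (mul_left_cancel₀ two_ne_zero h1).trans (Multiset.sum_singleton _).symm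
  | comp F G ihF ihG =>
    refine (FoamComplex.euler_comp F.complex G.complex
      (fun f => Xor (i ∈ Coloring.color c f) (j ∈ Coloring.color c f)) (fun e => ?_) ?_).trans ?_
    · exact iff_of_eq (congrArg (fun S => Xor (i ∈ S) (j ∈ S)) (Coloring.fst_upper c e))
    · exact (F.isColoring_upper (Coloring.fst c)).isCycle i j
    · refine (congrArg₂ _ (ihF hF.1 (Coloring.fst c)) (ihG hF.2 (Coloring.snd c))).trans ?_
      rw [← Multiset.sum_add, ← Multiset.map_add]
      rfl

end Models

/-! ### Two quantities of colored webs which telescope along the movie. -/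

section Invariants

variable {N : ℕ}

/-! ### The invariant which counts split vertices -/

section Split

variable {M : Type*} [AddCommGroup M]

/-- The sum of a function of two pigments over the pairs of a pigment on the left and a pigment on
the right of a split vertex. -/
def Tangle.splitSum {In Out : Type} {wIn : In → ℕ} {wOut : Out → ℕ} (T : Tangle wIn wOut)
    (γ : Fin N → Fin N → M) (col : T.Edge → Finset (Fin N)) : M :=
  ∑ v, pairSum γ (col (T.start.symm (.splitLeft v))) (col (T.start.symm (.splitRight v)))

/-- The variation of `Tangle.splitSum` in a basic foam. -/
def splitWeight (γ : Fin N → Fin N → M) : Piece N → M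
  | ⟨.digonCup _ _, c⟩ | ⟨.zip _ _, c⟩ => pairSum γ (c YFace.left) (c YFace.right)
  | ⟨.digonCap _ _, c⟩ | ⟨.unzip _ _, c⟩ => -pairSum γ (c YFace.left) (c YFace.right)
  | _ => 0

theorem Tangle.splitSum_glue {In Out : Type} [Fintype In] [Fintype Out] {wIn : In → ℕ}
    {wOut : Out → ℕ} (K : Tangle wOut wIn) (T : Tangle wIn wOut) (γ : Fin N → Fin N → M)
    (col : K.Edge ⊕ T.Edge → Finset (Fin N)) :
    (K.glue T).splitSum γ col =
      K.splitSum γ (fun e => col (.inl e)) + T.splitSum γ fun e => col (.inr e) :=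
  sum_sum_of_eq (fun _ => rfl) fun _ => rfl

/-- Both bracketings enumerate the pairs from `a × b`, `a × c` and `b × c` once each, whence
invariance of the split sum under reassociation. -/
theorem pairSum_tree (γ : Fin N → Fin N → M) {col : TFace → Finset (Fin N)}
    (h : ∀ x : TBinding, col x.thick = col x.left ∪ col x.right)
    (hd : ∀ x : TBinding, Disjoint (col x.left) (col x.right)) :
    pairSum γ (col .a) (col .bc) + pairSum γ (col .b) (col .c) =
      pairSum γ (col .ab) (col .c) + pairSum γ (col .a) (col .b) := by
  have h1 : col .ab = col .a ∪ col .b := h .a_b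
  have h2 : col .bc = col .b ∪ col .c := h .b_c
  have hd1 : Disjoint (col .a) (col .b) := hd .a_b
  have hd2 : Disjoint (col .b) (col .c) := hd .b_c
  rw [h1, h2, pairSum_union_left _ _ hd1, pairSum_union_right _ _ hd2]
  abel

theorem digon_splitSum {a b : ℕ} (γ : Fin N → Fin N → M) (col : DigonEdge → Finset (Fin N)) :
    (digon a b).splitSum γ col = pairSum γ (col .left) (col .right) :=
  Fintype.sum_unique fun _ : Unit => pairSum γ (col .left) (col .right)

theorem dumbbell_splitSum {a b : ℕ} (γ : Fin N → Fin N → M)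
    (col : DumbbellEdge → Finset (Fin N)) :
    (dumbbell a b).splitSum γ col = pairSum γ (col .leftOut) (col .rightOut) :=
  Fintype.sum_unique fun _ : Unit => pairSum γ (col .leftOut) (col .rightOut)

theorem splitTreeLeft_splitSum {a b c : ℕ} (γ : Fin N → Fin N → M)
    (col : TreeEdge → Finset (Fin N)) :
    (splitTreeLeft a b c).splitSum γ col =
      pairSum γ (col .middle) (col (.leg .c)) + pairSum γ (col (.leg .a)) (col (.leg .b)) :=
  TreeNode.sum_univ _

theorem splitTreeRight_splitSum {a b c : ℕ} (γ : Fin N → Fin N → M)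
    (col : TreeEdge → Finset (Fin N)) :
    (splitTreeRight a b c).splitSum γ col =
      pairSum γ (col (.leg .a)) (col .middle) + pairSum γ (col (.leg .b)) (col (.leg .c)) :=
  TreeNode.sum_univ _

theorem Model.splitSum_top {m : Model} (hm : ∀ a, m ≠ .saddle a)
    {col : m.piece.Face → Finset (Fin N)} (h : m.piece.IsColoring col) (γ : Fin N → Fin N → M) :
    m.piece.top.splitSum γ (fun e => col (m.piece.upper e)) =
      m.piece.bot.splitSum γ (fun e => col (m.piece.lower e)) + splitWeight γ ⟨m, col⟩ := by
  cases m with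
  | assocSplit a b c =>
    exact (splitTreeRight_splitSum γ _).trans ((pairSum_tree γ h.color_binding h.disjoint).trans
      ((add_zero _).symm.trans (congrArg (· + 0) (splitTreeLeft_splitSum γ
        fun e => col ((LocalModel.assocSplit a b c).lower e)).symm)))
  | coassocSplit a b c =>
    exact (splitTreeLeft_splitSum γ _).trans
      ((pairSum_tree γ h.color_binding h.disjoint).symm.trans
        ((add_zero _).symm.trans (congrArg (· + 0) (splitTreeRight_splitSum γ
          fun e => col ((LocalModel.assocSplit a b c).upper e)).symm)))
  | assocMerge a b c => exact (add_zero (0 : M)).symm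
  | coassocMerge a b c => exact (add_zero (0 : M)).symm
  | digonCup a b => exact (digon_splitSum γ _).trans (zero_add _).symm
  | digonCap a b =>
    exact (add_neg_cancel _).symm.trans (congrArg (· + -_) (digon_splitSum γ
      fun e => col ((LocalModel.digonCup a b).upper e)).symm)
  | zip a b => exact (dumbbell_splitSum γ _).trans (zero_add _).symm
  | unzip a b =>
    exact (add_neg_cancel _).symm.trans (congrArg (· + -_) (dumbbell_splitSum γ
      fun e => col ((LocalModel.zip a b).upper e)).symm)
  | cup a => exact (add_zero (0 : M)).symm
  | cap a => exact (add_zero (0 : M)).symm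
  | saddle a => exact absurd rfl (hm a)

/-- Telescoping: the split sum is a function of the current slice, and each basic foam changes it by
its own weight. -/
theorem GoodFoam.splitSum_upper {Γ Γ' : Web} (F : GoodFoam Γ Γ') (hF : F.IsSpherical)
    (c : Coloring F.complex N) (γ : Fin N → Fin N → M) :
    Γ'.splitSum γ (fun e => c.color (F.complex.upper e)) =
      Γ.splitSum γ (fun e => c.color (F.complex.lower e)) +
        ((F.pieces c.color).map (splitWeight γ)).sum := by
  induction F with
  | @isotopy Γ Γ' φ =>
    refine Eq.trans ?_ (add_zero _).symm
    refine (φ.split.sum_comp _).symm.trans (Finset.sum_congr rfl fun v _ => ?_)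
    exact congrArg₂ (pairSum γ) (congrArg (Coloring.color c) (φ.symm_start (.splitLeft v)))
      (congrArg (Coloring.color c) (φ.symm_start (.splitRight v)))
  -- Subdivision swaps halves only in finishes, whereas the split sum reads starts; the two sums
  -- agree by definition.
  | subdivide Γ e => exact (add_zero _).symm
  | unsubdivide Γ e => exact (add_zero _).symm
  | basic m K =>
    refine (Tangle.splitSum_glue K m.piece.top γ
      fun e => Coloring.color c (Sum.map id m.piece.upper e)).trans ?_
    refine (congrArg (_ + ·) (Model.splitSum_top hF (Coloring.isColoring c) γ)).trans ?_
    refine (add_assoc _ _ _).symm.trans (congrArg₂ _ ?_ (Multiset.sum_singleton _).symm)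
    exact (Tangle.splitSum_glue K m.piece.bot γ
      fun e => Coloring.color c (Sum.map id m.piece.lower e)).symm
  | @comp Γ Γ' Γ'' F G ihF ihG =>
    have h : Γ'.splitSum γ (fun e => (Coloring.snd c).color (G.complex.lower e)) =
        Γ'.splitSum γ (fun e => (Coloring.fst c).color (F.complex.upper e)) :=
      congrArg (Γ'.splitSum γ) (funext fun e => (Coloring.fst_upper c e).symm)
    refine (ihG hF.2 (Coloring.snd c)).trans ?_
    rw [h, ihF hF.1 (Coloring.fst c), add_assoc, ← Multiset.sum_add, ← Multiset.map_add]
    rfl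

theorem GoodFoam.sum_splitWeight (F : GoodFoam nothing nothing) (hF : F.IsSpherical)
    (c : Coloring F.complex N) (γ : Fin N → Fin N → M) :
    ((F.pieces c.color).map (splitWeight γ)).sum = 0 := by
  have h : ∀ col : nothing.Edge → Finset (Fin N), nothing.splitSum γ col = 0 := fun col => rfl
  have := F.splitSum_upper hF c γ
  rwa [h, h, zero_add, eq_comm] at this

end Split

/-! ### The invariant which counts circles -/

section Circle

/-- The number of circles with the pigment `i` which are created in a basic foam. -/
def birthWeight (i : Fin N) : Piece N → ℕ
  | ⟨.cup _, c⟩ => if i ∈ c () then 1 else 0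
  | _ => 0

/-- The number of circles with the pigment `i` which are removed in a basic foam. -/
def deathWeight (i : Fin N) : Piece N → ℕ
  | ⟨.cap _, c⟩ => if i ∈ c () then 1 else 0
  | _ => 0

/-- The pigment runs along one side only, hence along a single path through the thick ends; whether
a union contains it is decided on the edge `before`. -/
theorem digon_isPreconnected {a b : ℕ} {A : DigonEdge → Prop} (hA : (digon a b).IsSub A A)
    (hd : ¬(A .left ∧ A .right)) : (digon a b).IsPreconnected A := by
  intro B hB
  have h1 : B .before ↔ B .left ∨ B .right := hB.node (.inl ())
  have h2 : B .after ↔ B .left ∨ B .right := hB.node (.inr ())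
  have h3 : A .before ↔ A .left ∨ A .right := hA.node (.inl ())
  have h4 : A .after ↔ A .left ∨ A .right := hA.node (.inr ())
  have h5 := hB.le .left
  have h6 := hB.le .right
  clear hA hB
  refine ⟨B .before, fun e => ?_⟩
  cases e <;> grind

theorem dumbbell_isPreconnected {a b : ℕ} {A : DumbbellEdge → Prop}
    (hA : (dumbbell a b).IsSub A A) (hl : A .leftIn ↔ A .leftOut) (hr : A .rightIn ↔ A .rightOut)
    (hd : ¬(A .leftIn ∧ A .rightIn)) : (dumbbell a b).IsPreconnected A := by
  intro B hB
  have h1 : B .thick ↔ B .leftOut ∨ B .rightOut := hB.node (.inl ())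
  have h2 : B .thick ↔ B .leftIn ∨ B .rightIn := hB.node (.inr ())
  have h3 : A .thick ↔ A .leftOut ∨ A .rightOut := hA.node (.inl ())
  have h5 := hB.le .leftIn
  have h6 := hB.le .rightIn
  have h7 := hB.le .leftOut
  have h8 := hB.le .rightOut
  clear hA hB
  refine ⟨B .thick, fun e => ?_⟩
  cases e <;> grind

/-- Common form of the four trees: trunk `x`, middle edge `y` with its legs `t`, `u`, and the
remaining leg `z`. Disjointness leaves a single path from the trunk to one leg. -/
theorem tree_isPreconnected {In Out : Type} {wIn : In → ℕ} {wOut : Out → ℕ} {T : Tangle wIn wOut}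
    {A : T.Edge → Prop} (x y z t u : T.Edge) (hT : ∀ e, e = x ∨ e = y ∨ e = z ∨ e = t ∨ e = u)
    (h : ∀ B, T.IsSub A B → (B x ↔ B y ∨ B z) ∧ (B y ↔ B t ∨ B u)) (hA : T.IsSub A A)
    (hd : ¬(A y ∧ A z)) (hd' : ¬(A t ∧ A u)) : T.IsPreconnected A := by
  intro B hB
  obtain ⟨h1, h2⟩ := h B hB
  obtain ⟨h3, h4⟩ := h A hA
  have hx := hB.le x
  have hy := hB.le y
  have hz := hB.le z
  have ht := hB.le t
  have hu := hB.le u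
  clear h hA hB
  refine ⟨B x, fun e => ?_⟩
  rcases hT e with rfl | rfl | rfl | rfl | rfl <;> grind

theorem TreeEdge.forall {p : TreeEdge → Prop} (h1 : p .trunk) (h2 : p .middle) (h3 : p (.leg .a))
    (h4 : p (.leg .b)) (h5 : p (.leg .c)) : ∀ e, p e := by
  rintro (_ | _ | (_ | _ | _)) <;> assumption

theorem splitTreeLeft_isPreconnected {a b c : ℕ} {A : TreeEdge → Prop}
    (hA : (splitTreeLeft a b c).IsSub A A) (hd : ¬(A .middle ∧ A (.leg .c)))
    (hd' : ¬(A (.leg .a) ∧ A (.leg .b))) : (splitTreeLeft a b c).IsPreconnected A :=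
  tree_isPreconnected (T := splitTreeLeft a b c) TreeEdge.trunk TreeEdge.middle (TreeEdge.leg .c)
    (TreeEdge.leg .a) (TreeEdge.leg .b)
    (TreeEdge.forall (.inl rfl) (.inr (.inl rfl)) (.inr (.inr (.inr (.inl rfl))))
      (.inr (.inr (.inr (.inr rfl)))) (.inr (.inr (.inl rfl))))
    (fun _ hB => ⟨hB.node (.inl .outer), hB.node (.inl .inner)⟩) hA hd hd'

theorem mergeTreeLeft_isPreconnected {a b c : ℕ} {A : TreeEdge → Prop}
    (hA : (mergeTreeLeft a b c).IsSub A A) (hd : ¬(A .middle ∧ A (.leg .c)))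
    (hd' : ¬(A (.leg .a) ∧ A (.leg .b))) : (mergeTreeLeft a b c).IsPreconnected A :=
  tree_isPreconnected (T := mergeTreeLeft a b c) TreeEdge.trunk TreeEdge.middle (TreeEdge.leg .c)
    (TreeEdge.leg .a) (TreeEdge.leg .b)
    (TreeEdge.forall (.inl rfl) (.inr (.inl rfl)) (.inr (.inr (.inr (.inl rfl))))
      (.inr (.inr (.inr (.inr rfl)))) (.inr (.inr (.inl rfl))))
    (fun _ hB => ⟨hB.node (.inr .outer), hB.node (.inr .inner)⟩) hA hd hd'

theorem splitTreeRight_isPreconnected {a b c : ℕ} {A : TreeEdge → Prop}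
    (hA : (splitTreeRight a b c).IsSub A A) (hd : ¬(A (.leg .a) ∧ A .middle))
    (hd' : ¬(A (.leg .b) ∧ A (.leg .c))) : (splitTreeRight a b c).IsPreconnected A :=
  tree_isPreconnected (T := splitTreeRight a b c) TreeEdge.trunk TreeEdge.middle (TreeEdge.leg .a)
    (TreeEdge.leg .b) (TreeEdge.leg .c)
    (TreeEdge.forall (.inl rfl) (.inr (.inl rfl)) (.inr (.inr (.inl rfl)))
      (.inr (.inr (.inr (.inl rfl)))) (.inr (.inr (.inr (.inr rfl)))))
    -- In this bracketing the middle edge is the right one, so the two thin edges are exchanged to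
    -- fit the common form.
    (fun _ hB => ⟨(hB.node (.inl .outer)).trans or_comm, hB.node (.inl .inner)⟩) hA
    (fun h => hd h.symm) hd'

theorem mergeTreeRight_isPreconnected {a b c : ℕ} {A : TreeEdge → Prop}
    (hA : (mergeTreeRight a b c).IsSub A A) (hd : ¬(A (.leg .a) ∧ A .middle))
    (hd' : ¬(A (.leg .b) ∧ A (.leg .c))) : (mergeTreeRight a b c).IsPreconnected A :=
  tree_isPreconnected (T := mergeTreeRight a b c) TreeEdge.trunk TreeEdge.middle (TreeEdge.leg .a)
    (TreeEdge.leg .b) (TreeEdge.leg .c)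
    (TreeEdge.forall (.inl rfl) (.inr (.inl rfl)) (.inr (.inr (.inl rfl)))
      (.inr (.inr (.inr (.inl rfl)))) (.inr (.inr (.inr (.inr rfl)))))
    (fun _ hB => ⟨(hB.node (.inr .outer)).trans or_comm, hB.node (.inr .inner)⟩) hA
    (fun h => hd h.symm) hd'

theorem strand_isPreconnected {a : ℕ} {A : Unit → Prop} : (strand a).IsPreconnected A :=
  fun B hB => ⟨B (), fun e => ⟨fun h => ⟨h, hB.le e h⟩, fun h => h.1⟩⟩

/-- A pigment occurs on at most one of the two strands of a zip. For a saddle both strands have the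
same color, and this connectedness fails. -/
theorem parallel_isPreconnected {a b : ℕ} {A : Side → Prop} (hd : ¬(A .left ∧ A .right)) :
    (parallel a b).IsPreconnected A := by
  intro B hB
  have h1 := hB.le .left
  have h2 := hB.le .right
  refine ⟨B .left ∨ B .right, fun e => ?_⟩
  cases e <;> tauto

/-- Basic foams other than cups, caps and saddles. -/
def Model.IsBinding : Model → Prop
  | .cup _ | .cap _ | .saddle _ => False
  | _ => True

theorem LocalModel.IsColoring.not_mem {L : LocalModel} {col : L.Face → Finset (Fin N)}
    (h : L.IsColoring col) (i : Fin N) (x : L.Binding) :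
    ¬(i ∈ col (L.left x) ∧ i ∈ col (L.right x)) :=
  fun hx => Finset.disjoint_left.1 (h.disjoint x) hx.1 hx.2

theorem Model.isPreconnected_bot {m : Model} (hm : m.IsBinding)
    {col : m.piece.Face → Finset (Fin N)} (h : m.piece.IsColoring col) (i : Fin N) :
    m.piece.bot.IsPreconnected fun e => i ∈ col (m.piece.lower e) := by
  have hA := (Model.isColoring_bot h).isSub i
  cases m with
  | assocSplit a b c =>
    exact splitTreeLeft_isPreconnected hA (h.not_mem i TBinding.ab_c) (h.not_mem i TBinding.a_b)
  | coassocSplit a b c =>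
    exact splitTreeRight_isPreconnected hA (h.not_mem i TBinding.a_bc) (h.not_mem i TBinding.b_c)
  | assocMerge a b c =>
    exact mergeTreeLeft_isPreconnected hA (h.not_mem i TBinding.ab_c) (h.not_mem i TBinding.a_b)
  | coassocMerge a b c =>
    exact mergeTreeRight_isPreconnected hA (h.not_mem i TBinding.a_bc) (h.not_mem i TBinding.b_c)
  | digonCup a b => exact strand_isPreconnected
  | digonCap a b => exact digon_isPreconnected hA (h.not_mem i ())
  | zip a b => exact parallel_isPreconnected (h.not_mem i ())
  | unzip a b => exact dumbbell_isPreconnected hA Iff.rfl Iff.rfl (h.not_mem i ())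
  | _ => exact hm.elim

theorem Model.isPreconnected_top {m : Model} (hm : m.IsBinding)
    {col : m.piece.Face → Finset (Fin N)} (h : m.piece.IsColoring col) (i : Fin N) :
    m.piece.top.IsPreconnected fun e => i ∈ col (m.piece.upper e) := by
  have hA := (Model.isColoring_top h).isSub i
  cases m with
  | assocSplit a b c =>
    exact splitTreeRight_isPreconnected hA (h.not_mem i TBinding.a_bc) (h.not_mem i TBinding.b_c)
  | coassocSplit a b c =>
    exact splitTreeLeft_isPreconnected hA (h.not_mem i TBinding.ab_c) (h.not_mem i TBinding.a_b)
  | assocMerge a b c =>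
    exact mergeTreeRight_isPreconnected hA (h.not_mem i TBinding.a_bc) (h.not_mem i TBinding.b_c)
  | coassocMerge a b c =>
    exact mergeTreeLeft_isPreconnected hA (h.not_mem i TBinding.ab_c) (h.not_mem i TBinding.a_b)
  | digonCup a b => exact digon_isPreconnected hA (h.not_mem i ())
  | digonCap a b => exact strand_isPreconnected
  | zip a b => exact dumbbell_isPreconnected hA Iff.rfl Iff.rfl (h.not_mem i ())
  | unzip a b => exact parallel_isPreconnected (h.not_mem i ())
  | _ => exact hm.elim

theorem mem_trunk {col : TFace → Finset (Fin N)}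
    (h : ∀ x : TBinding, col x.thick = col x.left ∪ col x.right)
    (hd : ∀ x : TBinding, Disjoint (col x.left) (col x.right)) {i : Fin N} {f : TFace}
    (hf : i ∈ col f) : i ∈ col .abc := by
  obtain ⟨h1, h2, h3, -⟩ := mem_of_tree h hd i
  rw [h3]
  cases f with
  | abc => exact h3.1 hf
  | ab => exact (h1.1 hf).imp_right .inl
  | bc => exact .inr (h2.1 hf)
  | a => exact .inl hf
  | b => exact .inr (.inl hf)
  | c => exact .inr (.inr hf)

theorem mem_thick {col : YFace → Finset (Fin N)} (h : col .thick = col .left ∪ col .right)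
    {i : Fin N} {f : YFace} (hf : i ∈ col f) : i ∈ col .thick := by
  cases f with
  | thick => exact hf
  | left => rw [h]; exact Finset.mem_union_left _ hf
  | right => rw [h]; exact Finset.mem_union_right _ hf

/-- Every nonempty monochrome part of such a basic foam meets the bottom. -/
theorem Model.exists_lower {m : Model} (hm : m.IsBinding)
    {col : m.piece.Face → Finset (Fin N)} (h : m.piece.IsColoring col) {i : Fin N}
    {f : m.piece.Face} (hf : i ∈ col f) : ∃ e, i ∈ col (m.piece.lower e) := by
  cases m with
  | assocSplit a b c => exact ⟨TreeEdge.trunk, mem_trunk h.color_binding h.disjoint hf⟩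
  | coassocSplit a b c => exact ⟨TreeEdge.trunk, mem_trunk h.color_binding h.disjoint hf⟩
  | assocMerge a b c => exact ⟨TreeEdge.trunk, mem_trunk h.color_binding h.disjoint hf⟩
  | coassocMerge a b c => exact ⟨TreeEdge.trunk, mem_trunk h.color_binding h.disjoint hf⟩
  | digonCup a b => exact ⟨(), mem_thick (h.color_binding ()) hf⟩
  | digonCap a b => exact ⟨DigonEdge.before, mem_thick (h.color_binding ()) hf⟩
  | zip a b =>
    rcases Finset.mem_union.1 ((h.color_binding ()) ▸ mem_thick (h.color_binding ()) hf) with h' | h'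
    · exact ⟨Side.left, h'⟩
    · exact ⟨Side.right, h'⟩
  | unzip a b => exact ⟨DumbbellEdge.thick, mem_thick (h.color_binding ()) hf⟩
  | _ => exact hm.elim

/-- Every nonempty monochrome part of such a basic foam meets the top. -/
theorem Model.exists_upper {m : Model} (hm : m.IsBinding)
    {col : m.piece.Face → Finset (Fin N)} (h : m.piece.IsColoring col) {i : Fin N}
    {f : m.piece.Face} (hf : i ∈ col f) : ∃ e, i ∈ col (m.piece.upper e) := by
  cases m with
  | assocSplit a b c =>
    exact Model.exists_lower (m := .coassocSplit a b c) trivial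
      ⟨h.card_color, h.color_binding⟩ hf
  | coassocSplit a b c =>
    exact Model.exists_lower (m := .assocSplit a b c) trivial
      ⟨h.card_color, h.color_binding⟩ hf
  | assocMerge a b c =>
    exact Model.exists_lower (m := .coassocMerge a b c) trivial
      ⟨h.card_color, h.color_binding⟩ hf
  | coassocMerge a b c =>
    exact Model.exists_lower (m := .assocMerge a b c) trivial
      ⟨h.card_color, h.color_binding⟩ hf
  | digonCup a b =>
    exact Model.exists_lower (m := .digonCap a b) trivial
      ⟨h.card_color, h.color_binding⟩ hf
  | digonCap a b =>
    exact Model.exists_lower (m := .digonCup a b) trivial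
      ⟨h.card_color, h.color_binding⟩ hf
  | zip a b =>
    exact Model.exists_lower (m := .unzip a b) trivial
      ⟨h.card_color, h.color_binding⟩ hf
  | unzip a b =>
    exact Model.exists_lower (m := .zip a b) trivial
      ⟨h.card_color, h.color_binding⟩ hf
  | _ => exact hm.elim

/-- Bottom and top are connected on each pigment and are nonempty together, so the injection of
`Tangle.subCount_glue_le` exists in both directions. -/
theorem Model.subCount_eq {m : Model} (hm : m.IsBinding) (K : Tangle m.piece.wOut m.piece.wIn)
    (c : Coloring (FoamComplex.basic m.piece K) N) (i : Fin N) :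
    (K.glue m.piece.bot).subCount
        (Sum.elim (fun e => i ∈ c.color (.inl e)) fun e => i ∈ c.color (.inr (m.piece.lower e))) =
      (K.glue m.piece.top).subCount
        (Sum.elim (fun e => i ∈ c.color (.inl e)) fun e => i ∈ c.color (.inr (m.piece.upper e))) := by
  have h := Coloring.isColoring c
  have hin (p) : i ∈ c.color (.inr (m.piece.lower (m.piece.bot.start.symm (.boundary p)))) ↔
      i ∈ c.color (.inr (m.piece.upper (m.piece.top.start.symm (.boundary p)))) := by
    rw [m.piece.wall_in]
  have hout (p) : i ∈ c.color (.inr (m.piece.lower (m.piece.bot.finish.symm (.boundary p)))) ↔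
      i ∈ c.color (.inr (m.piece.upper (m.piece.top.finish.symm (.boundary p)))) := by
    rw [m.piece.wall_out]
  refine le_antisymm ?_ ?_
  · exact Tangle.subCount_glue_le K _ ((Model.isColoring_top h).isSub i)
      (Model.isPreconnected_bot hm h i) hin hout fun e he => Model.exists_upper hm h he
  · exact Tangle.subCount_glue_le K _ ((Model.isColoring_bot h).isSub i)
      (Model.isPreconnected_top hm h i) (fun p => (hin p).symm) (fun p => (hout p).symm)
      fun e he => Model.exists_lower hm h he

theorem Sum.elim_comp_map {α β γ : Type} (A : α ⊕ γ → Prop) (f : β → γ) :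
    (fun e => A (Sum.map id f e)) = Sum.elim (fun e => A (.inl e)) fun e => A (.inr (f e)) := by
  funext e
  rcases e with e | e <;> rfl

/-- Exponential form of "circles below plus births equals circles above plus deaths". Births and
deaths stand on opposite sides, so that no subtraction in `ℕ` occurs. -/
theorem GoodFoam.subCount_mul {Γ Γ' : Web} (F : GoodFoam Γ Γ') (hF : F.IsSpherical)
    (c : Coloring F.complex N) (i : Fin N) :
    Γ.subCount (fun e => i ∈ c.color (F.complex.lower e)) *
        2 ^ ((F.pieces c.color).map (birthWeight i)).sum =
      Γ'.subCount (fun e => i ∈ c.color (F.complex.upper e)) *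
        2 ^ ((F.pieces c.color).map (deathWeight i)).sum := by
  induction F with
  | isotopy φ =>
    refine congrArg (· * 2 ^ 0) (Eq.trans ?_
      (φ.subCount_eq fun e => i ∈ Coloring.color c (φ.edge.symm e)))
    exact congrArg _ (funext fun e => congrArg (fun e => i ∈ Coloring.color c e)
      (φ.edge.symm_apply_apply e).symm)
  | subdivide Γ e =>
    exact congrArg (· * 2 ^ 0) (Γ.subCount_subdivide e fun e => i ∈ Coloring.color c e).symm
  | unsubdivide Γ e =>
    exact congrArg (· * 2 ^ 0) (Γ.subCount_subdivide e fun e => i ∈ Coloring.color c e)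
  | basic m K =>
    have hbot : (K.glue m.piece.bot).subCount
        (fun e => i ∈ Coloring.color c (Sum.map id m.piece.lower e)) = _ :=
      congrArg _ (Sum.elim_comp_map (fun f => i ∈ Coloring.color c f) m.piece.lower)
    have htop : (K.glue m.piece.top).subCount
        (fun e => i ∈ Coloring.color c (Sum.map id m.piece.upper e)) = _ :=
      congrArg _ (Sum.elim_comp_map (fun f => i ∈ Coloring.color c f) m.piece.upper)
    refine Eq.trans (congrArg₂ (fun x y => x * 2 ^ y) hbot (Multiset.sum_singleton _))
      (Eq.trans ?_ (congrArg₂ (fun x y => x * 2 ^ y) htop (Multiset.sum_singleton _)).symm)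
    by_cases hm : m.IsBinding
    · refine congrArg₂ (fun x y => x * 2 ^ y) (Model.subCount_eq hm K c i) ?_
      cases m <;> first | rfl | exact hm.elim
    · cases m with
      | cup a =>
        exact (K.subCount_glue_circle (fun e => i ∈ Coloring.color c (.inl e)) a
          (i ∈ Coloring.color c (.inr ()))).symm.trans (mul_one _).symm
      | cap a =>
        exact (mul_one _).trans (K.subCount_glue_circle (fun e => i ∈ Coloring.color c (.inl e)) a
          (i ∈ Coloring.color c (.inr ())))
      | saddle a => exact absurd rfl (hF a)
      | _ => exact absurd trivial hm
  | @comp Γ Γ' Γ'' F G ihF ihG =>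
    have h : Γ'.subCount (fun e => i ∈ (Coloring.snd c).color (G.complex.lower e)) =
        Γ'.subCount (fun e => i ∈ (Coloring.fst c).color (F.complex.upper e)) :=
      congrArg Γ'.subCount (funext fun e => by rw [Coloring.fst_upper c e])
    have h1 := ihF hF.1 (Coloring.fst c)
    have h2 := ihG hF.2 (Coloring.snd c)
    rw [h] at h2
    have hsum (w : Piece N → ℕ) : (((F.comp G).pieces c.color).map w).sum =
        ((F.pieces (Coloring.fst c).color).map w).sum +
          ((G.pieces (Coloring.snd c).color).map w).sum := by
      rw [← Multiset.sum_add, ← Multiset.map_add]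
      rfl
    rw [hsum, hsum, pow_add, pow_add, ← mul_assoc]
    refine (congrArg (· * _) h1).trans ((mul_right_comm _ _ _).trans
      ((congrArg (· * _) h2).trans ?_))
    exact (mul_right_comm _ _ _).trans (mul_assoc _ _ _)

end Circle

end Invariants

/-! ### Vanishing of the error terms and parity. -/

section Closed

variable {N : ℕ}

/-! ### Consequences for closed foams -/

/-- The empty web has one union of components, the empty one; what remains of
`GoodFoam.subCount_mul` is an equality of powers of two. -/
theorem GoodFoam.sum_birthWeight (F : GoodFoam nothing nothing) (hF : F.IsSpherical)
    (c : Coloring F.complex N) (i : Fin N) :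
    ((F.pieces c.color).map (birthWeight i)).sum =
      ((F.pieces c.color).map (deathWeight i)).sum := by
  have h := F.subCount_mul hF c i
  rw [Tangle.subCount_nothing, Tangle.subCount_nothing, one_mul, one_mul] at h
  exact Nat.pow_right_injective le_rfl h

theorem sum_map_sum_zsmul {ι X M : Type*} [Fintype ι] [AddCommGroup M] (s : Multiset X)
    (e : ι → X → ℤ) (h : ι → M) :
    (s.map fun x => ∑ p, e p x • h p).sum = ∑ p, (s.map (e p)).sum • h p := by
  induction s using Multiset.induction_on with
  | empty => simp
  | cons x s ih => simp [ih, add_smul, Finset.sum_add_distrib]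

/-- The variation, in a basic foam, of the sum of a function of a pigment over all circles with this
pigment. -/
def circleWeight {M : Type*} [AddCommGroup M] (δ : Fin N → M) : Piece N → M
  | ⟨.cup _, c⟩ => ∑ i ∈ c (), δ i
  | ⟨.cap _, c⟩ => -∑ i ∈ c (), δ i
  | _ => 0

theorem circleWeight_eq {M : Type*} [AddCommGroup M] (δ : Fin N → M) (x : Piece N) :
    circleWeight δ x = ∑ i, ((birthWeight i x : ℤ) - deathWeight i x) • δ i := by
  obtain ⟨m, c⟩ := x
  cases m <;> simp [circleWeight, birthWeight, deathWeight, ite_smul]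

/-- The coefficient of each `δ i` is births minus deaths of the pigment `i`, which is zero. -/
theorem GoodFoam.sum_circleWeight {M : Type*} [AddCommGroup M] (F : GoodFoam nothing nothing)
    (hF : F.IsSpherical) (c : Coloring F.complex N) (δ : Fin N → M) :
    ((F.pieces c.color).map (circleWeight δ)).sum = 0 := by
  rw [funext (circleWeight_eq δ), sum_map_sum_zsmul]
  refine Finset.sum_eq_zero fun i _ => ?_
  have h := F.sum_birthWeight hF c i
  have h' (w : Piece N → ℕ) : ((F.pieces c.color).map fun x => (w x : ℤ)).sum =
      (((F.pieces c.color).map w).sum : ℕ) := by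
    rw [Nat.cast_multiset_sum, Multiset.map_map]
    rfl
  rw [Multiset.sum_map_sub, h', h', h, sub_self, zero_smul]

theorem pairSum_indicator {M : Type*} [AddCommMonoidWithOne M] (i j : Fin N)
    (S T : Finset (Fin N)) :
    pairSum (fun a b => if a = i ∧ b = j then (1 : M) else 0) S T =
      if i ∈ S ∧ j ∈ T then 1 else 0 := by
  simp [pairSum, ite_and]

/-- Modulo `2` signs disappear and "exactly one of `i`, `j`" is additive, so local Euler
contributions become combinations of the two telescoping weights. The indicators select the ordered
pairs `(i, j)` and `(j, i)`. -/
theorem eulerWeight_zmod_two {x : Piece N} (i j : Fin N) :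
    ((eulerWeight i j x : ℤ) : ZMod 2) =
      circleWeight (Pi.single i 1) x + circleWeight (Pi.single j 1) x +
        splitWeight (fun a b => if a = i ∧ b = j then 1 else 0) x +
        splitWeight (fun a b => if a = j ∧ b = i then 1 else 0) x := by
  obtain ⟨m, c⟩ := x
  have h2 : (1 : ZMod 2) + 1 = 0 := by decide
  have h3 : (-1 : ZMod 2) = 1 := by decide
  have hi (l : Fin N) (S : Finset (Fin N)) :
      ∑ a ∈ S, (Pi.single l 1 : Fin N → ZMod 2) a = if l ∈ S then 1 else 0 := by
    simp [Pi.single_apply]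
  have key (S : Finset (Fin N)) : ((ind (Xor (i ∈ S) (j ∈ S)) : ℤ) : ZMod 2) =
      (if i ∈ S then 1 else 0) + if j ∈ S then 1 else 0 := by
    by_cases h : i ∈ S <;> by_cases h' : j ∈ S <;> simp [h, h', ind, Xor, h2]
  have key' (p q : Prop) [Decidable p] [Decidable q] : ((ind p + ind q : ℤ) : ZMod 2) =
      (if p then 1 else 0) + if q then 1 else 0 := by
    simp [ind]
  have hneg (y : ZMod 2) : -y = y := by revert y; decide
  cases m with
  | digonCup a b =>
    simp only [eulerWeight, circleWeight, splitWeight, pairSum_indicator, key', zero_add]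
  | digonCap a b =>
    simp only [eulerWeight, circleWeight, splitWeight, pairSum_indicator, key', zero_add, hneg]
  | zip a b =>
    simp only [eulerWeight, circleWeight, splitWeight, pairSum_indicator, Int.cast_neg, key',
      zero_add, hneg]
  | unzip a b =>
    simp only [eulerWeight, circleWeight, splitWeight, pairSum_indicator, Int.cast_neg, key',
      zero_add, hneg]
  | cup a => simp only [eulerWeight, circleWeight, splitWeight, hi, key, add_zero]
  | cap a => simp only [eulerWeight, circleWeight, splitWeight, hi, key, add_zero, hneg]
  | _ => simp only [eulerWeight, circleWeight, splitWeight, Int.cast_zero, add_zero]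

/-- Bichrome surfaces are orientable, hence have even Euler characteristics. -/
theorem GoodFoam.even_bichromeEuler (F : GoodFoam nothing nothing) (hF : F.IsSpherical)
    (c : Coloring F.complex N) (i j : Fin N) : Even (c.bichromeEuler i j) := by
  rw [← ZMod.intCast_eq_zero_iff_even, F.euler_eq hF c, Int.cast_multiset_sum, Multiset.map_map]
  simp only [Function.comp_def, eulerWeight_zmod_two, Multiset.sum_map_add]
  rw [F.sum_circleWeight hF, F.sum_circleWeight hF, F.sum_splitWeight hF, F.sum_splitWeight hF]
  simp

/-- Euler characteristics are indexed by `i < j`, dots by pairs with a left and a right entry.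
Symmetry of `h` folds the two orders together. -/
theorem sum_ordered_pairs {M : Type*} [AddCommGroup M] (h : Fin N → Fin N → M)
    (hs : ∀ i j, h i j = h j i) {S T : Finset (Fin N)} (hd : Disjoint S T) :
    ∑ p : {p : Fin N × Fin N // p.1 < p.2},
      (ind (p.1.1 ∈ S ∧ p.1.2 ∈ T) + ind (p.1.2 ∈ S ∧ p.1.1 ∈ T)) • h p.1.1 p.1.2 =
        pairSum h S T := by
  classical
  let f : Fin N × Fin N → M := fun p => ind (p.1 ∈ S ∧ p.2 ∈ T) • h p.1 p.2
  have h1 : pairSum h S T = ∑ p, f p := by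
    rw [Fintype.sum_prod_type]
    simp [pairSum, f, ind, ite_and, ite_smul, Finset.sum_ite_mem]
  have h2 (g : Fin N × Fin N → M) : ∑ p : {p : Fin N × Fin N // p.1 < p.2}, g p.1 =
      ∑ p : Fin N × Fin N, if p.1 < p.2 then g p else 0 := by
    rw [← Finset.sum_filter]
    exact (Finset.sum_subtype _ (by simp) _).symm
  have h3 : ∑ p : Fin N × Fin N, (if p.1 < p.2 then f p.swap else 0) =
      ∑ p : Fin N × Fin N, if p.2 < p.1 then f p else 0 :=
    Fintype.sum_equiv (Equiv.prodComm _ _) _ _ fun p => rfl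
  rw [h1]
  have h4 : ∀ p : {p : Fin N × Fin N // p.1 < p.2},
      (ind (p.1.1 ∈ S ∧ p.1.2 ∈ T) + ind (p.1.2 ∈ S ∧ p.1.1 ∈ T)) • h p.1.1 p.1.2 =
        f p.1 + f p.1.swap := fun p => by
    simp only [f, add_smul, Prod.fst_swap, Prod.snd_swap, hs p.1.2 p.1.1]
  simp only [h4, Finset.sum_add_distrib]
  rw [h2 f, h2 fun p => f p.swap, h3, ← Finset.sum_add_distrib]
  refine Finset.sum_congr rfl fun p _ => ?_
  rcases lt_trichotomy p.1 p.2 with hp | hp | hp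
  · simp [hp, hp.not_gt]
  -- The diagonal, absent on the left-hand side, contributes nothing because the two sets are
  -- disjoint.
  · have : ¬(p.1 ∈ S ∧ p.2 ∈ T) := fun hx => Finset.disjoint_left.1 hd hx.1 (hp ▸ hx.2)
    have hf : f p = 0 := by simp only [f, ind, if_neg this, zero_smul]
    rw [if_neg hp.not_lt, if_neg hp.not_gt, hf, add_zero]
  · simp [hp, hp.not_gt]

end Closed

/-! ### Comparison of the action with the derivation. -/

section Main

open MvPolynomial

variable {k : Type u} [CommRing k] {N : ℕ}

/-! ### The evaluation of the action on basic foams -/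

variable (k) in
/-- The summand of `p_n(S) p_0(T)`. -/
def leftPow (n : ℤ) (i j : Fin N) : MvPolynomial (Fin N) k := intPow k n i * intPow k 0 j

variable (k) in
/-- The summand of `p_0(S) p_n(T)`. -/
def rightPow (n : ℤ) (i j : Fin N) : MvPolynomial (Fin N) k := intPow k 0 i * intPow k n j

/-- The evaluation of `bindingTerms` and of `diskTerms`. -/
def pairTerms (n : ℤ) (x y z : k) (S T : Finset (Fin N)) : MvPolynomial (Fin N) k :=
  x • pairSum (leftPow k n) S T + y • pairSum (rightPow k n) S T +
    z • pairSum (complete k n) S T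

/-- The evaluation of the action of `L_n` on a colored basic foam other than a saddle. -/
def actWeight [Invertible (2 : k)] (θ : Parameters k) (n : ℤ) : Piece N → MvPolynomial (Fin N) k
  | ⟨.digonCup _ _, c⟩ => pairTerms n (θ.lam n) (θ.mu n) θ.s (c YFace.left) (c YFace.right)
  | ⟨.digonCap _ _, c⟩ =>
      pairTerms n (-θ.lam n) (-θ.mu n) (1 - θ.s) (c YFace.left) (c YFace.right)
  | ⟨.zip _ _, c⟩ => pairTerms n (θ.lam n) (θ.mu n) (-(1 - θ.s)) (c YFace.left) (c YFace.right)
  | ⟨.unzip _ _, c⟩ => pairTerms n (-θ.lam n) (-θ.mu n) (-θ.s) (c YFace.left) (c YFace.right)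
  | ⟨.cup _, c⟩ => pairTerms n (-θ.nu n) (θ.nu n) (⅟2) (c ()) (c ())ᶜ
  | ⟨.cap _, c⟩ => pairTerms n (θ.nu n) (-θ.nu n) (⅟2) (c ()) (c ())ᶜ
  | _ => 0

theorem Model.termsEval_act [Invertible (2 : k)] (θ : Parameters k) (n : ℤ) {m : Model}
    (hm : ∀ a, m ≠ .saddle a) (col : m.piece.Face → Finset (Fin N))
    (hcol : ∀ f, (col f).card = m.piece.thickness f) :
    termsEval col hcol (m.act θ n) = actWeight θ n ⟨m, col⟩ := by
  cases m with
  | digonCup a b => exact termsEval_bindingTerms (Face := YFace) col hcol n _ _ _ _ _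
  | digonCap a b => exact termsEval_bindingTerms (Face := YFace) col hcol n _ _ _ _ _
  | zip a b => exact termsEval_bindingTerms (Face := YFace) col hcol n _ _ _ _ _
  | unzip a b => exact termsEval_bindingTerms (Face := YFace) col hcol n _ _ _ _ _
  | cup a =>
    exact (termsEval_diskTerms (Face := Unit) col hcol n _ _ _ _).trans
      (congrArg (· + _) (add_comm _ _))
  | cap a =>
    exact (termsEval_diskTerms (Face := Unit) col hcol n _ _ _ _).trans
      (congrArg (· + _) (add_comm _ _))
  | saddle a => exact absurd rfl (hm a)
  | _ => exact map_zero _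

theorem GoodFoam.termsEval_act [Invertible (2 : k)] (θ : Parameters k) (n : ℤ) {Γ Γ' : Web}
    (F : GoodFoam Γ Γ') (hF : F.IsSpherical) (c : Coloring F.complex N) :
    termsEval c.color c.card_color (F.act θ n) =
      ((F.pieces c.color).map (actWeight θ n)).sum := by
  induction F with
  | isotopy φ => exact map_zero _
  | subdivide Γ e => exact map_zero _
  | unsubdivide Γ e => exact map_zero _
  | basic m K =>
    refine (termsEval_mapDomain _ _ (fun f => Coloring.color c (.inr f))
      (fun f => Coloring.card_color c (.inr f)) _ (fun d => ?_) _).trans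
      ((Model.termsEval_act θ n hF _ _).trans (Multiset.sum_singleton _).symm)
    refine (Fintype.prod_sum_type _).trans ?_
    exact (congrArg (· * _) (Finset.prod_eq_one fun e _ => Decor.evalAt_one _ _)).trans (one_mul _)
  | comp F G ihF ihG =>
    have hsum : (((F.comp G).pieces c.color).map (actWeight θ n)).sum =
        ((F.pieces (Coloring.fst c).color).map (actWeight θ n)).sum +
          ((G.pieces (Coloring.snd c).color).map (actWeight θ n)).sum := by
      rw [← Multiset.sum_add, ← Multiset.map_add]
      rfl
    rw [hsum, ← ihF hF.1 (Coloring.fst c), ← ihG hF.2 (Coloring.snd c)]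
    refine (map_add _ _ _).trans (congrArg₂ _ ?_ ?_)
    · refine termsEval_mapDomain _ _ _ (Coloring.fst c).card_color _ (fun d => ?_) _
      refine (Fintype.prod_sum_type _).trans ?_
      exact (congrArg (_ * ·) (Finset.prod_eq_one fun e _ => Decor.evalAt_one _ _)).trans
        (mul_one _)
    · refine termsEval_mapDomain _ _ _ (Coloring.snd c).card_color _ (fun d => ?_) _
      refine (Fintype.prod_sum_type _).trans ?_
      exact (congrArg (· * _) (Finset.prod_eq_one fun e _ => Decor.evalAt_one _ _)).trans
        (one_mul _)

/-! ### The evaluation of the action on closed foams -/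

theorem ind_xor (p q : Prop) : ind (Xor p q) = ind (p ∧ ¬q) + ind (q ∧ ¬p) := by
  by_cases hp : p <;> by_cases hq : q <;> simp [hp, hq, ind, Xor]

/-- The antisymmetric summand cancels over `C × C`, so the complement may be replaced by the set of
all pigments. The result is a sum over single pigments of `C`, to which the count of circles
applies. -/
theorem pairSum_compl {M : Type*} [AddCommGroup M] (γ : Fin N → Fin N → M) (C : Finset (Fin N)) :
    pairSum (fun i j => γ j i) C Cᶜ - pairSum γ C Cᶜ = ∑ i ∈ C, ∑ j, (γ j i - γ i j) := by
  have h : ∑ i ∈ C, ∑ j ∈ C, γ j i = ∑ i ∈ C, ∑ j ∈ C, γ i j := Finset.sum_comm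
  simp only [pairSum, ← Finset.sum_add_sum_compl C, Finset.sum_sub_distrib, Finset.sum_add_distrib,
    h]
  abel

/-- The part of the action on basic foams which involves bindings and vanishes on closed foams. -/
def bindingPart (θ : Parameters k) (n : ℤ) (i j : Fin N) : MvPolynomial (Fin N) k :=
  (2 * θ.lam n) • leftPow k n i j + (2 * θ.mu n) • rightPow k n i j +
    (2 * θ.s - 1) • complete k n i j

/-- The part of the action on basic foams which involves circles and vanishes on closed foams. -/
def circlePart (θ : Parameters k) (n : ℤ) (i : Fin N) : MvPolynomial (Fin N) k :=
  (2 * θ.nu n) • ∑ j, (rightPow k n i j - leftPow k n i j)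

theorem pairSum_bindingPart (θ : Parameters k) (n : ℤ) (S T : Finset (Fin N)) :
    pairSum (bindingPart θ n) S T =
      pairTerms n (2 * θ.lam n) (2 * θ.mu n) (2 * θ.s - 1) S T := by
  simp only [pairTerms, pairSum, bindingPart, Finset.sum_add_distrib, Finset.smul_sum]

theorem sum_circlePart (θ : Parameters k) (n : ℤ) (C : Finset (Fin N)) :
    ∑ i ∈ C, circlePart θ n i = (2 * θ.nu n) • (pairSum (rightPow k n) C Cᶜ -
      pairSum (leftPow k n) C Cᶜ) := by
  have hr : (fun i j => leftPow k n j i) = rightPow (N := N) k n :=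
    funext fun i => funext fun j => mul_comm _ _
  have h := pairSum_compl (leftPow k n) C
  rw [hr] at h
  rw [h, Finset.smul_sum]
  refine Finset.sum_congr rfl fun i _ => ?_
  simp only [circlePart, ← hr]

/-- Local comparison. The coefficients of `complete` for digon-cup, digon-cap, zip and unzip are `2s
= 1 + (2s - 1)`, `2(1 - s) = 1 - (2s - 1)`, `-2(1 - s) = -1 + (2s - 1)` and `-2s = -1 - (2s - 1)`:
an Euler contribution `±1` and a telescoping remainder. For cups and caps the coefficient `⅟2` is
already half the Euler contribution, and the terms in `nu` telescope. -/
theorem two_smul_actWeight [Invertible (2 : k)] (θ : Parameters k) (n : ℤ) {x : Piece N}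
    (hx : x.1.piece.IsColoring x.2) (hs : ∀ a, x.1 ≠ .saddle a) :
    (2 : k) • actWeight θ n x =
      ∑ p : {p : Fin N × Fin N // p.1 < p.2},
        eulerWeight p.1.1 p.1.2 x • complete k n p.1.1 p.1.2 +
      splitWeight (bindingPart θ n) x + circleWeight (circlePart θ n) x := by
  have h2 : (2 : k) * ⅟2 = 1 := mul_invOf_self _
  obtain ⟨m, c⟩ := x
  have hY (S T : Finset (Fin N)) (hd : Disjoint S T) :=
    sum_ordered_pairs (complete k n) (complete_comm n) hd
  have hC (C : Finset (Fin N)) : ∑ p : {p : Fin N × Fin N // p.1 < p.2},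
      ind (Xor (p.1.1 ∈ C) (p.1.2 ∈ C)) • complete k n p.1.1 p.1.2 =
        pairSum (complete k n) C Cᶜ := by
    rw [← hY C Cᶜ disjoint_compl_right]
    simp only [ind_xor, Finset.mem_compl]
  cases m with
  | digonCup a b =>
    have hd : Disjoint (c YFace.left) (c YFace.right) := hx.disjoint ()
    simp only [actWeight, eulerWeight, splitWeight, circleWeight, hY _ _ hd, pairSum_bindingPart,
      pairTerms]
    module
  | digonCap a b =>
    have hd : Disjoint (c YFace.left) (c YFace.right) := hx.disjoint ()
    simp only [actWeight, eulerWeight, splitWeight, circleWeight, hY _ _ hd, pairSum_bindingPart,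
      pairTerms]
    module
  | zip a b =>
    have hd : Disjoint (c YFace.left) (c YFace.right) := hx.disjoint ()
    simp only [actWeight, eulerWeight, splitWeight, circleWeight, neg_smul,
      Finset.sum_neg_distrib, hY _ _ hd, pairSum_bindingPart, pairTerms]
    module
  | unzip a b =>
    have hd : Disjoint (c YFace.left) (c YFace.right) := hx.disjoint ()
    simp only [actWeight, eulerWeight, splitWeight, circleWeight, neg_smul,
      Finset.sum_neg_distrib, hY _ _ hd, pairSum_bindingPart, pairTerms]
    module
  | cup a =>
    simp only [actWeight, eulerWeight, splitWeight, circleWeight, hC, sum_circlePart, pairTerms,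
      smul_add, smul_smul, h2]
    module
  | cap a =>
    simp only [actWeight, eulerWeight, splitWeight, circleWeight, hC, sum_circlePart, pairTerms,
      smul_add, smul_smul, h2]
    module
  | saddle a => exact absurd rfl (hs a)
  | _ => simp [actWeight, eulerWeight, splitWeight, circleWeight]

theorem GoodFoam.termsEval_act_closed [Invertible (2 : k)] (θ : Parameters k) (n : ℤ)
    (F : GoodFoam nothing nothing) (hF : F.IsSpherical) (c : Coloring F.complex N) :
    termsEval c.color c.card_color (F.act θ n) =
      ∑ p : {p : Fin N × Fin N // p.1 < p.2},
        (c.bichromeEuler p.1.1 p.1.2 / 2) • complete k n p.1.1 p.1.2 := by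
  have h : (2 : k) • ((F.pieces c.color).map (actWeight θ n)).sum =
      ∑ p : {p : Fin N × Fin N // p.1 < p.2},
        c.bichromeEuler p.1.1 p.1.2 • complete k n p.1.1 p.1.2 := by
    rw [Multiset.smul_sum, Multiset.map_map]
    simp only [Function.comp_def]
    rw [Multiset.map_congr rfl fun x hx => two_smul_actWeight θ n
      (F.isColoring_of_mem_pieces hF c x hx).1 (F.isColoring_of_mem_pieces hF c x hx).2]
    rw [Multiset.sum_map_add, Multiset.sum_map_add, F.sum_splitWeight hF, F.sum_circleWeight hF,
      add_zero, add_zero, sum_map_sum_zsmul]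
    exact Finset.sum_congr rfl fun p _ => by rw [F.euler_eq hF c]
  rw [F.termsEval_act θ n hF c]
  -- Cancellation of the factor two uses its invertibility in `k`.
  have h' : ∀ x y : MvPolynomial (Fin N) k, (2 : k) • x = (2 : k) • y → x = y := fun x y hxy => by
    rw [← one_smul k x, ← one_smul k y, ← invOf_mul_self (2 : k), mul_smul, mul_smul, hxy]
  refine h' _ _ (h.trans ?_)
  rw [Finset.smul_sum]
  refine Finset.sum_congr rfl fun p _ => ?_
  -- By parity the integer division by two in the exponent of `Q` is exact.
  conv_lhs => rw [← Int.two_mul_ediv_two_of_even (F.even_bichromeEuler hF c p.1.1 p.1.2)]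
  rw [mul_smul, two_smul, two_smul]

/-! ### The action and the evaluation -/

/-- The sign drops out, and the minus from inverting `Q` cancels the minus in the logarithmic
derivative of its factors. -/
theorem logDeriv_zpow_mul_inv_prod {A ι : Type*} [CommRing A] [Algebra k A] [Fintype ι]
    (D : Derivation k A A) (s : ℤ) (u : ι → Aˣ) (e : ι → ℤ) (a : ι → A)
    (h : ∀ p, (logDeriv D (u p)).toAdd = -a p) :
    (logDeriv D ((-1) ^ s * (∏ p, u p ^ e p)⁻¹)).toAdd = ∑ p, e p • a p := by
  simp only [map_mul, map_zpow, map_inv, map_prod, logDeriv_neg_one, one_zpow, one_mul, toAdd_inv,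
    toAdd_prod, toAdd_zpow, h, smul_neg, Finset.sum_neg_distrib, neg_neg]

theorem derivation_prod {A ι : Type*} [CommRing A] [Algebra k A] [DecidableEq ι]
    (D : Derivation k A A) (s : Finset ι) (f : ι → A) :
    D (∏ i ∈ s, f i) = ∑ i ∈ s, (∏ j ∈ s.erase i, f j) * D (f i) := by
  induction s using Finset.induction_on with
  | empty => simp
  | insert a s ha ih =>
    rw [Finset.prod_insert ha, Derivation.leibniz, ih, Finset.sum_insert ha,
      Finset.erase_insert ha, smul_eq_mul, smul_eq_mul, Finset.mul_sum, add_comm]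
    congr 1
    refine Finset.sum_congr rfl fun i hi => ?_
    rw [Finset.erase_insert_of_ne (ne_of_mem_of_not_mem hi ha).symm,
      Finset.prod_insert fun h => ha (Finset.mem_of_mem_erase h), mul_assoc]

theorem logDeriv_denominator (F : DecoratedFoam k N) (c : Coloring F.foam.complex N) (n : ℤ) :
    (logDeriv (wittRat k N n) ((-1) ^ c.signExponent * (F.denominator c)⁻¹)).toAdd =
      algebraMap _ _ (∑ p : {p : Fin N × Fin N // p.1 < p.2},
        (c.bichromeEuler p.1.1 p.1.2 / 2) • complete k n p.1.1 p.1.2) := by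
  rw [map_sum]
  refine (logDeriv_zpow_mul_inv_prod _ _ _ _ _ fun p => logDeriv_diffUnit n p).trans ?_
  exact Finset.sum_congr rfl fun p _ => (map_zsmul (algebraMap _ _) _ _).symm

/-- The coefficient of the polynomial in a colored evaluation. -/
def DecoratedFoam.unit (F : DecoratedFoam k N) (c : Coloring F.foam.complex N) : (RatFun k N)ˣ :=
  (-1) ^ c.signExponent * (F.denominator c)⁻¹

theorem DecoratedFoam.numerator_eq (F : DecoratedFoam k N) (c : Coloring F.foam.complex N) :
    F.numerator c = dotsEval c.color c.card_color F.decor := rfl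

theorem DecoratedFoam.evaluation_eq (F : DecoratedFoam k N) :
    F.evaluation = ∑ c, (F.unit c : RatFun k N) * algebraMap _ _ (F.numerator c) := rfl

/-- Dots change neither the complex nor its colorings, so they only multiply the numerator in each
summand. -/
theorem DecoratedFoam.evaluation_mul (F : DecoratedFoam k N)
    (t : Dots k N F.foam.complex.thickness →₀ k) :
    WittFoam.evaluation k N (t.mapDomain fun d => ⟨F.foam, d * F.decor⟩) =
      ∑ c, (F.unit c : RatFun k N) *
        algebraMap _ _ (termsEval c.color c.card_color t * F.numerator c) := by
  rw [WittFoam.evaluation, Finsupp.linearCombination_mapDomain]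
  induction t using Finsupp.induction_linear with
  | zero => simp
  | add t t' ht ht' => simp only [map_add, ht, ht', add_mul, mul_add, Finset.sum_add_distrib]
  | single d a =>
    rw [Finsupp.linearCombination_single, Function.comp_apply, DecoratedFoam.evaluation_eq,
      Finset.smul_sum]
    refine Finset.sum_congr rfl fun c _ => ?_
    rw [termsEval_single, DecoratedFoam.numerator_eq, DecoratedFoam.numerator_eq]
    change a • (_ * algebraMap _ _ (dotsEval c.color c.card_color (d * F.decor))) = _
    rw [map_mul, smul_mul_assoc, ← mul_smul_comm]
    congr 1
    exact (map_smul (IsScalarTower.toAlgHom k (MvPolynomial (Fin N) k) (RatFun k N)) a _).symm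

-- Leibniz rule over the faces. It accounts for the part of `L_n` that acts on decorations.
open Classical in
theorem DecoratedFoam.witt_numerator (F : DecoratedFoam k N) (c : Coloring F.foam.complex N)
    (n : ℤ) : witt k n (F.numerator c) =
      ∑ f, dotsEval c.color c.card_color
        (Function.update F.decor f (Decor.witt n (F.decor f))) := by
  rw [DecoratedFoam.numerator, derivation_prod]
  refine Finset.sum_congr rfl fun f _ => ?_
  change _ = ∏ g, _
  rw [← Finset.mul_prod_erase _ _ (Finset.mem_univ f), Function.update_self, Decor.evalAt_witt,
    mul_comm]
  congr 1
  refine Finset.prod_congr rfl fun g hg => ?_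
  rw [Function.update_of_ne (Finset.ne_of_mem_erase hg)]

theorem derivation_unit_mul {A : Type*} [CommRing A] [Algebra k A] (D : Derivation k A A)
    (u : Aˣ) (p : A) : D (u * p) = u * D p + u * ((logDeriv D u).toAdd * p) := by
  rw [Derivation.leibniz, derivation_unit]
  simp only [smul_eq_mul]
  ring

-- The equality holds for each coloring separately: the decoration terms match the derivative of the
-- numerator, and the dots on the underlying foam match the logarithmic derivative of the
-- coefficient.
open Classical in
theorem DecoratedFoam.evaluation_act [Invertible (2 : k)] (θ : Parameters k) (n : ℤ)
    (F : DecoratedFoam k N) (hF : F.foam.IsSpherical) :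
    WittFoam.evaluation k N (F.act θ n) = wittRat k N n F.evaluation := by
  rw [DecoratedFoam.act, map_add, DecoratedFoam.evaluation_mul, DecoratedFoam.evaluation_eq,
    map_sum, map_sum]
  have h1 : ∀ G : DecoratedFoam k N,
      WittFoam.evaluation k N (Finsupp.single G 1) = G.evaluation := fun G => by
    rw [WittFoam.evaluation, Finsupp.linearCombination_single, one_smul]
  simp only [h1, DecoratedFoam.evaluation_eq]
  -- Move the sum over colorings outside the sum over faces, so that the comparison can be made for
  -- one coloring.
  rw [Finset.sum_comm' (t' := Finset.univ) (s' := fun _ => Finset.univ) (by simp)]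
  rw [← Finset.sum_add_distrib]
  refine Finset.sum_congr rfl fun c _ => ?_
  rw [derivation_unit_mul, wittRat_algebraMap, F.witt_numerator, map_sum, Finset.mul_sum]
  refine congrArg₂ (· + ·) rfl ?_
  rw [F.foam.termsEval_act_closed θ n hF c, map_mul]
  exact congrArg (fun x => (F.unit c : RatFun k N) * (x * algebraMap _ _ (F.numerator c)))
    (logDeriv_denominator F c n).symm

end Main

end

end WittFoam

theorem proposition4p2 {k : Type u} [CommRing k] [Invertible (2 : k)] (N : ℕ)
    (θ : WittFoam.Parameters k) (F : WittFoam.DecoratedFoam k N) (hF : F.foam.IsSpherical)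
    (n : ℤ) (hn : -1 ≤ n) :
    WittFoam.evaluation k N (WittFoam.foamL N θ n (Finsupp.single F 1)) =
        WittFoam.wittRat k N n (WittFoam.evaluation k N (Finsupp.single F 1)) ∧
      ∀ p : MvPolynomial (Fin N) k, p.IsSymmetric →
        WittFoam.evaluation k N (Finsupp.single F 1) = algebraMap _ _ p →
        (WittFoam.witt k n p).IsSymmetric ∧
          WittFoam.evaluation k N (WittFoam.foamL N θ n (Finsupp.single F 1)) =
            algebraMap _ _ (WittFoam.witt k n p) := by
  have h : WittFoam.evaluation k N (WittFoam.foamL N θ n (Finsupp.single F 1)) =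
      WittFoam.wittRat k N n (WittFoam.evaluation k N (Finsupp.single F 1)) := by
    rw [WittFoam.foamL, Finsupp.linearCombination_single, one_smul, F.evaluation_act θ n hF,
      WittFoam.evaluation, Finsupp.linearCombination_single, one_smul]
  exact ⟨h, fun p hp hF' => ⟨WittFoam.witt_isSymmetric n hp, by
    rw [h, hF', WittFoam.wittRat_algebraMap]⟩⟩
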